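/- **Setting.** A real RAM algorithm $A$ takes a real vector and an integer vector as input; two inputs $(a,b),(a',b)$ are equivalent for $A$ if all comparisons made in the two executions give the same results. A resource augmentation problem assigns to every input $I$ of size $n$ and every augmentation parameter $\alpha\in[0,1]$ for which the augmentation is defined a solution space $\chi_I[\alpha]$; an evaluation function $f$ with values in $\mathbb N$ is to be maximized or minimized over it, with optimum $\mathrm{opt}(\chi_I[\alpha])$. The input bit complexity $\mathrm{BIT}_{IN}(x,A)$ of a solution $x$ is the least $w$ such that some vector $x'$ of rational numbers is equivalent to $x$ for $A$ (with the input $I$ and $\alpha$ unchanged) and all coordinates of $x'$ have bit length at most $w$. Let $\mathrm{BIT}(\chi_I[\alpha])$ be the minimum of $\mathrm{BIT}_{IN}(x,A)$ over the optimal $x\in\chi_I[\alpha]$, and let $$\mathrm{BIT}_{smooth}(\delta,n)=\sup_{I}\ \mathbb E_{\alpha\in[0,\delta]}\big[\mathrm{BIT}(\chi_I[\alpha])\big],$$ where $\alpha$ is uniform in $[0,\delta]$ and $I$ ranges over the inputs of size $n$ whose augmentation is defined for all $\alpha\in[0,\delta]$. The problem is *monotone* if $\chi_I[\alpha]\subseteq\chi_I[\alpha']$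 for $\alpha\le\alpha'$; *moderate* if there are at most $n^{O(1)}$ breakpoints, i.e. $\alpha$ with $\mathrm{opt}(\chi_I[\alpha-\varepsilon])\ne\mathrm{opt}(\chi_I[\alpha+\varepsilon])$ for all $\varepsilon>0$ for which both sides are defined; *smoothable* if there is a constant $c$ such that for every optimal $x\in\chi_I[\alpha]$ and every $\varepsilon>0$ (with the augmentation by $\alpha+\varepsilon$ defined) there is an $x'\in\chi_I[\alpha+\varepsilon]$ at least as good as $x$ with $\mathrm{BIT}_{IN}(x',A)\le c\log_2(n/\varepsilon)$. **Corollary.** Each of the following problems is monotone, moderate and smoothable, and there is a constant $C$, independent of $A$, such that $\mathrm{BIT}_{smooth}(\delta,n)\le C\log_2(n/\delta)$ for all real RAM algorithms $A$, all $0<\delta\le1$ and all $n\ge2$; in particular there are optimal solutions with expected input bit complexity $O(\log(n/\delta))$. 1. *Art gallery problem under edge inflation*, in a fixed bounded square $[-R,R]^2$ (the constants may depend on $R$). The input is a simple polygon with $n$ vertices in $[0,1]^2$. The inflation by $\alpha$ shifts every edge by $\alpha$ outwards, orthogonally to the edge, the vertices moving to the common points of the shifted lines of adjacent edges; it is defined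 as long as, for all parameters in $[0,\alpha]$, the shifted edges bound a simple polygon contained in $[-R,R]^2$. A solution is a finite list of points of the inflated closed polygon such that every point of this polygon sees one of them along a segment inside the polygon; the number of points is minimized. 2. *Packing convex objects (e.g. convex polygons) into a square container under augmentation of the side length.* The input consists of convex bodies contained in $[0,1]^2$, and $n$ is their number (one object counts as $n=2$). A solution for $\alpha$ is a choice of some of the objects with a rotation and a translation for each, such that the moved objects lie in $[0,1+\alpha]^2$ and do not overlap; a rotation is given by a unit vector. The number of packed objects is maximized. This holds both if "do not overlap" means pairwise disjoint and if it means pairwise disjoint interiors. -/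

import Mathlib

open Set Filter Topology MeasureTheory
open scoped ENNReal

noncomputable section

/-! ## The real RAM -/

namespace RealRAM

/-- Word operations on `w`-bit words. -/
inductive WordOp
  | add | sub | mulLow | mulHigh | div | mod | nand

/-- Exact real operations. -/
inductive RealOp
  | add | sub | mul | div

/-- Instructions. `i`, `j`, `k` are constant words, `l` is a line of the program. -/
inductive Instr
  /-- `W[i] ← j` -/
  | wConst (i j : ℕ)
  /-- `R[i] ← 0` -/
  | rZero (i : ℕ)
  /-- `R[i] ← 1` -/
  | rOne (i : ℕ)
  /-- `W[i] ← W[j]` -/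
  | wMove (i j : ℕ)
  /-- `W[W[i]] ← W[j]` -/
  | wStore (i j : ℕ)
  /-- `W[i] ← W[W[j]]` -/
  | wLoad (i j : ℕ)
  /-- `R[i] ← R[j]` -/
  | rMove (i j : ℕ)
  /-- `R[W[i]] ← R[j]` -/
  | rStore (i j : ℕ)
  /-- `R[i] ← R[W[j]]` -/
  | rLoad (i j : ℕ)
  /-- `R[i] ← j` -/
  | castConst (i j : ℕ)
  /-- `R[i] ← W[j]` -/
  | castWord (i j : ℕ)
  /-- `W[i] ← W[j] ⊞ W[k]` -/
  | wOp (o : WordOp) (i j k : ℕ)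
  /-- `R[i] ← R[j] ⊕ R[k]` -/
  | rOp (o : RealOp) (i j k : ℕ)
  /-- `if W[i] = W[j] goto l` -/
  | ifWordEq (i j l : ℕ)
  /-- `if W[i] < W[j] goto l` -/
  | ifWordLt (i j l : ℕ)
  /-- `if R[i] = 0 goto l` -/
  | ifRealZero (i l : ℕ)
  /-- `if R[i] > 0 goto l` -/
  | ifRealPos (i l : ℕ)
  | goto (l : ℕ)
  | halt
  | accept
  | reject

/-- A configuration of the machine with word size `w`: the program counter and the two random
access arrays, both addressed by words. -/
structure Config (w : ℕ) where
  pc : ℕ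
  W : BitVec w → BitVec w
  R : BitVec w → ℝ

/-- The value of a word operation (`none` for a division by zero). -/
def WordOp.eval {w : ℕ} (o : WordOp) (y z : BitVec w) : Option (BitVec w) :=
  match o with
  | .add => some (y + z)
  | .sub => some (y - z)
  | .mulLow => some (y * z)
  | .mulHigh => some (BitVec.ofNat w (y.toNat * z.toNat / 2 ^ w))
  | .div => if z = 0 then none else some (BitVec.udiv y z)
  | .mod => if z = 0 then none else some (BitVec.umod y z)
  | .nand => some (~~~(y &&& z))

open Classical in
/-- The value of a real operation (`none` for a division by zero). -/
def RealOp.eval (o : RealOp) (y z : ℝ) : Option ℝ :=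
  match o with
  | .add => some (y + z)
  | .sub => some (y - z)
  | .mul => some (y * z)
  | .div => if z = 0 then none else some (y / z)

/-- The instruction in line `l` of a program; lines are numbered from `1`. -/
def fetch (prog : List Instr) (l : ℕ) : Option Instr :=
  if l = 0 then none else prog[l - 1]?

open Classical in
/-- The result of the comparison carried out in a configuration, if the current instruction is a
comparison. -/
def comparison (prog : List Instr) {w : ℕ} (c : Config w) : Option Bool :=
  match fetch prog c.pc with
  | some (.ifWordEq i j _) => some (decide (c.W (.ofNat w i) = c.W (.ofNat w j)))
  | some (.ifWordLt i j _) =>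
      some (decide ((c.W (.ofNat w i)).toNat < (c.W (.ofNat w j)).toNat))
  | some (.ifRealZero i _) => some (decide (c.R (.ofNat w i) = 0))
  | some (.ifRealPos i _) => some (decide (0 < c.R (.ofNat w i)))
  | _ => none

/-- One step of the machine; `none` if the execution ends. -/
def step (prog : List Instr) {w : ℕ} (c : Config w) : Option (Config w) :=
  let a : ℕ → BitVec w := BitVec.ofNat w
  let setW (k x : BitVec w) : Option (Config w) :=
    some { c with pc := c.pc + 1, W := Function.update c.W k x }
  let setR (k : BitVec w) (x : ℝ) : Option (Config w) :=
    some { c with pc := c.pc + 1, R := Function.update c.R k x }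
  let branch (l : ℕ) : Option (Config w) :=
    some { c with pc := if comparison prog c = some true then l else c.pc + 1 }
  match fetch prog c.pc with
  | none => none
  | some (.wConst i j) => setW (a i) (a j)
  | some (.rZero i) => setR (a i) 0
  | some (.rOne i) => setR (a i) 1
  | some (.wMove i j) => setW (a i) (c.W (a j))
  | some (.wStore i j) => setW (c.W (a i)) (c.W (a j))
  | some (.wLoad i j) => setW (a i) (c.W (c.W (a j)))
  | some (.rMove i j) => setR (a i) (c.R (a j))
  | some (.rStore i j) => setR (c.W (a i)) (c.R (a j))
  | some (.rLoad i j) => setR (a i) (c.R (c.W (a j)))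
  | some (.castConst i j) => setR (a i) ((a j).toNat : ℝ)
  | some (.castWord i j) => setR (a i) ((c.W (a j)).toNat : ℝ)
  | some (.wOp o i j k) => (o.eval (c.W (a j)) (c.W (a k))).bind (setW (a i))
  | some (.rOp o i j k) => (o.eval (c.R (a j)) (c.R (a k))).bind (setR (a i))
  | some (.ifWordEq _ _ l) => branch l
  | some (.ifWordLt _ _ l) => branch l
  | some (.ifRealZero _ l) => branch l
  | some (.ifRealPos _ l) => branch l
  | some (.goto l) => some { c with pc := l }
  | some .halt => none
  | some .accept => none
  | some .reject => none

/-- An algorithm: a finite program, run with word size `⌈c log₂ N⌉` on inputs of total length `N`,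
where `c` is a constant of the algorithm. -/
structure Algorithm where
  prog : List Instr
  c : ℕ

/-- The word size `⌈c log₂ N⌉` for an input `(a, b)` of total length `N`. -/
def Algorithm.wordSize (A : Algorithm) (a : List ℝ) (b : List ℤ) : ℕ :=
  Nat.clog 2 ((a.length + b.length) ^ A.c)

/-- The initial configuration on input `(a, b)`: the real array holds `a`, the word array holds the
two lengths followed by `b`, and all other registers hold `0`. -/
def Algorithm.init (A : Algorithm) (a : List ℝ) (b : List ℤ) : Config (A.wordSize a b) where
  pc := 1
  W k := ((BitVec.ofNat _ a.length :: BitVec.ofNat _ b.length ::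
    b.map (BitVec.ofInt (A.wordSize a b)))[k.toNat]?).getD 0
  R k := (a[k.toNat]?).getD 0

/-- The configuration at time `t` (`none` once the execution has ended). -/
def Algorithm.run (A : Algorithm) (a : List ℝ) (b : List ℤ) :
    ℕ → Option (Config (A.wordSize a b))
  | 0 => some (A.init a b)
  | t + 1 => (A.run a b t).bind (step A.prog)

/-- Two inputs `(a, b)` and `(a', b)` with `a`, `a'` of the same length are equivalent for `A` if
every comparison gives the same result in both executions and the program counters always agree. -/
def Algorithm.Equiv (A : Algorithm) (a a' : List ℝ) (b : List ℤ) : Prop :=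
  a.length = a'.length ∧ ∀ t : ℕ,
    (A.run a b t).map Config.pc = (A.run a' b t).map Config.pc ∧
    (A.run a b t).bind (comparison A.prog) = (A.run a' b t).bind (comparison A.prog)

end RealRAM

/-! ## Bit lengths -/

/-- The length of the binary representation of an integer (`0` has length one). -/
def intBits (z : ℤ) : ℕ := max 1 (Nat.size z.natAbs)

/-- `BIT(p / q) = BIT(p) + BIT(q)` for an irreducible fraction. -/
def ratBits (y : ℚ) : ℕ := intBits y.num + intBits y.den

/-- The input bit length of `(a, b)`: the maximal bit length of a coordinate. -/
def inputBits (a : List ℚ) (b : List ℤ) : ℕ :=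
  max ((a.map ratBits).foldr max 0) ((b.map intBits).foldr max 0)

/-! ## Resource augmentation problems and their smoothed analysis -/

/-- A resource augmentation problem. `size I` is the size `n` of the instance `I`, which is handed to
verification algorithms as the vectors `realInput I` and `intInput I`. `dom I ⊆ [0, 1]` is the set of
the augmentation parameters for which the augmentation of `I` is defined, `sol I α` is the solution
space `χ_I[α]` and `value` is the evaluation function. A solution is handed to verification
algorithms as the vectors `realPart` and `intPart`. -/
structure AugmentationProblem where
  Input : Type
  size : Input → ℕ
  realInput : Input → List ℝ
  intInput : Input → List ℤ
  Solution : Input → Type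
  realPart : ∀ {I}, Solution I → List ℝ
  intPart : ∀ {I}, Solution I → List ℤ
  dom : Input → Set ℝ
  sol : ∀ I, ℝ → Set (Solution I)
  value : ∀ {I}, Solution I → ℕ
  maximize : Bool

namespace AugmentationProblem

variable (P : AugmentationProblem)

/-- `x` is at least as good as `y`. -/
def AtLeastAsGood {I : P.Input} (x y : P.Solution I) : Prop :=
  if P.maximize then P.value y ≤ P.value x else P.value x ≤ P.value y

/-- `x` is an optimal solution in `χ_I[α]`. -/
def IsOptimal (I : P.Input) (α : ℝ) (x : P.Solution I) : Prop :=
  x ∈ P.sol I α ∧ ∀ y ∈ P.sol I α, P.AtLeastAsGood x y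

/-- `opt(χ_I[α])`. -/
def opt (I : P.Input) (α : ℝ) : ℕ :=
  if P.maximize then sSup (P.value '' P.sol I α) else sInf (P.value '' P.sol I α)

/-- `BIT_IN(x, A)`: the minimal input bit length of a rational solution vector which `A`, run on the
instance augmented by `α`, cannot distinguish from `x`; it is `⊤` if there is none. -/
def bitIn (A : RealRAM.Algorithm) (I : P.Input) (α : ℝ) (x : P.Solution I) : ℕ∞ :=
  ⨅ (x' : List ℚ)
    (_ : A.Equiv (P.realInput I ++ α :: P.realPart x)
      (P.realInput I ++ α :: x'.map (fun q : ℚ => (q : ℝ)))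
      (P.intInput I ++ P.intPart x)),
    (inputBits x' (P.intPart x) : ℕ∞)

/-- `BIT(χ_I[α])`: the minimal input bit complexity of an optimal solution. -/
def bit (A : RealRAM.Algorithm) (I : P.Input) (α : ℝ) : ℕ∞ :=
  ⨅ (x : P.Solution I) (_ : P.IsOptimal I α x), P.bitIn A I α x

/-- The expectation of `f α` for `α` uniform in `[0, δ]`, as an upper integral: it equals the integral
if `f` is measurable, and otherwise it is the least integral of a measurable majorant. -/
def uniformExpectation (δ : ℝ) (f : ℝ → ℝ≥0∞) : ℝ≥0∞ :=
  ⨅ (g : ℝ → ℝ≥0∞) (_ : Measurable g) (_ : ∀ α ∈ Icc 0 δ, f α ≤ g α),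
    ∫⁻ α, g α ∂(ProbabilityTheory.cond (volume : Measure ℝ) (Icc 0 δ))

/-- `BIT_δ(I, P)`: the expected input bit complexity. -/
def expectedBit (A : RealRAM.Algorithm) (δ : ℝ) (I : P.Input) : ℝ≥0∞ :=
  uniformExpectation δ (fun α => ((P.bit A I α : ℕ∞) : ℝ≥0∞))

/-- `BIT_smooth(δ, n, P)`: the worst expected input bit complexity of an instance of size `n` for
which the augmentation is defined up to `δ`. -/
def smoothedBit (A : RealRAM.Algorithm) (δ : ℝ) (n : ℕ) : ℝ≥0∞ :=
  ⨆ (I : P.Input) (_ : P.size I = n) (_ : Icc 0 δ ⊆ P.dom I), P.expectedBit A δ I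

/-- The monotone property. -/
def IsMonotone : Prop :=
  ∀ I : P.Input, ∀ α ∈ P.dom I, ∀ α' ∈ P.dom I, α ≤ α' → P.sol I α ⊆ P.sol I α'

/-- A breakpoint of the optimum. -/
def IsBreakpoint (I : P.Input) (α : ℝ) : Prop :=
  α ∈ P.dom I ∧ ∀ ε > 0, α - ε ∈ P.dom I → α + ε ∈ P.dom I → P.opt I (α - ε) ≠ P.opt I (α + ε)

/-- The moderate property: there are at most `n ^ O(1)` breakpoints. -/
def IsModerate : Prop :=
  ∃ c : ℕ, ∀ I : P.Input, {α | P.IsBreakpoint I α}.encard ≤ ((c * P.size I ^ c : ℕ) : ℕ∞)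

/-- The smoothable property; the constant does not depend on the verification algorithm. -/
def IsSmoothable : Prop :=
  ∃ c : ℕ, ∀ (A : RealRAM.Algorithm) (I : P.Input) (α ε : ℝ),
    α ∈ P.dom I → 0 < ε → α + ε ∈ P.dom I → ∀ x, P.IsOptimal I α x →
      ∃ x' ∈ P.sol I (α + ε), P.AtLeastAsGood x' x ∧
        ((P.bitIn A I (α + ε) x' : ℕ∞) : ℝ≥0∞) ≤
          ENNReal.ofReal (c * Real.logb 2 (P.size I / ε))

/-- `BIT_smooth(δ, n, P) = O(log(n / δ))`; the constant does not depend on the verification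
algorithm. -/
def HasLogSmoothedBit : Prop :=
  ∃ C : ℝ, ∀ (A : RealRAM.Algorithm) (δ : ℝ) (n : ℕ), 0 < δ → δ ≤ 1 → 2 ≤ n →
    P.smoothedBit A δ n ≤ ENNReal.ofReal (C * Real.logb 2 (n / δ))

end AugmentationProblem

/-! ## The art gallery problem under edge inflation. The plane is `ℂ`. -/

/-- The axis-parallel square `[a, b]²`. -/
def square (a b : ℝ) : Set ℂ := {z | z.re ∈ Icc a b ∧ z.im ∈ Icc a b}

/-- The two coordinates of a point. -/
def coords (z : ℂ) : List ℝ := [z.re, z.im]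

namespace ArtGallery

variable {n : ℕ} [NeZero n]

/-- The edge from vertex `i` to the cyclically next vertex. -/
def edge (v : Fin n → ℂ) (i : Fin n) : Set ℂ := segment ℝ (v i) (v (i + 1))

def boundary (v : Fin n → ℂ) : Set ℂ := ⋃ i, edge v i

/-- The closed region enclosed by a closed polygonal curve: the curve together with the bounded
connected components of its complement. -/
def region (v : Fin n → ℂ) : Set ℂ :=
  boundary v ∪
    {z | z ∉ boundary v ∧ Bornology.IsBounded (connectedComponentIn (boundary v)ᶜ z)}

/-- The vertices are distinct and edges meet only in common endpoints of consecutive edges. -/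
def IsSimple (v : Fin n → ℂ) : Prop :=
  3 ≤ n ∧ Function.Injective v ∧ (∀ i, edge v i ∩ edge v (i + 1) = {v (i + 1)}) ∧
    ∀ i j, i ≠ j → i + 1 ≠ j → j + 1 ≠ i → Disjoint (edge v i) (edge v j)

/-- The unit normal on the right-hand side of edge `i`. -/
def normal (v : Fin n → ℂ) (i : Fin n) : ℂ :=
  -Complex.I * ((v (i + 1) - v i) / (‖v (i + 1) - v i‖ : ℂ))

/-- A simple polygon, traversed with its interior on the left: crossing an edge in the direction of
its normal leads out of the polygon. So the normals are the outward normals. -/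
def IsPolygon (v : Fin n → ℂ) : Prop :=
  IsSimple v ∧ ∀ i, ∀ z ∈ openSegment ℝ (v i) (v (i + 1)),
    ∀ᶠ s : ℝ in 𝓝[>] 0, z + s • normal v i ∉ region v ∧ z - s • normal v i ∈ region v

/-- The edge inflation: every edge is shifted by `t` in the direction of its outward normal. The new
position of a vertex is the common point of the shifted lines of its two edges. -/
def inflate (v : Fin n → ℂ) (t : ℝ) (i : Fin n) : ℂ :=
  v i + (t / (1 + inner ℝ (normal v (i - 1)) (normal v i))) • (normal v (i - 1) + normal v i)

/-- A sequence of `n ≥ 1` points in the unit square. -/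
structure Input where
  n : ℕ
  [pos : NeZero n]
  v : Fin n → ℂ
  mem_square : ∀ i, v i ∈ square 0 1

attribute [instance] Input.pos

/-- The points of `G` lie in the closed region `Q` and guard it. -/
def Guards (G : List ℂ) (Q : Set ℂ) : Prop :=
  (∀ g ∈ G, g ∈ Q) ∧ ∀ q ∈ Q, ∃ g ∈ G, segment ℝ g q ⊆ Q

/-- The art gallery problem under edge inflation. The inflation by `α` is defined as long as the
shifted edges keep bounding a simple polygon in the square `[-R, R]²`. -/
def problem (R : ℝ) : AugmentationProblem where
  Input := Input
  size I := I.n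
  realInput I := (List.ofFn I.v).flatMap coords
  intInput _ := []
  Solution _ := List ℂ
  realPart G := G.flatMap coords
  intPart _ := []
  dom I := {α | α ∈ Icc 0 1 ∧ ∀ s ∈ Icc 0 α,
    IsPolygon (inflate I.v s) ∧ region (inflate I.v s) ⊆ square (-R) R}
  sol I α := {G | Guards G (region (inflate I.v α))}
  value G := G.length
  maximize := false

end ArtGallery

/-! ## Packing convex objects into a square -/

namespace Packing

/-- `N` convex bodies in the unit square, together with any description of them by a real vector and
an integer vector; for convex polygons this is the list of the coordinates of the vertices with the
list of the numbers of vertices. -/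
structure Input where
  N : ℕ
  K : Fin N → Set ℂ
  convex : ∀ i, Convex ℝ (K i)
  compact : ∀ i, IsCompact (K i)
  interior_nonempty : ∀ i, (interior (K i)).Nonempty
  subset_square : ∀ i, K i ⊆ square 0 1
  reals : List ℝ
  ints : List ℤ

/-- A packing: the set of the packed objects, and for each object a rotation, given by the image of
`1`, and a translation. -/
structure Solution (N : ℕ) where
  packed : Finset (Fin N)
  rot : Fin N → ℂ
  shift : Fin N → ℂ

/-- The position of object `i`. -/
def placed (I : Input) (x : Solution I.N) (i : Fin I.N) : Set ℂ :=
  (fun z => x.rot i * z + x.shift i) '' I.K i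

/-- Packing convex objects into a square container of side length `1 + α`. The relation `Apart`
says which pairs of objects do not overlap. The size is the number of the objects, but at least
two, so that its logarithm is positive. -/
def problem (Apart : Set ℂ → Set ℂ → Prop) : AugmentationProblem where
  Input := Input
  size I := max 2 I.N
  realInput I := I.reals
  intInput I := I.ints
  Solution I := Solution I.N
  realPart x := (List.ofFn (fun i => coords (x.rot i) ++ coords (x.shift i))).flatten
  intPart x := List.ofFn (fun i => if i ∈ x.packed then 1 else 0)
  dom _ := Icc 0 1
  sol I α := {x |
    (∀ i ∈ x.packed, ‖x.rot i‖ = 1 ∧ placed I x i ⊆ square 0 (1 + α)) ∧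
    ∀ i ∈ x.packed, ∀ j ∈ x.packed, i ≠ j → Apart (placed I x i) (placed I x j)}
  value x := x.packed.card
  maximize := true

end Packing

end

/-!
The smoothed bound holds for every problem that is monotone, moderate and smoothable and has optimal
solutions (`AugmentationProblem.hasLogSmoothedBit`). If there is no breakpoint in `[α - ε, α]`, then the
optimum does not change there, so a smoothed version of an optimal solution for `α - ε` is optimal for
`α` and has `O(log (n / ε))` bits. The parameters for which `ε = 2⁻ᵏ` fails lie within `2⁻ᵏ` after `0` or
after a breakpoint; their probability decreases geometrically in `k`, as there are only `n ^ O(1)`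
breakpoints. Since the optimum is monotone with values between `0` and `O(n)`, there are `O(n)`
breakpoints (`AugmentationProblem.encard_breakpoints_le`). Smoothability remains. A solution vector with
rational coordinates is equivalent to itself for every algorithm
(`AugmentationProblem.bitIn_le_of_rational`), so it is enough to find a solution for `α + ε` with short
rational coordinates; nothing else about the real RAM is needed.

*Packing.* The relation "`X` is below `Y` on some vertical line" on disjoint convex sets has no cycles,
so the objects can be numbered in a way compatible with it, and likewise for the horizontal direction.
Shifting the objects by small multiples of these numbers separates any two of them by a distance that is
polynomial in `ε / n` (`exists_separating_shifts`). Then the translations, and the rotations by the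
rational parametrisation of the circle, can be rounded to `O(log (n / ε))` bits.

*Art gallery.* The claim is that guards of a polygon still guard its inflation by `ε` if each of them is
moved by up to `ε` (`ArtGallery.PolygonUpTo.guards_map`); then their coordinates can be rounded. The
polygon is described by winding numbers: off the boundary, the region is the set of the points with
nonzero winding number (`ArtGallery.IsPolygon.mem_region_iff`), and winding numbers do not change as
long as the moving boundary avoids the point. At every moment, the boundary points nearest to an inside
point move away from it with speed at least one, so the inflation by `t` contains the
`t`-neighbourhood of the polygon (`ArtGallery.PolygonUpTo.closedBall_subset_region`). A point of the
inflated polygon is therefore within `ε` of the polygon, in which case the convex `ε`-neighbourhood of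
an old segment of sight contains the new one, or it lies in the spike that the inflation adds at a convex
vertex (`ArtGallery.PolygonUpTo.near_of_mem_region`). A guard that sees this vertex lies behind the lines
of both edges at the vertex, and this makes the moved guard see the whole spike
(`ArtGallery.PolygonUpTo.segment_subset_of_near_vertex`). Finally, every point of a polygon sees a
vertex (`ArtGallery.IsPolygon.exists_vertex_visible`), so that `n` guards suffice and the optimum is at
most `n`.
-/

open scoped Pointwise

noncomputable section

/-! ### Breakpoints of a monotone integer-valued function -/

/-- A monotone function with finitely many integer values jumps at most once per value; the two
additional points are the ends of its domain, where one of the two sides is missing. -/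
theorem encard_jumps_le {D : Set ℝ} (hD : D.OrdConnected) {h : ℝ → ℤ} (hm : MonotoneOn h D)
    {lo hi : ℤ} (hh : ∀ s ∈ D, h s ∈ Icc lo hi) :
    {α | α ∈ D ∧ ∀ ε > 0, α - ε ∈ D → α + ε ∈ D → h (α - ε) ≠ h (α + ε)}.encard ≤
      ((Icc lo hi).encard + 1) + 1 := by
  set S := {α | α ∈ D ∧ ∀ ε > 0, α - ε ∈ D → α + ε ∈ D → h (α - ε) ≠ h (α + ε)} with hS
  set S' := {α | α ∈ S ∧ (∃ β ∈ D, β < α) ∧ ∃ γ ∈ D, α < γ} with hS'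
  have hsub : S ⊆ (S' ∪ {α | IsLeast D α}) ∪ {α | IsGreatest D α} := by
    intro α hα
    by_cases h1 : ∃ β ∈ D, β < α
    · by_cases h2 : ∃ γ ∈ D, α < γ
      · exact Or.inl (Or.inl ⟨hα, h1, h2⟩)
      · push Not at h2
        exact Or.inr ⟨hα.1, fun x hx => h2 x hx⟩
    · push Not at h1
      exact Or.inl (Or.inr ⟨hα.1, fun x hx => h1 x hx⟩)
  have hl : {α | IsLeast D α}.encard ≤ 1 :=
    Set.encard_le_one_iff.2 fun a b ha hb => ha.unique hb
  have hg : {α | IsGreatest D α}.encard ≤ 1 :=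
    Set.encard_le_one_iff.2 fun a b ha hb => ha.unique hb
  -- A jump is determined by the limit of `h` from the left.
  set φ : ℝ → ℤ := fun α => sSup (h '' (D ∩ Iio α)) with hφ
  have hbdd : ∀ α, BddAbove (h '' (D ∩ Iio α)) := by
    rintro α
    refine ⟨hi, ?_⟩
    rintro _ ⟨s, hs, rfl⟩
    exact (hh s hs.1).2
  have hmem : ∀ α ∈ S', ∃ s ∈ D, s < α ∧ h s = φ α := by
    rintro α ⟨_, ⟨β, hβ, hβα⟩, _⟩
    obtain ⟨s, hs, hs'⟩ := Int.csSup_mem (s := h '' (D ∩ Iio α)) ⟨h β, β, ⟨hβ, hβα⟩, rfl⟩ (hbdd α)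
    exact ⟨s, hs.1, hs.2, hs'⟩
  have hlt : ∀ α ∈ S', ∀ α' ∈ S', α < α' → φ α < φ α' := by
    intro α hα α' hα' hlt
    obtain ⟨s, hsD, hsα, hs⟩ := hmem α hα
    set ε := min (α - s) ((α' - α) / 2) with hε
    have hε0 : 0 < ε := lt_min (by linarith) (by linarith)
    have h1 : ε ≤ α - s := min_le_left _ _
    have h2 : ε ≤ (α' - α) / 2 := min_le_right _ _
    have hm1 : α - ε ∈ D := hD.out hsD hα.1.1 ⟨by linarith, by linarith⟩
    have hm2 : α + ε ∈ D := hD.out hα.1.1 hα'.1.1 ⟨by linarith, by linarith⟩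
    have hne := hα.1.2 ε hε0 hm1 hm2
    have hle : h (α - ε) ≤ h (α + ε) := hm hm1 hm2 (by linarith)
    calc φ α = h s := hs.symm
      _ ≤ h (α - ε) := hm hsD hm1 (by linarith)
      _ < h (α + ε) := lt_of_le_of_ne hle hne
      _ ≤ φ α' := le_csSup (hbdd α') ⟨α + ε, ⟨hm2, by show α + ε < α'; linarith⟩, rfl⟩
  have hS'card : S'.encard ≤ (Icc lo hi).encard := by
    refine Set.encard_le_encard_of_injOn (f := φ) ?_ ?_
    · intro α hα
      obtain ⟨s, hsD, -, hs⟩ := hmem α hα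
      rw [← hs]
      exact hh s hsD
    · intro α hα α' hα' heq
      rcases lt_trichotomy α α' with hlt' | h' | hlt'
      · exact absurd heq (hlt α hα α' hα' hlt').ne
      · exact h'
      · exact absurd heq (hlt α' hα' α hα hlt').ne'
  calc S.encard ≤ _ := Set.encard_le_encard hsub
    _ ≤ (S' ∪ {α | IsLeast D α}).encard + {α | IsGreatest D α}.encard := Set.encard_union_le _ _
    _ ≤ (S'.encard + {α | IsLeast D α}.encard) + {α | IsGreatest D α}.encard := by
        gcongr
        exact Set.encard_union_le _ _
    _ ≤ _ := by gcongr

/-- A monotone function that takes different values at the ends of an interval jumps in it. -/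
theorem exists_jump {D : Set ℝ} {h : ℝ → ℤ} (hm : MonotoneOn h D) {a b : ℝ} (hab : a ≤ b)
    (hD : Icc a b ⊆ D) (hne : h a ≠ h b) :
    ∃ s ∈ Icc a b, ∀ ε > 0, s - ε ∈ D → s + ε ∈ D → h (s - ε) ≠ h (s + ε) := by
  have haD : a ∈ D := hD ⟨le_rfl, hab⟩
  have hbD : b ∈ D := hD ⟨hab, le_rfl⟩
  have hlt : h a < h b := lt_of_le_of_ne (hm haD hbD hab) hne
  set T := {s | s ∈ Icc a b ∧ h s = h a} with hT
  have haT : a ∈ T := ⟨⟨le_rfl, hab⟩, rfl⟩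
  have hTb : BddAbove T := ⟨b, fun s hs => hs.1.2⟩
  have has : a ≤ sSup T := le_csSup hTb haT
  have hsb : sSup T ≤ b := csSup_le ⟨a, haT⟩ fun s hs => hs.1.2
  refine ⟨sSup T, ⟨has, hsb⟩, fun ε hε h1 h2 => ?_⟩
  have hle : h (sSup T - ε) ≤ h a := by
    obtain ⟨s, hsT, hs⟩ := exists_lt_of_lt_csSup ⟨a, haT⟩ (show sSup T - ε < sSup T by linarith)
    rw [← hsT.2]
    exact hm h1 (hD hsT.1) hs.le
  have hgt : h a < h (sSup T + ε) := by
    rcases le_or_gt b (sSup T + ε) with hb | hb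
    · exact hlt.trans_le (hm hbD h2 hb)
    · refine lt_of_le_of_ne (hm haD h2 (by linarith)) fun heq => ?_
      have : sSup T + ε ≤ sSup T := le_csSup hTb ⟨⟨by linarith, hb.le⟩, heq.symm⟩
      linarith
  exact (hle.trans_lt hgt).ne

namespace AugmentationProblem

variable {P : AugmentationProblem}

/-! ### Optimal values -/

variable (P) in
/-- An evaluation with the sign chosen such that larger scores are better. -/
def score (k : ℕ) : ℤ := if P.maximize then k else -k

theorem score_injective : Function.Injective P.score := by
  intro a b h
  unfold score at h
  split_ifs at h <;> omega

theorem atLeastAsGood_iff {I : P.Input} {x y : P.Solution I} :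
    P.AtLeastAsGood x y ↔ P.score (P.value y) ≤ P.score (P.value x) := by
  unfold AtLeastAsGood score
  split_ifs <;> simp

theorem IsOptimal.value_eq_opt {I : P.Input} {α : ℝ} {x : P.Solution I} (hx : P.IsOptimal I α x) :
    P.value x = P.opt I α := by
  unfold opt
  have h := hx.2
  unfold AtLeastAsGood at h
  split_ifs with hmax
  · simp only [hmax, if_true] at h
    have hx' : IsGreatest (P.value '' P.sol I α) (P.value x) := by
      refine ⟨⟨x, hx.1, rfl⟩, ?_⟩
      rintro _ ⟨y, hy, rfl⟩
      exact h y hy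
    exact hx'.csSup_eq.symm
  · simp only [hmax, Bool.false_eq_true, if_false] at h
    have hx' : IsLeast (P.value '' P.sol I α) (P.value x) := by
      refine ⟨⟨x, hx.1, rfl⟩, ?_⟩
      rintro _ ⟨y, hy, rfl⟩
      exact h y hy
    exact hx'.csInf_eq.symm

theorem exists_isOptimal {I : P.Input} {α : ℝ} (hne : (P.sol I α).Nonempty) {N : ℤ}
    (hN : ∀ x ∈ P.sol I α, P.score (P.value x) ≤ N) : ∃ x, P.IsOptimal I α x := by
  obtain ⟨x₀, hx₀⟩ := hne
  have hb : BddAbove ((fun x => P.score (P.value x)) '' P.sol I α) := by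
    refine ⟨N, ?_⟩
    rintro _ ⟨x, hx, rfl⟩
    exact hN x hx
  obtain ⟨x, hx, hx'⟩ := Int.csSup_mem (Set.Nonempty.image _ ⟨x₀, hx₀⟩) hb
  refine ⟨x, hx, fun y hy => atLeastAsGood_iff.2 ?_⟩
  simp only at hx'
  rw [hx']
  exact le_csSup hb ⟨y, hy, rfl⟩

theorem monotoneOn_score_opt (hm : P.IsMonotone)
    (hex : ∀ I, ∀ α ∈ P.dom I, ∃ x, P.IsOptimal I α x) (I : P.Input) :
    MonotoneOn (fun α => P.score (P.opt I α)) (P.dom I) := by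
  intro a ha b hb hab
  obtain ⟨x, hx⟩ := hex I a ha
  obtain ⟨y, hy⟩ := hex I b hb
  have := atLeastAsGood_iff.1 (hy.2 x (hm I a ha b hb hab hx.1))
  simpa [hx.value_eq_opt, hy.value_eq_opt] using this

theorem encard_breakpoints_le (hm : P.IsMonotone)
    (hex : ∀ I, ∀ α ∈ P.dom I, ∃ x, P.IsOptimal I α x) {I : P.Input}
    (hD : (P.dom I).OrdConnected) {N : ℕ} (hN : ∀ α ∈ P.dom I, P.opt I α ≤ N) :
    {α | P.IsBreakpoint I α}.encard ≤ ((N + 3 : ℕ) : ℕ∞) := by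
  have key : ∃ lo : ℤ, ∀ s ∈ P.dom I, P.score (P.opt I s) ∈ Icc lo (lo + N) := by
    by_cases hmax : P.maximize
    · refine ⟨0, fun s hs => ?_⟩
      have := hN s hs
      simp only [score, hmax, if_true]
      rw [mem_Icc]
      omega
    · refine ⟨-N, fun s hs => ?_⟩
      have := hN s hs
      simp only [score, hmax]
      rw [mem_Icc]
      simp only [Bool.false_eq_true, if_false]
      omega
  obtain ⟨lo, hlo⟩ := key
  have h := encard_jumps_le hD (monotoneOn_score_opt hm hex I) hlo
  have hcard : (Icc lo (lo + N)).encard = ((N + 1 : ℕ) : ℕ∞) := by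
    rw [← Finset.coe_Icc, Set.encard_coe_eq_coe_finsetCard, Int.card_Icc]
    congr 1
    omega
  rw [hcard] at h
  refine le_trans (Set.encard_le_encard ?_) (h.trans ?_)
  · rintro α ⟨hα, hα'⟩
    exact ⟨hα, fun ε hε h1 h2 heq => hα' ε hε h1 h2 (score_injective heq)⟩
  · norm_cast

/-- If there is no breakpoint in `[a, b]`, then a smoothed version of an optimal solution for `a` is
optimal for `b`. -/
theorem bit_le_of_no_breakpoint (hm : P.IsMonotone)
    (hex : ∀ I, ∀ α ∈ P.dom I, ∃ x, P.IsOptimal I α x) {c : ℕ}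
    (hs : ∀ (A : RealRAM.Algorithm) (I : P.Input) (α ε : ℝ),
      α ∈ P.dom I → 0 < ε → α + ε ∈ P.dom I → ∀ x, P.IsOptimal I α x →
        ∃ x' ∈ P.sol I (α + ε), P.AtLeastAsGood x' x ∧
          ((P.bitIn A I (α + ε) x' : ℕ∞) : ℝ≥0∞) ≤
            ENNReal.ofReal (c * Real.logb 2 (P.size I / ε)))
    (A : RealRAM.Algorithm) {I : P.Input} {a ε : ℝ} (hε : 0 < ε) (hab : Icc a (a + ε) ⊆ P.dom I)
    (hno : ∀ s ∈ Icc a (a + ε), ¬ P.IsBreakpoint I s) :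
    ((P.bit A I (a + ε) : ℕ∞) : ℝ≥0∞) ≤ ENNReal.ofReal (c * Real.logb 2 (P.size I / ε)) := by
  have ha : a ∈ P.dom I := hab ⟨le_rfl, by linarith⟩
  have hb : a + ε ∈ P.dom I := hab ⟨by linarith, le_rfl⟩
  have hopt : P.opt I a = P.opt I (a + ε) := by
    by_contra hne
    obtain ⟨s, hs, hs'⟩ := exists_jump (monotoneOn_score_opt hm hex I) (show a ≤ a + ε by linarith)
      hab (fun h => hne (score_injective h))
    exact hno s hs ⟨hab hs, fun ε hε h1 h2 heq => hs' ε hε h1 h2 (by simp only [heq])⟩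
  obtain ⟨x, hx⟩ := hex I a ha
  obtain ⟨y, hy⟩ := hex I (a + ε) hb
  obtain ⟨x', hx', hgood, hbit⟩ := hs A I a ε ha hε hb x hx
  have hx'opt : P.IsOptimal I (a + ε) x' := by
    refine ⟨hx', fun z hz => ?_⟩
    have h1 := atLeastAsGood_iff.1 (hy.2 z hz)
    have h2 := atLeastAsGood_iff.1 hgood
    rw [atLeastAsGood_iff]
    rw [hy.value_eq_opt, ← hopt, ← hx.value_eq_opt] at h1
    exact h1.trans h2
  refine le_trans ?_ hbit
  have : P.bit A I (a + ε) ≤ P.bitIn A I (a + ε) x' := iInf₂_le x' hx'opt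
  exact_mod_cast this

/-! ### The expected input bit complexity -/

/-- The points that follow one of the points of `F` at distance at most `2 ^ (-k)`. -/
def afterSet (F : Finset ℝ) (k : ℕ) : Set ℝ := ⋃ b ∈ F, Icc b (b + (2 : ℝ)⁻¹ ^ k)

theorem measurableSet_afterSet (F : Finset ℝ) (k : ℕ) : MeasurableSet (afterSet F k) :=
  F.measurableSet_biUnion fun _ _ => measurableSet_Icc

theorem cond_afterSet_le (F : Finset ℝ) (k : ℕ) {δ : ℝ} (hδ : 0 < δ) :
    ProbabilityTheory.cond (volume : Measure ℝ) (Icc 0 δ) (afterSet F k) ≤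
      ENNReal.ofReal (F.card / δ * (2 : ℝ)⁻¹ ^ k) := by
  rw [ProbabilityTheory.cond_apply measurableSet_Icc]
  have h1 : volume (afterSet F k) ≤ ENNReal.ofReal (F.card * (2 : ℝ)⁻¹ ^ k) := by
    calc volume (afterSet F k) ≤ ∑ b ∈ F, volume (Icc b (b + (2 : ℝ)⁻¹ ^ k)) :=
          measure_biUnion_finset_le F _
      _ = ENNReal.ofReal (F.card * (2 : ℝ)⁻¹ ^ k) := by
          simp only [Real.volume_Icc, add_sub_cancel_left, Finset.sum_const, nsmul_eq_mul]
          rw [ENNReal.ofReal_mul (by positivity), ENNReal.ofReal_natCast]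
  calc (volume (Icc 0 δ))⁻¹ * volume (Icc 0 δ ∩ afterSet F k)
      ≤ (volume (Icc 0 δ))⁻¹ * ENNReal.ofReal (F.card * (2 : ℝ)⁻¹ ^ k) := by
        gcongr
        exact (measure_mono inter_subset_right).trans h1
    _ = ENNReal.ofReal (F.card / δ * (2 : ℝ)⁻¹ ^ k) := by
        rw [Real.volume_Icc, sub_zero, ← ENNReal.ofReal_inv_of_pos hδ,
          ← ENNReal.ofReal_mul (by positivity)]
        congr 1
        field_simp

/-- If `f α ≤ c (L + k)` for every `α` that is farther than `2 ^ (-k)` beyond each point of `F`, then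
the sets of the `α` with large `f α` have geometrically decreasing measure. -/
theorem uniformExpectation_le {f : ℝ → ℝ≥0∞} {δ L : ℝ} (hδ : 0 < δ) (hL : 0 ≤ L) (F : Finset ℝ)
    {c : ℕ} {K : ℕ} (hK : F.card / δ ≤ (2 : ℝ) ^ K)
    (hf : ∀ α ∈ Icc 0 δ, ∀ k : ℕ, α ∉ afterSet F k → f α ≤ ENNReal.ofReal (c * (L + k))) :
    uniformExpectation δ f ≤ ENNReal.ofReal ((c + 1) * (L + K + 2)) := by
  set μ := ProbabilityTheory.cond (volume : Measure ℝ) (Icc 0 δ) with hμ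
  have : IsProbabilityMeasure μ := by
    refine ProbabilityTheory.cond_isProbabilityMeasure_of_finite ?_ ?_ <;> simp [hδ]
  set g : ℝ → ℝ≥0∞ := fun α => ENNReal.ofReal (c + 1) *
    (ENNReal.ofReal (L + K) + ∑' k : ℕ, (afterSet F (K + k)).indicator 1 α) with hg
  have hmeas : ∀ k : ℕ, Measurable ((afterSet F (K + k)).indicator (1 : ℝ → ℝ≥0∞)) := fun k =>
    measurable_one.indicator (measurableSet_afterSet F _)
  have hgm : Measurable g :=
    (measurable_const.add (Measurable.tsum hmeas)).const_mul _
  have hfg : ∀ α ∈ Icc 0 δ, f α ≤ g α := by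
    intro α hα
    by_cases hex : ∃ k, α ∉ afterSet F (K + k)
    · classical
      set m := Nat.find hex with hm
      have h1 := hf α hα (K + m) (Nat.find_spec hex)
      refine h1.trans ?_
      have h2 : (m : ℝ≥0∞) ≤ ∑' k : ℕ, (afterSet F (K + k)).indicator (1 : ℝ → ℝ≥0∞) α := by
        calc (m : ℝ≥0∞) = ∑ k ∈ Finset.range m, 1 := by simp
          _ = ∑ k ∈ Finset.range m, (afterSet F (K + k)).indicator (1 : ℝ → ℝ≥0∞) α := by
              refine Finset.sum_congr rfl fun k hk => ?_
              have := Nat.find_min hex (Finset.mem_range.1 hk)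
              rw [not_not] at this
              rw [indicator_of_mem this, Pi.one_apply]
          _ ≤ _ := ENNReal.sum_le_tsum _
      calc ENNReal.ofReal (c * (L + (K + m : ℕ)))
          ≤ ENNReal.ofReal ((c + 1) * (L + K + m)) := by
            apply ENNReal.ofReal_le_ofReal
            push_cast
            nlinarith [show (0 : ℝ) ≤ K from by positivity, show (0 : ℝ) ≤ m from by positivity]
        _ = ENNReal.ofReal (c + 1) * (ENNReal.ofReal (L + K) + m) := by
            rw [ENNReal.ofReal_mul (by positivity),
              ENNReal.ofReal_add (add_nonneg hL K.cast_nonneg) m.cast_nonneg, ENNReal.ofReal_natCast]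
        _ ≤ g α := by
            simp only [hg]
            gcongr
    · push Not at hex
      have : g α = ⊤ := by
        simp only [hg]
        have : ∑' k : ℕ, (afterSet F (K + k)).indicator (1 : ℝ → ℝ≥0∞) α = ⊤ := by
          have h1 : ∀ k : ℕ, (afterSet F (K + k)).indicator (1 : ℝ → ℝ≥0∞) α = 1 := fun k => by
            rw [indicator_of_mem (hex k), Pi.one_apply]
          simp_rw [h1]
          exact ENNReal.tsum_const_eq_top_of_ne_zero one_ne_zero
        rw [this, add_top, ENNReal.mul_top]
        simp only [ne_eq, ENNReal.ofReal_eq_zero, not_le]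
        positivity
      rw [this]
      exact le_top
  have hsum : ∑' k : ℕ, μ (afterSet F (K + k)) ≤ 2 := by
    calc ∑' k : ℕ, μ (afterSet F (K + k)) ≤ ∑' k : ℕ, ENNReal.ofReal ((2 : ℝ)⁻¹ ^ k) := by
          refine ENNReal.tsum_le_tsum fun k => (cond_afterSet_le F _ hδ).trans ?_
          apply ENNReal.ofReal_le_ofReal
          rw [pow_add, ← mul_assoc]
          have : F.card / δ * (2 : ℝ)⁻¹ ^ K ≤ 1 := by
            calc F.card / δ * (2 : ℝ)⁻¹ ^ K ≤ 2 ^ K * (2 : ℝ)⁻¹ ^ K := by gcongr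
              _ = 1 := by rw [← mul_pow]; norm_num
          calc _ ≤ 1 * (2 : ℝ)⁻¹ ^ k := by gcongr
            _ = _ := one_mul _
      _ = ENNReal.ofReal (∑' k : ℕ, (2 : ℝ)⁻¹ ^ k) := by
          rw [ENNReal.ofReal_tsum_of_nonneg (fun k => by positivity)]
          exact summable_geometric_of_lt_one (by norm_num) (by norm_num)
      _ = 2 := by
          rw [tsum_geometric_of_lt_one (by norm_num) (by norm_num)]
          norm_num
  refine (iInf₂_le g hgm).trans ((iInf_le _ hfg).trans ?_)
  calc ∫⁻ α, g α ∂μ = ENNReal.ofReal (c + 1) *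
        (ENNReal.ofReal (L + K) + ∑' k : ℕ, μ (afterSet F (K + k))) := by
        have hmt : Measurable fun α => ∑' k : ℕ, (afterSet F (K + k)).indicator (1 : ℝ → ℝ≥0∞) α :=
          Measurable.tsum hmeas
        simp only [hg]
        rw [lintegral_const_mul' _ _ ENNReal.ofReal_ne_top, lintegral_add_right _ hmt,
          lintegral_const, measure_univ, mul_one, lintegral_tsum fun k => (hmeas k).aemeasurable]
        simp_rw [lintegral_indicator_one (measurableSet_afterSet F _)]
    _ ≤ ENNReal.ofReal (c + 1) * (ENNReal.ofReal (L + K) + 2) := by gcongr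
    _ = ENNReal.ofReal ((c + 1) * (L + K + 2)) := by
        rw [ENNReal.ofReal_mul (by positivity),
          ENNReal.ofReal_add (add_nonneg hL K.cast_nonneg) zero_le_two, ENNReal.ofReal_ofNat]

/-- Smoothed analysis: monotonicity, few breakpoints and smoothability bound the expected input bit
complexity. -/
theorem hasLogSmoothedBit (hm : P.IsMonotone) (hmod : P.IsModerate) (hs : P.IsSmoothable)
    (hex : ∀ I, ∀ α ∈ P.dom I, ∃ x, P.IsOptimal I α x) : P.HasLogSmoothedBit := by
  obtain ⟨c₁, hc₁⟩ := hmod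
  obtain ⟨c, hc⟩ := hs
  refine ⟨(c + 1) * (c₁ + 5 + Real.logb 2 (c₁ + 1)), fun A δ n hδ hδ1 hn => ?_⟩
  have hn0 : (0 : ℝ) < n := by positivity
  have hn2 : (2 : ℝ) ≤ n := by exact_mod_cast hn
  set L := Real.logb 2 n with hL
  set M := Real.logb 2 (n / δ) with hM
  have hMeq : M = L - Real.logb 2 δ := Real.logb_div hn0.ne' hδ.ne'
  have hδL : Real.logb 2 δ ≤ 0 := Real.logb_nonpos (by norm_num) hδ.le hδ1
  have hL1 : 1 ≤ L := by
    rw [hL, Real.le_logb_iff_rpow_le (by norm_num) hn0]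
    simpa using hn2
  refine iSup_le fun I => iSup_le fun hI => iSup_le fun hdom => ?_
  have hfin : {α | P.IsBreakpoint I α}.Finite :=
    Set.finite_of_encard_le_coe (hc₁ I)
  set F : Finset ℝ := insert 0 hfin.toFinset with hF
  have hFcard : (F.card : ℝ) ≤ (c₁ + 1) * n ^ c₁ := by
    have h1 : hfin.toFinset.card ≤ c₁ * n ^ c₁ := by
      have := hc₁ I
      rw [hI, hfin.encard_eq_coe_toFinset_card] at this
      exact_mod_cast this
    have h2 : F.card ≤ c₁ * n ^ c₁ + 1 := (Finset.card_insert_le _ _).trans (by omega)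
    have h3 : (1 : ℝ) ≤ n ^ c₁ := one_le_pow₀ (by linarith)
    have h4 : (F.card : ℝ) ≤ c₁ * n ^ c₁ + 1 := by exact_mod_cast h2
    linarith
  have hFpos : (0 : ℝ) < F.card := by
    have : 0 < F.card := Finset.card_pos.2 ⟨0, Finset.mem_insert_self _ _⟩
    exact_mod_cast this
  set K := ⌈Real.logb 2 (F.card / δ)⌉₊ with hK
  have hlog : Real.logb 2 (F.card / δ) ≤ Real.logb 2 (c₁ + 1) + c₁ * L - Real.logb 2 δ := by
    rw [Real.logb_div hFpos.ne' hδ.ne']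
    have : Real.logb 2 F.card ≤ Real.logb 2 ((c₁ + 1) * n ^ c₁) :=
      Real.logb_le_logb_of_le (by norm_num) hFpos hFcard
    rw [Real.logb_mul (by positivity) (by positivity), Real.logb_pow] at this
    linarith
  have hc₁log : 0 ≤ Real.logb 2 ((c₁ : ℝ) + 1) :=
    Real.logb_nonneg (by norm_num) (by linarith [show (0 : ℝ) ≤ c₁ from by positivity])
  have hK1 : F.card / δ ≤ (2 : ℝ) ^ K := by
    rw [← Real.rpow_natCast, ← Real.logb_le_iff_le_rpow (by norm_num) (by positivity)]
    exact Nat.le_ceil _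
  have hK2 : (K : ℝ) ≤ Real.logb 2 (c₁ + 1) + c₁ * L - Real.logb 2 δ + 1 := by
    have h0 : 0 ≤ Real.logb 2 (c₁ + 1) + c₁ * L - Real.logb 2 δ := by
      have : 0 ≤ c₁ * L := by positivity
      linarith
    have h1 : (K : ℝ) ≤ ⌈Real.logb 2 (c₁ + 1) + c₁ * L - Real.logb 2 δ⌉₊ := by
      exact_mod_cast Nat.ceil_le_ceil hlog
    exact h1.trans (Nat.ceil_lt_add_one h0).le
  have hexp : P.expectedBit A δ I ≤ ENNReal.ofReal ((c + 1) * (L + K + 2)) := by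
    refine uniformExpectation_le hδ (by linarith) F hK1 fun α hα k hk => ?_
    have hkey : ∀ b ∈ F, b ≤ α → b < α - (2 : ℝ)⁻¹ ^ k := by
      intro b hb hbα
      by_contra hcon
      refine hk (mem_iUnion₂.2 ⟨b, hb, hbα, by linarith⟩)
    have hpos := hkey 0 (Finset.mem_insert_self _ _) hα.1
    have h2k : (0 : ℝ) < (2 : ℝ)⁻¹ ^ k := by positivity
    have := bit_le_of_no_breakpoint hm hex hc A (I := I) (a := α - (2 : ℝ)⁻¹ ^ k) h2k
      (fun s hs => hdom ⟨by linarith [hs.1], by linarith [hs.2, hα.2]⟩)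
      (fun s hs hbr => by
        have hsF : s ∈ F := Finset.mem_insert_of_mem (hfin.mem_toFinset.2 hbr)
        have := hkey s hsF (by linarith [hs.2])
        linarith [hs.1])
    rw [sub_add_cancel, hI] at this
    refine this.trans (le_of_eq ?_)
    rw [Real.logb_div hn0.ne' h2k.ne', Real.logb_pow, Real.logb_inv, Real.logb_self_eq_one (by norm_num)]
    congr 2
    ring
  refine hexp.trans (ENNReal.ofReal_le_ofReal ?_)
  rw [mul_assoc]
  refine mul_le_mul_of_nonneg_left ?_ (by positivity)
  have hLM : L ≤ M := by linarith
  have hM1 : 1 ≤ M := by linarith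
  have e1 : c₁ * L ≤ c₁ * M := by gcongr
  have e2 : Real.logb 2 (c₁ + 1) ≤ Real.logb 2 (c₁ + 1) * M := le_mul_of_one_le_right hc₁log hM1
  nlinarith

end AugmentationProblem

/-! ### Bit lengths and rational approximation -/

theorem intBits_le {z : ℤ} {k : ℕ} (h : z.natAbs ≤ 2 ^ k) : intBits z ≤ k + 1 := by
  refine max_le (by omega) (Nat.size_le.2 (h.trans_lt ?_))
  exact Nat.pow_lt_pow_right (by norm_num) (by omega)

theorem ratBits_div_le {a : ℤ} {b A B : ℕ} (hb : 0 < b) (ha : a.natAbs ≤ 2 ^ A)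
    (hb' : b ≤ 2 ^ B) : ratBits ((a : ℚ) / b) ≤ A + B + 2 := by
  have hb0 : (b : ℤ) ≠ 0 := by exact_mod_cast hb.ne'
  have hnum : ((a : ℚ) / b).num.natAbs ≤ 2 ^ A := by
    rcases eq_or_ne a 0 with rfl | ha0
    · simp
    · have h := Rat.num_dvd a hb0
      rw [Rat.divInt_eq_div] at h
      exact (Nat.le_of_dvd (Int.natAbs_pos.2 ha0)
        (by simpa using Int.natAbs_dvd_natAbs.2 h)).trans ha
  have hden : ((((a : ℚ) / b).den : ℤ)).natAbs ≤ 2 ^ B := by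
    have h := Rat.den_dvd a b
    rw [Rat.divInt_eq_div] at h
    have h' := Nat.le_of_dvd (by omega) (Int.natAbs_dvd_natAbs.2 h)
    simp only [Int.natAbs_natCast, Int.cast_natCast] at h' ⊢
    exact h'.trans hb'
  have h1 := intBits_le hnum
  have h2 := intBits_le hden
  unfold ratBits
  omega

theorem List.foldr_max_le {l : List ℕ} {m : ℕ} (h : ∀ x ∈ l, x ≤ m) : l.foldr max 0 ≤ m := by
  induction l with
  | nil => simp
  | cons a l ih =>
    simp only [List.foldr_cons]
    exact max_le (h a (by simp)) (ih fun x hx => h x (by simp [hx]))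

/-- A solution whose real part is rational is equivalent to itself, so its bit length bounds its input
bit complexity for every algorithm. -/
theorem AugmentationProblem.bitIn_le_of_rational {P : AugmentationProblem} (A : RealRAM.Algorithm)
    (I : P.Input) (α : ℝ) (x : P.Solution I) {l : List ℚ}
    (hl : P.realPart x = l.map (fun q : ℚ => (q : ℝ))) {m : ℕ} (h1 : ∀ q ∈ l, ratBits q ≤ m)
    (h2 : ∀ z ∈ P.intPart x, intBits z ≤ m) : P.bitIn A I α x ≤ m := by
  refine (iInf₂_le l ?_).trans ?_
  · rw [hl]
    exact ⟨rfl, fun t => ⟨rfl, rfl⟩⟩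
  · have : inputBits l (P.intPart x) ≤ m := by
      refine max_le (List.foldr_max_le ?_) (List.foldr_max_le ?_)
      · intro k hk
        obtain ⟨q, hq, rfl⟩ := List.mem_map.1 hk
        exact h1 q hq
      · intro k hk
        obtain ⟨q, hq, rfl⟩ := List.mem_map.1 hk
        exact h2 q hq
    exact_mod_cast this

theorem exists_half_pow_le {η : ℝ} (h0 : 0 < η) (h1 : η ≤ 1) :
    ∃ k : ℕ, (2 : ℝ)⁻¹ ^ k ≤ η ∧ (k : ℝ) ≤ Real.logb 2 (1 / η) + 1 := by
  have hpos : 0 ≤ Real.logb 2 (1 / η) :=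
    Real.logb_nonneg (by norm_num) (by rw [le_div_iff₀ h0]; linarith)
  refine ⟨⌈Real.logb 2 (1 / η)⌉₊, ?_, (Nat.ceil_lt_add_one hpos).le⟩
  have h := Nat.le_ceil (Real.logb 2 (1 / η))
  rw [Real.logb_le_iff_le_rpow (by norm_num) (by positivity), Real.rpow_natCast] at h
  rw [inv_pow]
  exact inv_le_of_inv_le₀ h0 (by simpa only [one_div] using h)

theorem exists_shortRat_near {x : ℝ} {A : ℕ} (k : ℕ) (hx : |x| ≤ 2 ^ A) :
    ∃ q : ℚ, |(q : ℝ) - x| ≤ (2 : ℝ)⁻¹ ^ k ∧ ratBits q ≤ A + 2 * k + 3 := by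
  have hk : (0 : ℝ) < 2 ^ k := by positivity
  refine ⟨(⌊x * 2 ^ k⌋ : ℤ) / ((2 ^ k : ℕ) : ℚ), ?_, ?_⟩
  · have h1 := Int.floor_le (x * 2 ^ k)
    have h2 := Int.lt_floor_add_one (x * 2 ^ k)
    push_cast
    have : (⌊x * 2 ^ k⌋ : ℝ) / 2 ^ k - x = -((x * 2 ^ k - ⌊x * 2 ^ k⌋) / 2 ^ k) := by
      field_simp
      ring
    rw [this, abs_neg, abs_of_nonneg (div_nonneg (by linarith) hk.le), inv_pow, div_eq_mul_inv]
    exact mul_le_of_le_one_left (by positivity) (by linarith)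
  · have hxk : |x * 2 ^ k| ≤ 2 ^ (A + k) := by
      rw [abs_mul, abs_of_pos hk, pow_add]
      gcongr
    obtain ⟨hl, hu⟩ := abs_le.1 hxk
    have hf1 : ⌊x * 2 ^ k⌋ ≤ 2 ^ (A + k) := by
      have : (⌊x * 2 ^ k⌋ : ℝ) ≤ ((2 ^ (A + k) : ℤ) : ℝ) := by
        push_cast
        exact (Int.floor_le _).trans hu
      exact_mod_cast this
    have hf2 : -(2 ^ (A + k) : ℤ) ≤ ⌊x * 2 ^ k⌋ := by
      rw [Int.le_floor]
      push_cast
      exact hl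
    have := ratBits_div_le (a := ⌊x * 2 ^ k⌋) (b := 2 ^ k) (A := A + k) (B := k) (by positivity)
      (by zify; exact abs_le.2 ⟨hf2, hf1⟩) le_rfl
    omega

/-- The rational parametrisation of the unit circle. -/
def circleParam (t : ℝ) : ℂ := (1 + t * Complex.I) / (1 - t * Complex.I)

theorem one_sub_mul_I_ne_zero (t : ℝ) : (1 - t * Complex.I : ℂ) ≠ 0 := by
  intro h
  simpa using congrArg Complex.re h

theorem one_le_norm_one_sub_mul_I (t : ℝ) : 1 ≤ ‖(1 - t * Complex.I : ℂ)‖ := by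
  have := Complex.abs_re_le_norm (1 - t * Complex.I : ℂ)
  simpa using this

theorem circleParam_eq (t : ℝ) :
    circleParam t = ((1 - t ^ 2) / (1 + t ^ 2) : ℝ) + ((2 * t) / (1 + t ^ 2) : ℝ) * Complex.I := by
  have h : (1 + t ^ 2 : ℂ) ≠ 0 := by
    have : (1 + t ^ 2 : ℝ) ≠ 0 := by positivity
    exact_mod_cast this
  rw [circleParam, div_eq_iff (one_sub_mul_I_ne_zero t)]
  push_cast
  field_simp
  linear_combination 2 * (t : ℂ) ^ 2 * Complex.I_sq

theorem norm_circleParam_sub_le (s t : ℝ) : ‖circleParam s - circleParam t‖ ≤ 2 * |s - t| := by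
  have hs := one_sub_mul_I_ne_zero s
  have ht := one_sub_mul_I_ne_zero t
  have : circleParam s - circleParam t =
      (2 * (s - t : ℝ) * Complex.I) / ((1 - s * Complex.I) * (1 - t * Complex.I)) := by
    unfold circleParam
    rw [div_sub_div _ _ hs ht]
    congr 1
    push_cast
    ring
  rw [this, norm_div, norm_mul, norm_mul, norm_mul, Complex.norm_I, mul_one, Complex.norm_real]
  have h1 := one_le_norm_one_sub_mul_I s
  have h2 := one_le_norm_one_sub_mul_I t
  simp only [Complex.norm_ofNat, Real.norm_eq_abs]
  exact div_le_self (by positivity) (one_le_mul_of_one_le_of_one_le h1 h2)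

theorem exists_circleParam_eq {r : ℂ} (hr : ‖r‖ = 1) (hre : 0 ≤ r.re) :
    ∃ t : ℝ, |t| ≤ 1 ∧ circleParam t = r := by
  have h1 : r.re ^ 2 + r.im ^ 2 = 1 := by
    have := Complex.sq_norm r
    rw [hr, Complex.normSq_apply] at this
    linarith
  have hpos : 0 < 1 + r.re := by linarith
  have him : |r.im| ≤ 1 := by
    rw [← hr]
    exact Complex.abs_im_le_norm r
  obtain ⟨t, ht⟩ : ∃ t : ℝ, t = r.im / (1 + r.re) := ⟨_, rfl⟩
  have ht' : t * (1 + r.re) = r.im := by rw [ht, div_mul_cancel₀ _ hpos.ne']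
  refine ⟨t, ?_, ?_⟩
  · rw [ht, abs_div, abs_of_pos hpos, div_le_one hpos]
    linarith
  · rw [circleParam, div_eq_iff (one_sub_mul_I_ne_zero _)]
    apply Complex.ext
    · simp
      refine mul_right_cancel₀ hpos.ne' ?_
      linear_combination -h1 - r.im * ht'
    · simp
      linear_combination ht'

/-- Every rotation is close to a rotation with short rational coordinates. -/
theorem exists_rat_rotation_near {r : ℂ} (hr : ‖r‖ = 1) (k : ℕ) :
    ∃ p q : ℚ, ‖((p : ℝ) + (q : ℝ) * Complex.I : ℂ)‖ = 1 ∧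
      ‖((p : ℝ) + (q : ℝ) * Complex.I : ℂ) - r‖ ≤ 2 * (2 : ℝ)⁻¹ ^ k ∧
      ratBits p ≤ 4 * k + 4 ∧ ratBits q ≤ 4 * k + 4 := by
  obtain ⟨σ, hσ, hre⟩ : ∃ σ : ℤ, (σ = 1 ∨ σ = -1) ∧ 0 ≤ ((σ : ℂ) * r).re := by
    rcases le_total 0 r.re with h | h
    · exact ⟨1, Or.inl rfl, by simpa using h⟩
    · exact ⟨-1, Or.inr rfl, by simpa using h⟩
  have hσn : ‖(σ : ℂ)‖ = 1 := by rcases hσ with rfl | rfl <;> simp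
  have hσσ : (σ : ℂ) * σ = 1 := by rcases hσ with rfl | rfl <;> simp
  obtain ⟨t, ht, htr⟩ := exists_circleParam_eq (r := σ * r) (by rw [norm_mul, hσn, hr, one_mul]) hre
  obtain ⟨ht1, ht2⟩ := abs_le.1 ht
  have hk : (0 : ℝ) < 2 ^ k := by positivity
  set a : ℤ := ⌊t * 2 ^ k⌋ with ha
  have hl := Int.floor_le (t * 2 ^ k)
  have hu := Int.lt_floor_add_one (t * 2 ^ k)
  have ha1 : a ≤ 2 ^ k := by
    have : (a : ℝ) ≤ ((2 ^ k : ℤ) : ℝ) := by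
      push_cast
      nlinarith
    exact_mod_cast this
  have ha2 : -(2 ^ k : ℤ) ≤ a := by
    rw [ha, Int.le_floor]
    push_cast
    nlinarith
  have haN : a.natAbs ≤ 2 ^ k := by
    zify
    exact abs_le.2 ⟨ha2, ha1⟩
  set s : ℝ := a / 2 ^ k with hs
  have hst : |s - t| ≤ (2 : ℝ)⁻¹ ^ k := by
    have : s - t = -((t * 2 ^ k - a) / 2 ^ k) := by
      rw [hs]
      field_simp
      ring
    rw [this, abs_neg, abs_of_nonneg (div_nonneg (by linarith) hk.le), inv_pow, div_eq_mul_inv]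
    exact mul_le_of_le_one_left (by positivity) (by linarith)
  set b : ℕ := (2 ^ k) ^ 2 + a.natAbs ^ 2 with hb
  have hb0 : 0 < b := by positivity
  have hb' : b ≤ 2 ^ (2 * k + 1) := by
    have : a.natAbs ^ 2 ≤ (2 ^ k) ^ 2 := Nat.pow_le_pow_left haN 2
    have h2 : 2 ^ (2 * k + 1) = 2 * (2 ^ k) ^ 2 := by ring
    omega
  have hbR : (b : ℝ) = (2 ^ k) ^ 2 + a ^ 2 := by
    rw [hb]
    push_cast
    congr 1
    rw [Nat.cast_natAbs, Int.cast_abs, sq_abs]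
  set n₁ : ℤ := σ * ((2 ^ k) ^ 2 - a ^ 2) with hn₁
  set n₂ : ℤ := σ * (2 * a * 2 ^ k) with hn₂
  have hσa : σ.natAbs = 1 := by rcases hσ with rfl | rfl <;> simp
  have h₁ : n₁.natAbs ≤ 2 ^ (2 * k + 1) := by
    rw [hn₁, Int.natAbs_mul, hσa, one_mul]
    have h3 : a ^ 2 ≤ (2 ^ k) ^ 2 := sq_le_sq' ha2 ha1
    have h4 : (2 : ℤ) ^ (2 * k + 1) = 2 * (2 ^ k) ^ 2 := by ring
    have h5 := sq_nonneg a
    zify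
    rw [h4, abs_le]
    constructor <;> linarith
  have h₂ : n₂.natAbs ≤ 2 ^ (2 * k + 1) := by
    rw [hn₂, Int.natAbs_mul, hσa, one_mul, Int.natAbs_mul, Int.natAbs_mul, Int.natAbs_pow]
    calc _ ≤ (2 : ℤ).natAbs * 2 ^ k * (2 : ℤ).natAbs ^ k := by gcongr
      _ = 2 ^ (2 * k + 1) := by
        simp only [Int.reduceAbs]
        ring
  have heq : (((n₁ / b : ℚ) : ℝ) + ((n₂ / b : ℚ) : ℝ) * Complex.I : ℂ) = σ * circleParam s := by
    rw [circleParam_eq]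
    have e1 : ((n₁ / b : ℚ) : ℝ) = σ * ((1 - s ^ 2) / (1 + s ^ 2)) := by
      push_cast
      rw [hbR, hn₁, hs]
      push_cast
      field_simp
    have e2 : ((n₂ / b : ℚ) : ℝ) = σ * ((2 * s) / (1 + s ^ 2)) := by
      push_cast
      rw [hbR, hn₂, hs]
      push_cast
      field_simp
    rw [e1, e2]
    push_cast
    ring
  refine ⟨n₁ / b, n₂ / b, ?_, ?_, ?_, ?_⟩
  · rw [heq, norm_mul, hσn, one_mul, circleParam, norm_div]
    have : ‖(1 + s * Complex.I : ℂ)‖ = ‖(1 - s * Complex.I : ℂ)‖ := by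
      rw [← Complex.norm_conj (1 + s * Complex.I)]
      simp [sub_eq_add_neg]
    rw [this, div_self (by linarith [one_le_norm_one_sub_mul_I s])]
  · have hr' : r = σ * circleParam t := by
      rw [htr, ← mul_assoc, hσσ, one_mul]
    rw [heq, hr', ← mul_sub, norm_mul, hσn, one_mul]
    calc _ ≤ 2 * |s - t| := norm_circleParam_sub_le s t
      _ ≤ _ := by gcongr
  · have := ratBits_div_le hb0 h₁ hb'
    omega
  · have := ratBits_div_le hb0 h₂ hb'
    omega

/-! ### Ordering disjoint convex sets along a direction -/

section Below

variable {E : Type*} [AddCommGroup E] [Module ℝ E] {f g : E →ₗ[ℝ] ℝ}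

/-- `X` lies below `Y`, where `f` is the horizontal and `g` the vertical coordinate: on some vertical
line, a point of `X` is below a point of `Y`. -/
def Below (f g : E →ₗ[ℝ] ℝ) (X Y : Set E) : Prop := ∃ a ∈ X, ∃ b ∈ Y, f a = f b ∧ g a < g b

/-- If `X` is below `Y` on one vertical line, then on every one: otherwise the two sets would meet on
a line in between. -/
theorem Below.lt (hfg : ∀ a b, f a = f b → g a = g b → a = b) {X Y : Set E} (hX : Convex ℝ X)
    (hY : Convex ℝ Y) (hd : Disjoint X Y) (h : Below f g X Y) {a b : E} (ha : a ∈ X) (hb : b ∈ Y)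
    (hab : f a = f b) : g a < g b := by
  obtain ⟨a', ha', b', hb', hab', hlt⟩ := h
  by_contra hcon
  push Not at hcon
  set d := g b' - g a' with hd0
  set e := g a - g b with he0
  have hdpos : 0 < d := by linarith
  have hepos : 0 ≤ e := by linarith
  have hs : d / (d + e) + e / (d + e) = 1 := by field_simp
  have hpX := hX ha ha' (by positivity : 0 ≤ d / (d + e)) (by positivity : 0 ≤ e / (d + e)) hs
  have hpY := hY hb hb' (by positivity : 0 ≤ d / (d + e)) (by positivity : 0 ≤ e / (d + e)) hs
  have : (d / (d + e)) • a + (e / (d + e)) • a' = (d / (d + e)) • b + (e / (d + e)) • b' := by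
    apply hfg
    · simp [hab, hab']
    · simp only [map_add, map_smul, smul_eq_mul]
      have h1 : g a = g b + e := by linarith
      have h2 : g b' = g a' + d := by linarith
      rw [h1, h2]
      field_simp
      ring
  exact Set.disjoint_left.1 hd hpX (this ▸ hpY)

/-- A convex set that contains points on both sides of a vertical line meets it. -/
theorem Convex.exists_mem_eq {X : Set E} (hX : Convex ℝ X) {a b : E} (ha : a ∈ X) (hb : b ∈ X)
    {x : ℝ} (hax : f a ≤ x) (hxb : x ≤ f b) : ∃ c ∈ X, f c = x := by
  rcases eq_or_lt_of_le (hax.trans hxb) with h | h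
  · exact ⟨a, ha, by linarith⟩
  · have hpos : 0 < f b - f a := by linarith
    refine ⟨_, hX ha hb (div_nonneg (by linarith : 0 ≤ f b - x) hpos.le)
      (div_nonneg (by linarith : 0 ≤ x - f a) hpos.le) (by field_simp; ring), ?_⟩
    simp only [map_add, map_smul, smul_eq_mul]
    field_simp
    ring

/-- A set between two others whose projection ends first: all three meet a common vertical line. -/
theorem Below.trans_of_csSup_le (hfg : ∀ a b, f a = f b → g a = g b → a = b) {X Y Z : Set E}
    (hX : Convex ℝ X) (hY : Convex ℝ Y) (hZ : Convex ℝ Z) (hXY : Disjoint X Y) (hYZ : Disjoint Y Z)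
    (hYb : BddAbove (f '' Y)) (hYo : ∀ a ∈ Y, ∃ b ∈ Y, f a < f b)
    (hYX : sSup (f '' Y) ≤ sSup (f '' X)) (hYZs : sSup (f '' Y) ≤ sSup (f '' Z))
    (h₁ : Below f g X Y) (h₂ : Below f g Y Z) : Below f g X Z := by
  obtain ⟨a, ha, b, hb, hab, -⟩ := id h₁
  obtain ⟨b', hb', c, hc, hbc, -⟩ := id h₂
  obtain ⟨y, hy, hyx⟩ : ∃ y ∈ Y, f y = max (f b) (f b') := by
    rcases le_total (f b) (f b') with h | h
    · exact ⟨b', hb', by rw [max_eq_right h]⟩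
    · exact ⟨b, hb, by rw [max_eq_left h]⟩
  obtain ⟨y', hy', hyy'⟩ := hYo y hy
  have hys : f y < sSup (f '' Y) := hyy'.trans_le (le_csSup hYb ⟨y', hy', rfl⟩)
  have key : ∀ W : Set E, Convex ℝ W → sSup (f '' Y) ≤ sSup (f '' W) → ∀ w ∈ W, f w ≤ f y →
      ∃ z ∈ W, f z = f y := by
    intro W hW hs w hw hwy
    obtain ⟨_, ⟨w', hw', rfl⟩, hlt⟩ := exists_lt_of_lt_csSup (s := f '' W) ⟨f w, w, hw, rfl⟩ (hys.trans_le hs)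
    exact hW.exists_mem_eq hw hw' hwy hlt.le
  obtain ⟨x, hx, hxy⟩ := key X hX hYX a ha (by rw [hab, hyx]; exact le_max_left _ _)
  obtain ⟨z, hz, hzy⟩ := key Z hZ hYZs c hc (by rw [← hbc, hyx]; exact le_max_right _ _)
  exact ⟨x, hx, z, hz, hxy.trans hzy.symm, (h₁.lt hfg hX hY hXY hx hy hxy).trans
    (h₂.lt hfg hY hZ hYZ hy hz hzy.symm)⟩

variable {ι : Type*} {U : ι → Set E}

/-- The labels are chosen in the order of decreasing right ends of the projections. All labelled sets
reach at least as far as the new set `U a`, so by `Below.trans_of_csSup_le` every set below `U a` is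
below every set above `U a`, and there is room for a label in between. -/
theorem exists_real_labels (hfg : ∀ a b, f a = f b → g a = g b → a = b)
    (hU : ∀ i, Convex ℝ (U i)) (hd : Pairwise fun i j => Disjoint (U i) (U j))
    (hb : ∀ i, BddAbove (f '' U i)) (ho : ∀ i, ∀ a ∈ U i, ∃ b ∈ U i, f a < f b) (s : Finset ι) :
    ∃ σ : ι → ℝ, InjOn σ s ∧ ∀ i ∈ s, ∀ j ∈ s, i ≠ j → Below f g (U i) (U j) → σ i < σ j := by
  classical
  induction s using Finset.induction_on_min_value (fun i => sSup (f '' U i)) with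
  | empty => exact ⟨0, by simp, by simp⟩
  | insert a s ha hmin ih =>
    obtain ⟨σ, hinj, hσ⟩ := ih
    have hne : ∀ i ∈ s, i ≠ a := fun i hi h => ha (h ▸ hi)
    obtain ⟨m, hm1, hm2⟩ := Order.exists_between_finsets
      (lo := (s.filter fun i => Below f g (U i) (U a)).image σ)
      (hi := (s.filter fun i => Below f g (U a) (U i)).image σ) (by
        intro x hx y hy
        obtain ⟨i, hi, rfl⟩ := Finset.mem_image.1 hx
        obtain ⟨j, hj, rfl⟩ := Finset.mem_image.1 hy
        rw [Finset.mem_filter] at hi hj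
        have hij : i ≠ j := by
          rintro rfl
          obtain ⟨p, hp, q, hq, hpq, hlt⟩ := hj.2
          exact lt_asymm hlt (hi.2.lt hfg (hU i) (hU a) (hd (hne i hi.1)) hq hp hpq.symm)
        exact hσ i hi.1 j hj.1 hij (hi.2.trans_of_csSup_le hfg (hU i) (hU a) (hU j)
          (hd (hne i hi.1)) (hd (hne j hj.1).symm) (hb a) (ho a) (hmin i hi.1) (hmin j hj.1) hj.2))
    -- A second choice makes the label of `a` different from all the others.
    obtain ⟨v, hv1, hv2⟩ := Order.exists_between_finsets
      (lo := insert m ((s.image σ).filter fun x => x ≤ m)) (hi := (s.image σ).filter fun x => m < x)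
      (by
        intro x hx y hy
        rw [Finset.mem_filter] at hy
        rcases Finset.mem_insert.1 hx with rfl | hx
        · exact hy.2
        · exact (Finset.mem_filter.1 hx).2.trans_lt hy.2)
    have hlow : ∀ i ∈ s, σ i ≤ m → σ i < v := fun i hi h =>
      hv1 _ (Finset.mem_insert_of_mem (Finset.mem_filter.2 ⟨Finset.mem_image_of_mem σ hi, h⟩))
    have hhigh : ∀ i ∈ s, m < σ i → v < σ i := fun i hi h =>
      hv2 _ (Finset.mem_filter.2 ⟨Finset.mem_image_of_mem σ hi, h⟩)
    have hval : ∀ i ∈ s, Function.update σ a v i = σ i := fun i hi =>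
      Function.update_of_ne (hne i hi) _ _
    have hvne : ∀ i ∈ s, σ i ≠ v := fun i hi => by
      rcases le_or_gt (σ i) m with h | h
      · exact (hlow i hi h).ne
      · exact (hhigh i hi h).ne'
    refine ⟨Function.update σ a v, ?_, ?_⟩
    · intro i hi j hj hij
      rw [Finset.coe_insert] at hi hj
      rcases hi with rfl | hi <;> rcases hj with rfl | hj
      · rfl
      · rw [hval j hj, Function.update_self] at hij
        exact absurd hij.symm (hvne j hj)
      · rw [hval i hi, Function.update_self] at hij
        exact absurd hij (hvne i hi)
      · rw [hval i hi, hval j hj] at hij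
        exact hinj hi hj hij
    · intro i hi j hj hne' hij
      rcases Finset.mem_insert.1 hi with rfl | hi' <;> rcases Finset.mem_insert.1 hj with rfl | hj'
      · exact absurd rfl hne'
      · rw [hval j hj', Function.update_self]
        exact hhigh j hj' (hm2 _ (Finset.mem_image_of_mem σ (Finset.mem_filter.2 ⟨hj', hij⟩)))
      · rw [hval i hi', Function.update_self]
        exact hlow i hi' (hm1 _ (Finset.mem_image_of_mem σ (Finset.mem_filter.2 ⟨hi', hij⟩))).le
      · rw [hval i hi', hval j hj']
        exact hσ i hi' j hj' hne' hij

/-- Disjoint convex sets can be numbered such that sets farther up have larger numbers. -/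
theorem exists_labels [Fintype ι] (hfg : ∀ a b, f a = f b → g a = g b → a = b)
    (hU : ∀ i, Convex ℝ (U i)) (hd : Pairwise fun i j => Disjoint (U i) (U j))
    (hb : ∀ i, BddAbove (f '' U i)) (ho : ∀ i, ∀ a ∈ U i, ∃ b ∈ U i, f a < f b) :
    ∃ σ : ι → ℕ, Function.Injective σ ∧ (∀ i, σ i < Fintype.card ι) ∧
      ∀ i j, i ≠ j → Below f g (U i) (U j) → σ i < σ j := by
  classical
  obtain ⟨σ, hinj, hσ⟩ := exists_real_labels (g := g) hfg hU hd hb ho Finset.univ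
  have hmono : ∀ i j, σ i < σ j →
      (Finset.univ.filter fun k => σ k < σ i).card < (Finset.univ.filter fun k => σ k < σ j).card := by
    intro i j hij
    apply Finset.card_lt_card
    rw [Finset.ssubset_iff_of_subset (Finset.monotone_filter_right _ fun k _ hk => lt_trans hk hij)]
    exact ⟨i, by simpa using hij, by simp⟩
  refine ⟨fun i => (Finset.univ.filter fun k => σ k < σ i).card, ?_, ?_, ?_⟩
  · intro i j hij
    rcases lt_trichotomy (σ i) (σ j) with h | h | h
    · exact absurd hij (hmono i j h).ne
    · exact hinj (by simp) (by simp) h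
    · exact absurd hij (hmono j i h).ne'
  · intro i
    apply Finset.card_lt_card
    rw [Finset.ssubset_iff_of_subset (Finset.filter_subset _ _)]
    exact ⟨i, Finset.mem_univ _, by simp⟩
  · intro i j hne hij
    exact hmono i j (hσ i (Finset.mem_univ _) j (Finset.mem_univ _) hne hij)

/-- Moving the sets upwards in the order of their numbers keeps them disjoint. -/
theorem disjoint_vadd_of_labels (hfg : ∀ a b, f a = f b → g a = g b → a = b)
    (hd : Pairwise fun i j => Disjoint (U i) (U j)) {σ : ι → ℕ} (hσi : Function.Injective σ)
    (hσ : ∀ i j, i ≠ j → Below f g (U i) (U j) → σ i < σ j) {e : E} (hf : f e = 0) (hg : g e = 1)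
    {c : ℝ} (hc : 0 ≤ c) :
    Pairwise fun i j => Disjoint ((c * σ i) • e +ᵥ U i) ((c * σ j) • e +ᵥ U j) := by
  have key : ∀ i j, σ i < σ j → Disjoint ((c * σ i) • e +ᵥ U i) ((c * σ j) • e +ᵥ U j) := by
    intro i j hij
    have hne : i ≠ j := fun h => by simp [h] at hij
    rw [Set.disjoint_left]
    rintro _ ⟨a, ha, rfl⟩ ⟨b, hb, hab⟩
    simp only [vadd_eq_add] at hab
    have h1 := congrArg f hab
    have h2 := congrArg g hab
    simp only [map_add, map_smul, hf, hg, smul_eq_mul, mul_zero, zero_add, mul_one] at h1 h2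
    have h3 : c * (σ i : ℝ) ≤ c * σ j := by gcongr
    rcases eq_or_lt_of_le (show g b ≤ g a by linarith) with h | h
    · exact Set.disjoint_left.1 (hd hne) ha (hfg b a h1 h ▸ hb)
    · exact lt_asymm hij (hσ j i hne.symm ⟨b, hb, a, ha, h1, h⟩)
  intro i j hij
  rcases lt_trichotomy (σ i) (σ j) with h | h | h
  · exact key i j h
  · exact absurd (hσi h) hij
  · exact (key j i h).symm

end Below

/-! ### Separating disjoint convex sets by small shifts -/

/-- Two open convex sets whose horizontal projections overlap substantially are separated by a line
that is not steep, so a vertical shift creates a distance. -/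
theorem le_dist_of_overlap {X Y : Set ℂ} (hX : Convex ℝ X) (hXo : IsOpen X) (hY : Convex ℝ Y)
    (hYo : IsOpen Y) (hd : Disjoint X Y) {η : ℝ} (hη : 0 < η) (hη1 : η ≤ 1)
    (hb : ∀ a ∈ X, ∀ b ∈ Y, |b.im - a.im| ≤ 2)
    (h₁ : ∃ a ∈ X, ∃ b ∈ Y, b.re - a.re ≤ -(η / 2)) (h₂ : ∃ a ∈ X, ∃ b ∈ Y, η / 2 ≤ b.re - a.re)
    (hord : ∀ a ∈ X, ∀ b ∈ Y, a.re = b.re → a.im < b.im) {v : ℝ} {a b : ℂ}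
    (ha : a ∈ X) (hb' : b ∈ Y) : v * η / 5 ≤ ‖v * Complex.I + (b - a)‖ := by
  obtain ⟨φ, u, hφX, hφY⟩ := geometric_hahn_banach_open_open hX hXo hY hYo hd
  set p := φ 1 with hp
  set q := φ Complex.I with hq
  have hφ : ∀ z : ℂ, φ z = p * z.re + q * z.im := by
    intro z
    have : z = z.re • (1 : ℂ) + z.im • Complex.I := by
      apply Complex.ext <;> simp
    conv_lhs => rw [this]
    rw [map_add, map_smul, map_smul, smul_eq_mul, smul_eq_mul]
    ring
  have hpos : ∀ a ∈ X, ∀ b ∈ Y, 0 < p * (b.re - a.re) + q * (b.im - a.im) := by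
    intro a ha b hb
    have h1 := hφX a ha
    have h2 := hφY b hb
    rw [hφ] at h1 h2
    linarith
  obtain ⟨a₁, ha₁, b₁, hb₁, h₁⟩ := h₁
  obtain ⟨a₂, ha₂, b₂, hb₂, h₂⟩ := h₂
  have hq0 : 0 < q := by
    set d₁ := -(b₁.re - a₁.re) with hd₁
    set d₂ := b₂.re - a₂.re with hd₂
    have hd₁0 : 0 < d₁ := by linarith
    have hd₂0 : 0 < d₂ := by linarith
    have hs : d₂ / (d₁ + d₂) + d₁ / (d₁ + d₂) = 1 := by field_simp; ring
    have hXm := hX ha₁ ha₂ (by positivity : 0 ≤ d₂ / (d₁ + d₂)) (by positivity : 0 ≤ d₁ / (d₁ + d₂)) hs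
    have hYm := hY hb₁ hb₂ (by positivity : 0 ≤ d₂ / (d₁ + d₂)) (by positivity : 0 ≤ d₁ / (d₁ + d₂)) hs
    have hre : ((d₂ / (d₁ + d₂)) • a₁ + (d₁ / (d₁ + d₂)) • a₂).re =
        ((d₂ / (d₁ + d₂)) • b₁ + (d₁ / (d₁ + d₂)) • b₂).re := by
      simp only [Complex.add_re, Complex.real_smul, Complex.re_ofReal_mul]
      have e1 : b₁.re = a₁.re - d₁ := by linarith
      have e2 : b₂.re = a₂.re + d₂ := by linarith
      rw [e1, e2]
      field_simp
      ring
    have him := hord _ hXm _ hYm hre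
    have hpos' := hpos _ hXm _ hYm
    rw [hre, sub_self, mul_zero, zero_add] at hpos'
    exact (pos_iff_pos_of_mul_pos hpos').2 (by linarith)
  have hp1 : p * η ≤ 4 * q := by
    have h3 := hpos a₁ ha₁ b₁ hb₁
    have h4 := (abs_le.1 (hb a₁ ha₁ b₁ hb₁)).2
    by_contra hcon
    push Not at hcon
    have : 0 < p := by
      by_contra hp0
      push Not at hp0
      nlinarith
    nlinarith
  have hp2 : -(4 * q) ≤ p * η := by
    have h3 := hpos a₂ ha₂ b₂ hb₂
    have h4 := (abs_le.1 (hb a₂ ha₂ b₂ hb₂)).2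
    by_contra hcon
    push Not at hcon
    have : p < 0 := by
      by_contra hp0
      push Not at hp0
      nlinarith
    nlinarith
  set z : ℂ := v * Complex.I + (b - a) with hz
  have hz1 : q * v ≤ p * z.re + q * z.im := by
    have := hpos a ha b hb'
    have e1 : z.re = b.re - a.re := by simp [hz]
    have e2 : z.im = v + (b.im - a.im) := by simp [hz]
    rw [e1, e2]
    linarith
  have hr := Complex.abs_re_le_norm z
  have hi := Complex.abs_im_le_norm z
  have hn := norm_nonneg z
  have hpa : |p| * η ≤ 4 * q := by
    rw [← abs_of_pos hη, ← abs_mul]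
    exact abs_le.2 ⟨hp2, hp1⟩
  have h5 : p * z.re ≤ |p| * ‖z‖ :=
    (le_abs_self _).trans (by rw [abs_mul]; gcongr)
  have h6 : q * z.im ≤ q * ‖z‖ := by
    gcongr
    exact (le_abs_self _).trans hi
  have h7 : q * v * η ≤ q * (5 * ‖z‖) := by
    have : |p| * ‖z‖ * η ≤ 4 * q * ‖z‖ := by nlinarith
    nlinarith [mul_le_of_le_one_right (mul_nonneg hq0.le hn) hη1]
  have h8 : v * η ≤ 5 * ‖z‖ := by
    rw [mul_assoc] at h7
    exact le_of_mul_le_mul_left h7 hq0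
  linarith

/-- Finitely many shifts `c * d` of a number, with `d` a nonzero integer, come close to `0` for at most
one `c`. So among enough values of `c` one avoids all pairs. -/
theorem exists_multiple_avoiding {ι : Type*} [Fintype ι] {n : ℕ} (hn : Fintype.card ι ≤ n)
    (hn1 : 1 ≤ n) (S : ι → ι → ℝ) {σ : ι → ℕ} (hσ : Function.Injective σ) {u : ℝ} (hu : 0 < u) :
    ∃ c : ℕ, c < n ^ 2 ∧ ∀ i j, i ≠ j → u / 2 ≤ |S i j + c * u * ((σ j : ℝ) - σ i)| := by
  classical
  by_contra hcon
  push Not at hcon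
  have h' : ∀ c : Fin (n ^ 2), ∃ p : ι × ι, p.1 ≠ p.2 ∧
      |S p.1 p.2 + c * u * ((σ p.2 : ℝ) - σ p.1)| < u / 2 := fun c => by
    obtain ⟨i, j, h1, h2⟩ := hcon c c.2
    exact ⟨(i, j), h1, h2⟩
  choose F hF1 hF2 using h'
  have hcard : (Finset.univ.filter fun p : ι × ι => p.1 ≠ p.2).card < (Finset.univ : Finset (Fin (n ^ 2))).card := by
    rw [Finset.card_univ, Fintype.card_fin]
    have h1 : (Finset.univ.filter fun p : ι × ι => p.1 ≠ p.2) = (Finset.univ : Finset ι).offDiag := by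
      ext p
      simp [Finset.mem_offDiag]
    rw [h1, Finset.offDiag_card, Finset.card_univ]
    rcases Nat.eq_zero_or_pos (Fintype.card ι) with h | h
    · rw [h]
      positivity
    · have : Fintype.card ι * Fintype.card ι ≤ n ^ 2 := by
        rw [sq]
        exact Nat.mul_le_mul hn hn
      have := Nat.mul_pos h h
      omega
  obtain ⟨c, -, c', -, hne, heq⟩ := Finset.exists_ne_map_eq_of_card_lt_of_maps_to hcard
    (f := F) (fun c _ => by simpa using hF1 c)
  have h1 := hF2 c
  have h2 := hF2 c'
  rw [heq] at h1
  have h3 := hF1 c'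
  set d : ℝ := (σ (F c').2 : ℝ) - σ (F c').1 with hd
  have hd1 : 1 ≤ |d| := by
    have : ((σ (F c').2 : ℤ) - σ (F c').1) ≠ 0 := by
      intro h
      exact h3 (hσ (by omega))
    have := Int.one_le_abs this
    rw [hd]
    exact_mod_cast this
  have hc1 : 1 ≤ |((c : ℕ) : ℝ) - ((c' : ℕ) : ℝ)| := by
    have : (((c : ℕ) : ℤ) - ((c' : ℕ) : ℤ)) ≠ 0 := by
      intro h
      exact hne (Fin.ext (by omega))
    have := Int.one_le_abs this
    exact_mod_cast this
  have h4 : u ≤ |(((c : ℕ) : ℝ) - ((c' : ℕ) : ℝ)) * u * d| := by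
    rw [abs_mul, abs_mul, abs_of_pos hu]
    nlinarith [mul_le_mul hc1 hd1 zero_le_one (by linarith)]
  have h5 : (((c : ℕ) : ℝ) - ((c' : ℕ) : ℝ)) * u * d =
      (S (F c').1 (F c').2 + (c : ℕ) * u * d) - (S (F c').1 (F c').2 + (c' : ℕ) * u * d) := by ring
  rw [h5] at h4
  have := abs_sub (S (F c').1 (F c').2 + (c : ℕ) * u * d) (S (F c').1 (F c').2 + (c' : ℕ) * u * d)
  linarith

theorem eq_of_re_eq_of_im_eq (a b : ℂ) (h1 : Complex.reLm a = Complex.reLm b)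
    (h2 : Complex.imLm a = Complex.imLm b) : a = b := Complex.ext h1 h2

theorem IsOpen.exists_re_lt {X : Set ℂ} (hX : IsOpen X) {a : ℂ} (ha : a ∈ X) :
    ∃ b ∈ X, a.re < b.re := by
  obtain ⟨r, hr, hball⟩ := Metric.isOpen_iff.1 hX a ha
  refine ⟨a + (r / 2 : ℝ), hball ?_, ?_⟩
  · rw [Metric.mem_ball, dist_eq_norm, add_sub_cancel_left, Complex.norm_real, Real.norm_eq_abs,
      abs_of_pos (by linarith)]
    linarith
  · simpa using hr

theorem IsOpen.exists_im_lt {X : Set ℂ} (hX : IsOpen X) {a : ℂ} (ha : a ∈ X) :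
    ∃ b ∈ X, a.im < b.im := by
  obtain ⟨r, hr, hball⟩ := Metric.isOpen_iff.1 hX a ha
  refine ⟨a + (r / 2 : ℝ) * Complex.I, hball ?_, ?_⟩
  · rw [Metric.mem_ball, dist_eq_norm, add_sub_cancel_left, norm_mul, Complex.norm_I, mul_one,
      Complex.norm_real, Real.norm_eq_abs, abs_of_pos (by linarith)]
    linarith
  · simpa using hr

/-- Disjoint convex sets can be moved apart by short shifts, by a distance that depends only on their
number and on the length of the shifts. A horizontal shift along the horizontal order makes the
horizontal projections of any two sets either clearly disjoint or clearly overlapping. A vertical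
shift along the vertical order then separates the pairs with overlapping projections. -/
theorem exists_separating_shifts {ι : Type*} [Fintype ι] {U : ι → Set ℂ}
    (hU : ∀ i, Convex ℝ (U i)) (hUo : ∀ i, IsOpen (U i)) (hne : ∀ i, (U i).Nonempty)
    (hd : Pairwise fun i j => Disjoint (U i) (U j)) (hb : ∀ i, U i ⊆ square 0 2) {n : ℕ}
    (hn : Fintype.card ι ≤ n) (hn1 : 1 ≤ n) {ε : ℝ} (hε : 0 < ε) (hε1 : ε ≤ 1) :
    ∃ s : ι → ℂ, (∀ i, s i ∈ square 0 ε) ∧ ∀ i j, i ≠ j → ∀ a ∈ U i, ∀ b ∈ U j,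
      ε ^ 2 / (10 * n ^ 4) ≤ ‖(s j + b) - (s i + a)‖ := by
  have hn0 : (1 : ℝ) ≤ n := by exact_mod_cast hn1
  have hbre : ∀ i, ∀ z ∈ U i, 0 ≤ z.re ∧ z.re ≤ 2 := fun i z hz => (hb i hz).1
  have hbim : ∀ i, ∀ z ∈ U i, 0 ≤ z.im ∧ z.im ≤ 2 := fun i z hz => (hb i hz).2
  obtain ⟨σ, hσi, hσn, hσ⟩ := exists_labels (U := U) (f := Complex.imLm) (g := Complex.reLm)
    (fun a b h1 h2 => eq_of_re_eq_of_im_eq a b h2 h1) hU hd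
    (fun i => ⟨2, by rintro _ ⟨z, hz, rfl⟩; exact (hbim i z hz).2⟩)
    (fun i a ha => (hUo i).exists_im_lt ha)
  set u : ℝ := ε / n ^ 3 with hu
  have hu0 : 0 < u := by positivity
  have hu1 : u ≤ 1 := by
    rw [hu, div_le_one (by positivity)]
    exact hε1.trans (one_le_pow₀ hn0)
  set S : ι → ι → ℝ := fun i j => sSup ((fun p : ℂ × ℂ => p.2.re - p.1.re) '' (U i ×ˢ U j)) with hS
  have hSb : ∀ i j, BddAbove ((fun p : ℂ × ℂ => p.2.re - p.1.re) '' (U i ×ˢ U j)) := by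
    intro i j
    refine ⟨2, ?_⟩
    rintro _ ⟨⟨a, b⟩, ⟨ha, hb⟩, rfl⟩
    have h1 := hbre i a ha
    have h2 := hbre j b hb
    show b.re - a.re ≤ 2
    linarith
  obtain ⟨c, hc, hcS⟩ := exists_multiple_avoiding hn hn1 S hσi hu0
  have hcu : 0 ≤ c * u := by positivity
  set x : ι → ℂ := fun i => (c * u * σ i) • (1 : ℂ) with hx
  set V : ι → Set ℂ := fun i => x i +ᵥ U i with hV
  have hxre : ∀ i, (x i).re = c * u * σ i := fun i => by simp [hx]
  have hxim : ∀ i, (x i).im = 0 := fun i => by simp [hx]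
  have hVd : Pairwise fun i j => Disjoint (V i) (V j) :=
    disjoint_vadd_of_labels (fun a b h1 h2 => eq_of_re_eq_of_im_eq a b h2 h1) hd hσi hσ
      (by simp) (by simp) hcu
  have hVc : ∀ i, Convex ℝ (V i) := fun i => (hU i).vadd _
  have hVo : ∀ i, IsOpen (V i) := fun i => (hUo i).vadd _
  have hxle : ∀ i, c * u * σ i ≤ ε := by
    intro i
    have h1 : (c : ℝ) ≤ n ^ 2 := by exact_mod_cast hc.le
    have h2 : (σ i : ℝ) ≤ n := by exact_mod_cast (hσn i).le.trans hn
    calc c * u * σ i ≤ n ^ 2 * u * n := by gcongr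
      _ = ε := by
        rw [hu]
        field_simp
  obtain ⟨τ, hτi, hτn, hτ⟩ := exists_labels (U := V) (f := Complex.reLm) (g := Complex.imLm)
    eq_of_re_eq_of_im_eq hVc hVd
    (fun i => ⟨3, by
      rintro _ ⟨_, ⟨z, hz, rfl⟩, rfl⟩
      have h1 := (hbre i z hz).2
      have h2 := hxle i
      simp only [vadd_eq_add, Complex.reLm_coe, Complex.add_re, hxre]
      linarith⟩)
    (fun i a ha => (hVo i).exists_re_lt ha)
  set v : ℝ := ε / n with hv
  have hv0 : 0 < v := by positivity
  have hρ1 : ε ^ 2 / (10 * n ^ 4) = v * u / 5 / 2 := by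
    rw [hu, hv]
    field_simp
    norm_num
  have hv1 : v ≤ 1 := by
    rw [hv, div_le_one (by positivity)]
    linarith
  -- The pairs for which the first one has the smaller number in the vertical order.
  have key : ∀ i j, τ i < τ j → ∀ a ∈ U i, ∀ b ∈ U j, ε ^ 2 / (10 * n ^ 4) ≤
      ‖((x j + (v * τ j : ℝ) * Complex.I) + b) - ((x i + (v * τ i : ℝ) * Complex.I) + a)‖ := by
    intro i j hij a ha b hb'
    have hne' : i ≠ j := fun h => by simp [h] at hij
    set z := ((x j + (v * τ j : ℝ) * Complex.I) + b) - ((x i + (v * τ i : ℝ) * Complex.I) + a) with hz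
    have hzre : z.re = (b.re - a.re) + c * u * ((σ j : ℝ) - σ i) := by
      simp [hz, hxre]
      ring
    have hzn := Complex.abs_re_le_norm z
    have hle : ε ^ 2 / (10 * n ^ 4) ≤ u / 2 := by
      rw [hρ1]
      nlinarith
    have hupper : ∀ i j, ∀ a ∈ U i, ∀ b ∈ U j, b.re - a.re ≤ S i j := fun i j a ha b hb =>
      le_csSup (hSb i j) ⟨(a, b), ⟨ha, hb⟩, rfl⟩
    have happrox : ∀ i j, u / 2 ≤ S i j + c * u * ((σ j : ℝ) - σ i) →
        ∃ a ∈ V i, ∃ b ∈ V j, u / 2 / 2 ≤ b.re - a.re := by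
      intro i j h
      obtain ⟨_, ⟨⟨a, b⟩, ⟨ha, hb⟩, rfl⟩, hlt⟩ := exists_lt_of_lt_csSup
        (((hne i).prod (hne j)).image _) (show S i j - u / 4 < S i j by linarith)
      refine ⟨x i + a, ⟨a, ha, rfl⟩, x j + b, ⟨b, hb, rfl⟩, ?_⟩
      simp only [Complex.add_re, hxre]
      simp only at hlt
      linarith
    rcases le_abs'.1 (hcS i j hne') with h1 | h1
    · have := hupper i j a ha b hb'
      have h3 : z.re ≤ -(u / 2) := by linarith
      linarith [neg_le_abs z.re]
    rcases le_abs'.1 (hcS j i hne'.symm) with h2 | h2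
    · have := hupper j i b hb' a ha
      have h3 : u / 2 ≤ z.re := by linarith
      linarith [le_abs_self z.re]
    have hfin := le_dist_of_overlap (hVc i) (hVo i) (hVc j) (hVo j) (hVd hne') (η := u / 2)
      (by linarith) (by linarith)
      (by
        rintro _ ⟨a, ha, rfl⟩ _ ⟨b, hb, rfl⟩
        have h3 := hbim i a ha
        have h4 := hbim j b hb
        simp only [vadd_eq_add, Complex.add_im, hxim, zero_add]
        rw [abs_le]
        constructor <;> linarith)
      (by
        obtain ⟨b, hb, a, ha, h⟩ := happrox j i h2
        exact ⟨a, ha, b, hb, by linarith⟩)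
      (happrox i j h1)
      (by
        intro a ha b hb hab
        rcases lt_trichotomy a.im b.im with h | h | h
        · exact h
        · exact absurd (Complex.ext hab h ▸ hb) (Set.disjoint_left.1 (hVd hne') ha)
        · exact absurd (hτ j i hne'.symm ⟨b, hb, a, ha, hab.symm, h⟩) (lt_asymm hij))
      (v := v * ((τ j : ℝ) - τ i))
      (show x i + a ∈ V i from ⟨a, ha, rfl⟩) (show x j + b ∈ V j from ⟨b, hb', rfl⟩)
    have hz' : ((v * ((τ j : ℝ) - τ i) : ℝ) : ℂ) * Complex.I + (x j + b - (x i + a)) = z := by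
      rw [hz]
      push_cast
      ring
    rw [hz'] at hfin
    refine le_trans ?_ hfin
    rw [hρ1]
    have hτ1 : (1 : ℝ) ≤ (τ j : ℝ) - τ i := by
      have : (τ i : ℝ) + 1 ≤ τ j := by exact_mod_cast hij
      linarith
    have : v * u ≤ v * ((τ j : ℝ) - τ i) * u := by
      apply mul_le_mul_of_nonneg_right _ hu0.le
      exact le_mul_of_one_le_right hv0.le hτ1
    linarith
  refine ⟨fun i => x i + (v * τ i : ℝ) * Complex.I, fun i => ?_, fun i j hij a ha b hb' => ?_⟩
  · have h2 : (τ i : ℝ) ≤ n := by exact_mod_cast (hτn i).le.trans hn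
    have h3 : v * τ i ≤ ε := by
      calc v * τ i ≤ v * n := by gcongr
        _ = ε := by
          rw [hv]
          field_simp
    have h4 : (x i + (v * τ i : ℝ) * Complex.I).re = c * u * σ i := by simp [hxre]
    have h5 : (x i + (v * τ i : ℝ) * Complex.I).im = v * τ i := by simp [hxim]
    refine ⟨?_, ?_⟩
    · rw [h4]
      exact ⟨by positivity, hxle i⟩
    · rw [h5]
      exact ⟨by positivity, h3⟩
  · rcases lt_trichotomy (τ i) (τ j) with h | h | h
    · exact key i j h a ha b hb'
    · exact absurd (hτi h) hij
    · rw [norm_sub_rev]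
      exact key j i h b hb' a ha

/-! ### Packing -/

theorem square_mono {a b a' b' : ℝ} (ha : a' ≤ a) (hb : b ≤ b') : square a b ⊆ square a' b' :=
  fun _ hz => ⟨Icc_subset_Icc ha hb hz.1, Icc_subset_Icc ha hb hz.2⟩

namespace Packing

variable {Apart : Set ℂ → Set ℂ → Prop}

theorem isMonotone : (problem Apart).IsMonotone := by
  intro I α _ α' _ hαα' x hx
  exact ⟨fun i hi => ⟨(hx.1 i hi).1, (hx.1 i hi).2.trans (square_mono le_rfl (by linarith))⟩, hx.2⟩

theorem value_le (I : (problem Apart).Input) (x : (problem Apart).Solution I) :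
    (problem Apart).value x ≤ I.N := by
  show x.packed.card ≤ I.N
  simpa using Finset.card_le_univ x.packed

theorem exists_isOptimal (I : (problem Apart).Input) (α : ℝ) :
    ∃ x, (problem Apart).IsOptimal I α x := by
  refine AugmentationProblem.exists_isOptimal (N := I.N)
    ⟨(⟨∅, 0, 0⟩ : Solution I.N), fun i hi => absurd hi (Finset.notMem_empty i),
      fun i hi => absurd hi (Finset.notMem_empty i)⟩ fun x _ => ?_
  have := value_le I x
  have h : (problem Apart).score ((problem Apart).value x) = (problem Apart).value x := rfl
  rw [h]
  exact_mod_cast this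

theorem isModerate : (problem Apart).IsModerate := by
  refine ⟨4, fun I => ?_⟩
  have hopt : ∀ α ∈ (problem Apart).dom I, (problem Apart).opt I α ≤ I.N := by
    intro α _
    obtain ⟨x, hx⟩ := exists_isOptimal I α
    rw [← hx.value_eq_opt]
    exact value_le I x
  refine (AugmentationProblem.encard_breakpoints_le isMonotone (fun I α _ => exists_isOptimal I α)
    (show (Icc (0 : ℝ) 1).OrdConnected from ordConnected_Icc) hopt).trans ?_
  have h1 : I.N ≤ (problem Apart).size I := le_max_right _ _
  have h2 : 2 ≤ (problem Apart).size I := le_max_left _ _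
  have h3 : (problem Apart).size I ≤ (problem Apart).size I ^ 4 := Nat.le_self_pow (by norm_num) _
  exact_mod_cast (show I.N + 3 ≤ 4 * (problem Apart).size I ^ 4 by omega)

theorem convex_placed {I : Input} {x : Solution I.N} {i : Fin I.N} (h : ‖x.rot i‖ = 1) :
    Convex ℝ (placed I x i) ∧ placed I x i ⊆ closure (interior (placed I x i)) ∧
      (interior (placed I x i)).Nonempty := by
  have hr : x.rot i ≠ 0 := by
    intro h0
    simp [h0] at h
  have hconv : Convex ℝ (placed I x i) := by
    have h1 : placed I x i = (fun z => z + x.shift i) '' (LinearMap.mulLeft ℝ (x.rot i) '' I.K i) := by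
      rw [← image_comp]
      rfl
    rw [h1, image_add_right]
    exact ((I.convex i).linear_image _).translate_preimage_left _
  have hne : (interior (placed I x i)).Nonempty := by
    obtain ⟨z, hz⟩ := I.interior_nonempty i
    let e : ℂ ≃ₜ ℂ := (Homeomorph.mulLeft₀ (x.rot i) hr).trans (Homeomorph.addRight (x.shift i))
    have : placed I x i = e '' I.K i := rfl
    rw [this, ← e.image_interior]
    exact ⟨e z, z, hz, rfl⟩
  refine ⟨hconv, ?_, hne⟩
  rw [hconv.closure_interior_eq_closure_of_nonempty_interior hne]
  exact subset_closure

theorem norm_le_two_of_mem_square {z : ℂ} (hz : z ∈ square 0 1) : ‖z‖ ≤ 2 := by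
  have h := Complex.norm_le_abs_re_add_abs_im z
  rw [abs_of_nonneg hz.1.1, abs_of_nonneg hz.2.1] at h
  linarith [hz.1.2, hz.2.2]

/-- A packing can be perturbed to a packing with short rational coordinates: the objects are moved
apart and away from the boundary of the slightly larger container, and the positions are rounded. -/
theorem isSmoothable (h₁ : ∀ X Y, Apart X Y → Disjoint (interior X) (interior Y))
    (h₂ : ∀ X Y, Disjoint X Y → Apart X Y) : (problem Apart).IsSmoothable := by
  refine ⟨74, fun A I α ε hα hε hαε x hx => ?_⟩
  have hα0 : 0 ≤ α := hα.1
  have hαε1 : α + ε ≤ 1 := hαε.2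
  obtain ⟨hsq, hap⟩ : (∀ i ∈ x.packed, ‖x.rot i‖ = 1 ∧ placed I x i ⊆ square 0 (1 + α)) ∧
    ∀ i ∈ x.packed, ∀ j ∈ x.packed, i ≠ j → Apart (placed I x i) (placed I x j) := hx.1
  set n : ℕ := max 2 I.N with hn
  have hn2 : (2 : ℝ) ≤ n := by exact_mod_cast le_max_left _ _
  have hcard : Fintype.card {i // i ∈ x.packed} ≤ n := by
    rw [Fintype.card_coe]
    exact (value_le (Apart := Apart) I x).trans (le_max_right _ _)
  have hbody : ∀ i : {i // i ∈ x.packed}, _ := fun i => convex_placed (hsq i i.2).1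
  obtain ⟨s, hs, hsep⟩ := exists_separating_shifts
    (U := fun i : {i // i ∈ x.packed} => interior (placed I x i))
    (fun i => (hbody i).1.interior) (fun i => isOpen_interior) (fun i => (hbody i).2.2)
    (fun i j hij => h₁ _ _ (hap i i.2 j j.2 fun h => hij (Subtype.ext h)))
    (fun i => interior_subset.trans ((hsq i i.2).2.trans (square_mono le_rfl (by linarith))))
    hcard (le_trans (by norm_num) (le_max_left _ _)) (show 0 < ε / 4 by linarith)
    (by linarith)
  -- The shifts move the objects by at most `ε / 4` to the right and upwards. A further translation by
  -- `ε / 4` in both directions leaves room for the rounding errors, which are below `ρ / 2 ≤ ε / 8`.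
  set ρ : ℝ := (ε / 4) ^ 2 / (10 * n ^ 4) with hρ
  have hρ0 : 0 < ρ := by positivity
  have hρε : ρ ≤ ε / 4 := by
    rw [hρ, div_le_iff₀ (by positivity)]
    have : (1 : ℝ) ≤ n ^ 4 := one_le_pow₀ (by linarith)
    nlinarith
  have hsep' : ∀ i j : {i // i ∈ x.packed}, i ≠ j → ∀ a ∈ placed I x i, ∀ b ∈ placed I x j,
      ρ ≤ ‖(s j + b) - (s i + a)‖ := by
    intro i j hij a ha b hb
    have hcl : IsClosed {p : ℂ × ℂ | ρ ≤ ‖(s j + p.2) - (s i + p.1)‖} :=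
      isClosed_le continuous_const (by fun_prop)
    have hmem : (a, b) ∈ closure (interior (placed I x i) ×ˢ interior (placed I x j)) := by
      rw [closure_prod_eq]
      exact ⟨(hbody i).2.1 ha, (hbody j).2.1 hb⟩
    exact closure_minimal (fun p hp => hsep i j hij p.1 hp.1 p.2 hp.2) hcl hmem
  obtain ⟨k, hk, hk'⟩ := exists_half_pow_le (show 0 < ρ / 16 by linarith) (by linarith)
  set κ : ℝ := (2 : ℝ)⁻¹ ^ k with hκ
  have hround : ∀ i : Fin I.N, ∃ p q a b : ℚ, (ratBits p ≤ 4 * k + 6 ∧ ratBits q ≤ 4 * k + 6 ∧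
      ratBits a ≤ 4 * k + 6 ∧ ratBits b ≤ 4 * k + 6) ∧ ∀ hi : i ∈ x.packed,
        ‖(⟨p, q⟩ : ℂ)‖ = 1 ∧ ∀ z ∈ I.K i, ‖((⟨p, q⟩ : ℂ) * z + ⟨a, b⟩) -
          (s ⟨i, hi⟩ + (x.rot i * z + x.shift i) + ⟨ε / 4, ε / 4⟩)‖ ≤ 6 * κ := by
    intro i
    by_cases hi : i ∈ x.packed
    · obtain ⟨p, q, hpq1, hpq, hp, hq⟩ := exists_rat_rotation_near (hsq i hi).1 k
      set t : ℂ := x.shift i + s ⟨i, hi⟩ + ⟨ε / 4, ε / 4⟩ with ht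
      obtain ⟨z₀, hz₀⟩ := I.interior_nonempty i
      have hz₀K := interior_subset hz₀
      have hz₀2 := norm_le_two_of_mem_square (I.subset_square i hz₀K)
      have hrz : ‖x.rot i * z₀‖ ≤ 2 := by rwa [norm_mul, (hsq i hi).1, one_mul]
      have hpl := (hsq i hi).2 ⟨z₀, hz₀K, rfl⟩
      have hsi := hs ⟨i, hi⟩
      have hre := abs_le.1 ((Complex.abs_re_le_norm _).trans hrz)
      have him := abs_le.1 ((Complex.abs_im_le_norm _).trans hrz)
      have hp1 := hpl.1
      have hp2 := hpl.2
      simp only [Complex.add_re, Complex.add_im, mem_Icc] at hp1 hp2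
      obtain ⟨a, ha, ha'⟩ := exists_shortRat_near (x := t.re) (A := 3) k (by
        rw [ht, abs_le]
        simp only [Complex.add_re]
        constructor <;> linarith [hsi.1.1, hsi.1.2])
      obtain ⟨b, hb, hb'⟩ := exists_shortRat_near (x := t.im) (A := 3) k (by
        rw [ht, abs_le]
        simp only [Complex.add_im]
        constructor <;> linarith [hsi.2.1, hsi.2.2])
      refine ⟨p, q, a, b, ⟨by omega, by omega, by omega, by omega⟩, fun _ => ?_⟩
      rw [Complex.mk_eq_add_mul_I]
      have hpq1' : ‖((p : ℝ) : ℂ) + ((q : ℝ) : ℂ) * Complex.I‖ = 1 := by exact_mod_cast hpq1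
      refine ⟨hpq1', fun z hz => ?_⟩
      have hz2 := norm_le_two_of_mem_square (I.subset_square i hz)
      have heq : (((p : ℝ) : ℂ) + ((q : ℝ) : ℂ) * Complex.I) * z + ⟨a, b⟩ -
          (s ⟨i, hi⟩ + (x.rot i * z + x.shift i) + ⟨ε / 4, ε / 4⟩) =
          ((((p : ℝ) : ℂ) + ((q : ℝ) : ℂ) * Complex.I) - x.rot i) * z + ((⟨a, b⟩ : ℂ) - t) := by
        rw [ht]
        ring
      have hab : ‖(⟨a, b⟩ : ℂ) - t‖ ≤ 2 * κ := by
        refine (Complex.norm_le_abs_re_add_abs_im _).trans ?_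
        simp only [Complex.sub_re, Complex.sub_im]
        linarith
      rw [heq]
      calc _ ≤ ‖(((p : ℝ) : ℂ) + ((q : ℝ) : ℂ) * Complex.I) - x.rot i‖ * ‖z‖ +
            ‖(⟨a, b⟩ : ℂ) - t‖ := (norm_add_le _ _).trans_eq (by rw [norm_mul])
        _ ≤ (2 * κ) * 2 + 2 * κ := by
          gcongr
        _ = 6 * κ := by ring
    · have h0 : ratBits 0 ≤ 4 * k + 6 := by
        have : ratBits 0 = 2 := by simp [ratBits, intBits]
        omega
      exact ⟨0, 0, 0, 0, ⟨h0, h0, h0, h0⟩, fun h => absurd h hi⟩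
  choose p q a b hbits hpos using hround
  set x' : Solution I.N := ⟨x.packed, fun i => ⟨p i, q i⟩, fun i => ⟨a i, b i⟩⟩ with hx'
  have hκρ : 6 * κ < ρ / 2 := by linarith
  refine ⟨x', ⟨fun i hi => ⟨(hpos i hi).1, ?_⟩, fun i hi j hj hij => ?_⟩, ?_, ?_⟩
  · rintro _ ⟨z, hz, rfl⟩
    have h := (hpos i hi).2 z hz
    have hre := abs_le.1 ((Complex.abs_re_le_norm _).trans h)
    have him := abs_le.1 ((Complex.abs_im_le_norm _).trans h)
    have hpl := (hsq i hi).2 ⟨z, hz, rfl⟩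
    have hsi := hs ⟨i, hi⟩
    have hp1 := hpl.1
    have hp2 := hpl.2
    simp only [Complex.add_re, Complex.sub_re, Complex.add_im, Complex.sub_im, mem_Icc] at hp1 hp2 hre him
    refine ⟨?_, ?_⟩
    · simp only [Complex.add_re, mem_Icc, hx']
      constructor <;> linarith [hsi.1.1, hsi.1.2]
    · simp only [Complex.add_im, mem_Icc, hx']
      constructor <;> linarith [hsi.2.1, hsi.2.2]
  · apply h₂
    rw [Set.disjoint_left]
    rintro _ ⟨z, hz, rfl⟩ ⟨w, hw, hzw⟩
    have e1 := (hpos i hi).2 z hz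
    have e2 := (hpos j hj).2 w hw
    have e3 := hsep' ⟨i, hi⟩ ⟨j, hj⟩ (fun h => hij (congrArg Subtype.val h)) _ ⟨z, hz, rfl⟩ _ ⟨w, hw, rfl⟩
    simp only [hx'] at hzw
    simp only at e3
    rw [hzw] at e2
    set Z := (⟨(p i : ℝ), (q i : ℝ)⟩ : ℂ) * z + ⟨a i, b i⟩ with hZ
    have : (s ⟨j, hj⟩ + (x.rot j * w + x.shift j)) - (s ⟨i, hi⟩ + (x.rot i * z + x.shift i)) =
        (Z - (s ⟨i, hi⟩ + (x.rot i * z + x.shift i) + ⟨ε / 4, ε / 4⟩)) -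
        (Z - (s ⟨j, hj⟩ + (x.rot j * w + x.shift j) + ⟨ε / 4, ε / 4⟩)) := by ring
    rw [this] at e3
    have := norm_sub_le (Z - (s ⟨i, hi⟩ + (x.rot i * z + x.shift i) + ⟨ε / 4, ε / 4⟩))
      (Z - (s ⟨j, hj⟩ + (x.rot j * w + x.shift j) + ⟨ε / 4, ε / 4⟩))
    linarith
  · exact AugmentationProblem.atLeastAsGood_iff.2 le_rfl
  · have hbit := AugmentationProblem.bitIn_le_of_rational (P := problem Apart) A I (α + ε) x'
      (l := (List.ofFn fun i => [p i, q i, a i, b i]).flatten) (m := 4 * k + 6)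
      (by
        rw [List.map_flatten, List.map_ofFn]
        rfl)
      (by
        intro r hr
        obtain ⟨l, hl, hrl⟩ := List.mem_flatten.1 hr
        obtain ⟨i, rfl⟩ := List.mem_ofFn.1 hl
        obtain ⟨b1, b2, b3, b4⟩ := hbits i
        simp only [List.mem_cons, List.not_mem_nil, or_false] at hrl
        rcases hrl with rfl | rfl | rfl | rfl <;> assumption)
      (by
        intro z hz
        obtain ⟨i, rfl⟩ := List.mem_ofFn.1 hz
        have h0 : intBits 0 = 1 := by simp [intBits]
        have h1 : intBits 1 = 1 := by simp [intBits]
        show intBits (if i ∈ x.packed then 1 else 0) ≤ _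
        split_ifs <;> omega)
    have hn0 : (0 : ℝ) < n := by linarith
    have hM1 : 1 ≤ Real.logb 2 (n / ε) := by
      rw [Real.le_logb_iff_rpow_le (by norm_num) (by positivity), Real.rpow_one, le_div_iff₀ hε]
      nlinarith
    have hlog : Real.logb 2 (1 / (ρ / 16)) ≤ 12 + 4 * Real.logb 2 (n / ε) := by
      have h12 : (12 : ℝ) = Real.logb 2 (2 ^ 12) := by
        rw [Real.logb_pow, Real.logb_self_eq_one (by norm_num)]
        norm_num
      have h4 : 4 * Real.logb 2 (n / ε) = Real.logb 2 ((n / ε) ^ 4) := by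
        rw [Real.logb_pow]
        norm_num
      rw [h12, h4, ← Real.logb_mul (by positivity) (by positivity)]
      apply Real.logb_le_logb_of_le (by norm_num) (by positivity)
      rw [hρ, div_le_iff₀ (by positivity)]
      have hε2 : ε ^ 2 ≤ 1 := pow_le_one₀ hε.le (by linarith)
      have : (2 : ℝ) ^ 12 * (n / ε) ^ 4 * ((ε / 4) ^ 2 / (10 * n ^ 4) / 16) = 8 / (5 * ε ^ 2) := by
        field_simp
        norm_num
      rw [this, le_div_iff₀ (by positivity)]
      linarith
    have hm : ((4 * k + 6 : ℕ) : ℝ) ≤ (74 : ℕ) * Real.logb 2 (n / ε) := by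
      push_cast
      linarith
    calc (((problem Apart).bitIn A I (α + ε) x' : ℕ∞) : ℝ≥0∞) ≤ ((4 * k + 6 : ℕ) : ℝ≥0∞) := by
          exact_mod_cast hbit
      _ = ENNReal.ofReal ((4 * k + 6 : ℕ) : ℝ) := (ENNReal.ofReal_natCast _).symm
      _ ≤ _ := ENNReal.ofReal_le_ofReal hm

end Packing

/-! ### The winding number of a polygon -/

namespace ArtGallery

variable {n : ℕ} [NeZero n] {v : Fin n → ℂ} {z : ℂ}

theorem isCompact_edge (v : Fin n → ℂ) (i : Fin n) : IsCompact (edge v i) := by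
  rw [edge, ← convexHull_pair]
  exact (Set.toFinite _).isCompact_convexHull ℝ

theorem isCompact_boundary (v : Fin n → ℂ) : IsCompact (boundary v) :=
  isCompact_iUnion fun i => isCompact_edge v i

theorem edge_subset_boundary (v : Fin n → ℂ) (i : Fin n) : edge v i ⊆ boundary v :=
  subset_iUnion (edge v) i

theorem vertex_mem_boundary (v : Fin n → ℂ) (i : Fin n) : v i ∈ boundary v :=
  edge_subset_boundary v i (left_mem_segment ℝ _ _)

/-- The sum of the angles under which the edges are seen from `z`. -/
def angleSum (v : Fin n → ℂ) (z : ℂ) : ℝ := ∑ i, Complex.arg ((v (i + 1) - z) / (v i - z))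

/-- The winding number of a closed polygonal curve around a point. The quotient is an integer if the
point is not a vertex (`angleSum_eq`); the rounding only changes its type. -/
def winding (v : Fin n → ℂ) (z : ℂ) : ℤ := round (angleSum v z / (2 * Real.pi))

theorem exists_angleSum_eq (h : ∀ i, v i ≠ z) : ∃ k : ℤ, angleSum v z = k * (2 * Real.pi) := by
  have h0 : ∀ i, (v i - z) ≠ 0 := fun i => sub_ne_zero.2 (h i)
  have hprod : ∏ i, ((v (i + 1) - z) / (v i - z)) = 1 := by
    rw [Finset.prod_div_distrib, div_eq_one_iff_eq (Finset.prod_ne_zero_iff.2 fun i _ => h0 i)]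
    exact Fintype.prod_equiv (Equiv.addRight 1) _ _ fun i => rfl
  have hexp : Complex.exp (angleSum v z * Complex.I) = 1 := by
    have h1 : ∀ w : ℂ, w ≠ 0 → Complex.exp (w.arg * Complex.I) = w / ‖w‖ := by
      intro w hw
      rw [eq_div_iff (by simpa using hw), mul_comm, Complex.norm_mul_exp_arg_mul_I]
    rw [angleSum, Complex.ofReal_sum, Finset.sum_mul, Complex.exp_sum]
    calc _ = ∏ i, ((v (i + 1) - z) / (v i - z)) / (‖(v (i + 1) - z) / (v i - z)‖ : ℂ) :=
          Finset.prod_congr rfl fun i _ => h1 _ (div_ne_zero (h0 _) (h0 _))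
      _ = 1 := by
          rw [Finset.prod_div_distrib, ← Complex.ofReal_prod, ← norm_prod, hprod]
          simp
  obtain ⟨k, hk⟩ := Complex.exp_eq_one_iff.1 hexp
  refine ⟨k, ?_⟩
  have h2 : (angleSum v z : ℂ) = (k * (2 * Real.pi) : ℝ) := by
    apply mul_right_cancel₀ Complex.I_ne_zero
    rw [hk]
    push_cast
    ring
  exact_mod_cast h2

theorem angleSum_eq (h : ∀ i, v i ≠ z) : angleSum v z = winding v z * (2 * Real.pi) := by
  obtain ⟨k, hk⟩ := exists_angleSum_eq h
  have : winding v z = k := by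
    rw [winding, hk, mul_div_cancel_right₀ _ Real.two_pi_pos.ne', round_intCast]
  rw [this, hk]

theorem vertex_ne_of_notMem_boundary (h : z ∉ boundary v) (i : Fin n) : v i ≠ z :=
  fun hi => h (hi ▸ vertex_mem_boundary v i)

theorem div_mem_slitPlane {a b z : ℂ} (h : z ∉ segment ℝ a b) :
    (b - z) / (a - z) ∈ Complex.slitPlane := by
  have ha : a - z ≠ 0 := fun h0 => h (by
    rw [← sub_eq_zero.1 h0]
    exact left_mem_segment ℝ _ _)
  by_contra hs
  rw [Complex.mem_slitPlane_iff] at hs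
  push Not at hs
  set w := (b - z) / (a - z) with hw
  have hwr : w = ((w.re : ℝ) : ℂ) := Complex.ext (by simp) (by simpa using hs.2)
  have hb : b - z = w.re * (a - z) := by
    rw [← hwr, hw, div_mul_cancel₀ _ ha]
  refine h ⟨-w.re / (1 - w.re), 1 / (1 - w.re), div_nonneg (by linarith) (by linarith),
    div_nonneg zero_le_one (by linarith), ?_, ?_⟩
  · rw [← add_div, div_eq_one_iff_eq (by linarith)]
    ring
  · have h1 : (1 - w.re : ℂ) ≠ 0 := by
      have : (1 - w.re : ℝ) ≠ 0 := by linarith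
      exact_mod_cast this
    have hb' : b = w.re * (a - z) + z := by rw [← hb]; ring
    rw [Complex.real_smul, Complex.real_smul, hb']
    push_cast
    field_simp
    ring

theorem continuousAt_angleSum (h : z ∉ boundary v) :
    ContinuousAt (fun p : (Fin n → ℂ) × ℂ => angleSum p.1 p.2) (v, z) := by
  unfold angleSum
  refine tendsto_finsetSum _ fun i _ => ?_
  have hi : z ∉ edge v i := fun hz => h (edge_subset_boundary v i hz)
  have h1 := Complex.continuousAt_arg (div_mem_slitPlane hi)
  have h2 : ContinuousAt (fun p : (Fin n → ℂ) × ℂ => (p.1 (i + 1) - p.2) / (p.1 i - p.2)) (v, z) := by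
    refine ContinuousAt.div (by fun_prop) (by fun_prop) ?_
    exact sub_ne_zero.2 (vertex_ne_of_notMem_boundary h i)
  exact ContinuousAt.comp (f := fun p : (Fin n → ℂ) × ℂ => (p.1 (i + 1) - p.2) / (p.1 i - p.2)) h1 h2

/-- The winding number is locally constant in the curve and the point. -/
theorem eventually_winding_eq (h : z ∉ boundary v) :
    ∀ᶠ p : (Fin n → ℂ) × ℂ in 𝓝 (v, z), winding p.1 p.2 = winding v z := by
  have h1 : ∀ᶠ p : (Fin n → ℂ) × ℂ in 𝓝 (v, z), ∀ i, p.1 i ≠ p.2 := by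
    rw [eventually_all]
    intro i
    have hc : ContinuousAt (fun p : (Fin n → ℂ) × ℂ => p.1 i - p.2) (v, z) := by fun_prop
    filter_upwards [hc.eventually_ne (sub_ne_zero.2 (vertex_ne_of_notMem_boundary h i))] with p hp
    exact sub_ne_zero.1 hp
  have h2 := Metric.tendsto_nhds.1 (continuousAt_angleSum h) (2 * Real.pi) Real.two_pi_pos
  filter_upwards [h1, h2] with p hp1 hp2
  rw [angleSum_eq hp1, angleSum_eq (vertex_ne_of_notMem_boundary h), Real.dist_eq, ← sub_mul, abs_mul,
    abs_of_pos Real.two_pi_pos] at hp2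
  have h3 : |(winding p.1 p.2 : ℝ) - winding v z| < 1 := by
    by_contra hcon
    push Not at hcon
    nlinarith [Real.two_pi_pos]
  have h4 : |winding p.1 p.2 - winding v z| < 1 := by exact_mod_cast h3
  rw [Int.abs_lt_one_iff] at h4
  omega

theorem continuousAt_winding {X : Type*} [TopologicalSpace X] {f : X → Fin n → ℂ} {g : X → ℂ} {x : X}
    (hf : ContinuousAt f x) (hg : ContinuousAt g x) (h : g x ∉ boundary (f x)) :
    ContinuousAt (fun y => winding (f y) (g y)) x := by
  have h1 : ∀ᶠ y in 𝓝 x, winding (f y) (g y) = winding (f x) (g x) :=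
    (hf.prodMk hg).eventually (eventually_winding_eq h)
  exact tendsto_const_nhds.congr' (h1.mono fun y hy => hy.symm)

theorem winding_eq_of_isPreconnected {S : Set ℂ} (hS : IsPreconnected S) (hd : Disjoint S (boundary v))
    {x y : ℂ} (hx : x ∈ S) (hy : y ∈ S) : winding v x = winding v y :=
  hS.constant (f := winding v) (fun _ hw => (continuousAt_winding (f := fun _ => v) (g := id)
    continuousAt_const continuousAt_id (Set.disjoint_left.1 hd hw)).continuousWithinAt) hx hy

theorem tendsto_angleSum_cobounded (v : Fin n → ℂ) :
    Tendsto (angleSum v) (Bornology.cobounded ℂ) (𝓝 0) := by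
  have h1 : ∀ i, Tendsto (fun z => Complex.arg ((v (i + 1) - z) / (v i - z))) (Bornology.cobounded ℂ)
      (𝓝 0) := by
    intro i
    have h2 : Tendsto (fun z => (v (i + 1) - z) / (v i - z)) (Bornology.cobounded ℂ) (𝓝 1) := by
      have h3 : Tendsto (fun z : ℂ => v i - z) (Bornology.cobounded ℂ) (Bornology.cobounded ℂ) := by
        exact tendsto_const_sub_cobounded (v i)
      have h4 := (tendsto_inv₀_cobounded.comp h3).const_mul (v (i + 1) - v i)
      have h5 := h4.const_add 1
      simp only [mul_zero, add_zero] at h5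
      refine h5.congr' ?_
      filter_upwards [Bornology.eventually_ne_cobounded (v i)] with z hz
      have : v i - z ≠ 0 := sub_ne_zero.2 hz.symm
      simp only [Function.comp_apply]
      field_simp
      ring
    have h7 := (Complex.continuousAt_arg Complex.one_mem_slitPlane).tendsto.comp h2
    rwa [Complex.arg_one] at h7
  have := tendsto_finsetSum Finset.univ fun i _ => h1 i
  rwa [Finset.sum_const_zero] at this

/-- The winding number vanishes on the unbounded components of the complement. -/
theorem winding_eq_zero_of_not_isBounded (hz : z ∉ boundary v)
    (h : ¬ Bornology.IsBounded (connectedComponentIn (boundary v)ᶜ z)) : winding v z = 0 := by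
  set C := connectedComponentIn (boundary v)ᶜ z with hC
  have h1 : ∀ᶠ w in Bornology.cobounded ℂ, winding v w = 0 := by
    have hpos : (0 : ℝ) < Real.pi := Real.pi_pos
    filter_upwards [Metric.tendsto_nhds.1 (tendsto_angleSum_cobounded v) Real.pi hpos] with w hw
    rw [Real.dist_eq, sub_zero, abs_lt] at hw
    rw [winding, round_eq_zero_iff]
    constructor
    · rw [le_div_iff₀ Real.two_pi_pos]
      linarith
    · rw [div_lt_iff₀ Real.two_pi_pos]
      linarith
  obtain ⟨w, hwC, hw⟩ : ∃ w ∈ C, winding v w = 0 := by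
    by_contra hcon
    push Not at hcon
    apply h
    rw [← Bornology.isCobounded_compl_iff]
    exact Filter.mem_of_superset h1 fun w hw hwC => hcon w hwC hw
  rw [← hw]
  exact winding_eq_of_isPreconnected isPreconnected_connectedComponentIn
    (Set.disjoint_left.2 fun x hx => connectedComponentIn_subset _ _ hx)
    (mem_connectedComponentIn hz) hwC

theorem mem_region_of_winding_ne_zero (h : winding v z ≠ 0) : z ∈ region v := by
  by_cases hz : z ∈ boundary v
  · exact Or.inl hz
  · refine Or.inr ⟨hz, ?_⟩
    by_contra hb
    exact h (winding_eq_zero_of_not_isBounded hz hb)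

theorem winding_eq_zero_of_notMem_region (h : z ∉ region v) : winding v z = 0 := by
  by_contra hw
  exact h (mem_region_of_winding_ne_zero hw)

theorem boundary_subset_region (v : Fin n → ℂ) : boundary v ⊆ region v := subset_union_left

/-! ### The neighbourhood of a point of the boundary -/

theorem inner_eq_re_im (a b : ℂ) : inner ℝ a b = a.re * b.re + a.im * b.im := by
  rw [Complex.inner]
  simp
  ring

/-- The unit vector along an edge. -/
def tangent (v : Fin n → ℂ) (i : Fin n) : ℂ := (v (i + 1) - v i) / (‖v (i + 1) - v i‖ : ℂ)

theorem normal_eq (v : Fin n → ℂ) (i : Fin n) : normal v i = -Complex.I * tangent v i := rfl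

theorem normal_re (v : Fin n → ℂ) (i : Fin n) : (normal v i).re = (tangent v i).im := by
  simp [normal_eq]

theorem normal_im (v : Fin n → ℂ) (i : Fin n) : (normal v i).im = -(tangent v i).re := by
  simp [normal_eq]

theorem IsSimple.add_one_ne (h : IsSimple v) (i : Fin n) : i + 1 ≠ i := by
  have : 3 ≤ n := h.1
  intro hi
  have h1 : (1 : Fin n) = 0 := by
    have := congrArg (fun x => x - i) hi
    simpa using this
  have h2 := congrArg Fin.val h1
  rw [Fin.val_one', Fin.val_zero, Nat.mod_eq_of_lt (by omega)] at h2
  omega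

theorem IsSimple.sub_ne_zero (h : IsSimple v) (i : Fin n) : v (i + 1) - v i ≠ 0 :=
  _root_.sub_ne_zero.2 fun hi => h.add_one_ne i (h.2.1 hi)

theorem IsSimple.norm_pos (h : IsSimple v) (i : Fin n) : 0 < ‖v (i + 1) - v i‖ :=
  norm_pos_iff.2 (h.sub_ne_zero i)

theorem IsSimple.norm_tangent (h : IsSimple v) (i : Fin n) : ‖tangent v i‖ = 1 := by
  rw [tangent, norm_div, Complex.norm_real, norm_norm, div_self (h.norm_pos i).ne']

theorem IsSimple.norm_normal (h : IsSimple v) (i : Fin n) : ‖normal v i‖ = 1 := by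
  rw [normal_eq, norm_mul, h.norm_tangent]
  simp

theorem IsSimple.tangent_sq (h : IsSimple v) (i : Fin n) :
    (tangent v i).re ^ 2 + (tangent v i).im ^ 2 = 1 := by
  have := Complex.sq_norm (tangent v i)
  rw [h.norm_tangent, Complex.normSq_apply] at this
  linarith

theorem IsSimple.sub_eq (h : IsSimple v) (i : Fin n) :
    v (i + 1) - v i = ‖v (i + 1) - v i‖ • tangent v i := by
  rw [tangent, Complex.real_smul, mul_div_cancel₀]
  exact_mod_cast (h.norm_pos i).ne'

theorem inner_tangent_self (h : IsSimple v) (i : Fin n) : inner ℝ (tangent v i) (tangent v i) = 1 := by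
  rw [inner_eq_re_im]
  linarith [h.tangent_sq i]

theorem inner_normal_self (h : IsSimple v) (i : Fin n) : inner ℝ (normal v i) (normal v i) = 1 := by
  rw [inner_eq_re_im, normal_re, normal_im]
  linarith [h.tangent_sq i]

theorem inner_normal_tangent (v : Fin n → ℂ) (i : Fin n) :
    inner ℝ (normal v i) (tangent v i) = 0 := by
  rw [inner_eq_re_im, normal_re, normal_im]
  ring

theorem inner_tangent_normal (v : Fin n → ℂ) (i : Fin n) :
    inner ℝ (tangent v i) (normal v i) = 0 := by
  rw [real_inner_comm, inner_normal_tangent]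

theorem eq_tangent_add_normal (h : IsSimple v) (i : Fin n) (w : ℂ) :
    w = (inner ℝ (tangent v i) w : ℝ) • tangent v i + (inner ℝ (normal v i) w : ℝ) • normal v i := by
  have h1 := h.tangent_sq i
  rw [inner_eq_re_im, inner_eq_re_im, normal_re, normal_im]
  apply Complex.ext
  · simp only [Complex.add_re, Complex.real_smul, Complex.re_ofReal_mul, normal_re]
    linear_combination -w.re * h1
  · simp only [Complex.add_im, Complex.real_smul, Complex.im_ofReal_mul, normal_im]
    linear_combination -w.im * h1

theorem inner_tangent_sub (h : IsSimple v) (i : Fin n) :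
    inner ℝ (tangent v i) (v (i + 1) - v i) = ‖v (i + 1) - v i‖ := by
  conv_lhs => rw [h.sub_eq i]
  rw [inner_smul_right, inner_tangent_self h, mul_one]

theorem inner_normal_sub (h : IsSimple v) (i : Fin n) :
    inner ℝ (normal v i) (v (i + 1) - v i) = 0 := by
  rw [h.sub_eq i, inner_smul_right, inner_normal_tangent, mul_zero]

theorem eq_add_smul_tangent (h : IsSimple v) {i : Fin n} {y : ℂ}
    (hy : inner ℝ (normal v i) (y - v i) = 0) :
    y = v i + (inner ℝ (tangent v i) (y - v i) / ‖v (i + 1) - v i‖) • (v (i + 1) - v i) := by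
  have h1 := eq_tangent_add_normal h i (y - v i)
  have h2 : (inner ℝ (tangent v i) (y - v i) / ‖v (i + 1) - v i‖) • (v (i + 1) - v i) =
      (inner ℝ (tangent v i) (y - v i) : ℝ) • tangent v i := by
    conv_lhs => arg 2; rw [h.sub_eq i]
    rw [smul_smul, div_mul_cancel₀ _ (h.norm_pos i).ne']
  rw [h2]
  rw [hy, zero_smul, add_zero] at h1
  rw [← h1]
  ring

/-- Coordinates along and orthogonal to an edge. -/
theorem mem_edge_iff (h : IsSimple v) {i : Fin n} {y : ℂ} :
    y ∈ edge v i ↔ inner ℝ (normal v i) (y - v i) = 0 ∧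
      inner ℝ (tangent v i) (y - v i) ∈ Icc 0 ‖v (i + 1) - v i‖ := by
  have hL := h.norm_pos i
  rw [edge, segment_eq_image']
  constructor
  · rintro ⟨t, ht, rfl⟩
    rw [add_sub_cancel_left, inner_smul_right, inner_smul_right, inner_normal_sub h,
      inner_tangent_sub h, mul_zero]
    exact ⟨rfl, mul_nonneg ht.1 hL.le, mul_le_of_le_one_left hL.le ht.2⟩
  · rintro ⟨h1, h2⟩
    exact ⟨_, ⟨div_nonneg h2.1 hL.le, (div_le_one hL).2 h2.2⟩, (eq_add_smul_tangent h h1).symm⟩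

theorem mem_openSegment_iff (h : IsSimple v) {i : Fin n} {y : ℂ} :
    y ∈ openSegment ℝ (v i) (v (i + 1)) ↔ inner ℝ (normal v i) (y - v i) = 0 ∧
      inner ℝ (tangent v i) (y - v i) ∈ Ioo 0 ‖v (i + 1) - v i‖ := by
  have hL := h.norm_pos i
  rw [openSegment_eq_image']
  constructor
  · rintro ⟨t, ht, rfl⟩
    rw [add_sub_cancel_left, inner_smul_right, inner_smul_right, inner_normal_sub h,
      inner_tangent_sub h, mul_zero]
    exact ⟨rfl, mul_pos ht.1 hL, mul_lt_of_lt_one_left hL ht.2⟩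
  · rintro ⟨h1, h2⟩
    exact ⟨_, ⟨div_pos h2.1 hL, (div_lt_one hL).2 h2.2⟩, (eq_add_smul_tangent h h1).symm⟩

theorem IsSimple.notMem_edge_of_openSegment (h : IsSimple v) {i j : Fin n} (hij : j ≠ i) {x : ℂ}
    (hx : x ∈ openSegment ℝ (v i) (v (i + 1))) : x ∉ edge v j := by
  intro hxj
  have hxi : x ∈ edge v i := openSegment_subset_segment ℝ _ _ hx
  have hx' := (mem_openSegment_iff h).1 hx
  have hne1 : x ≠ v i := by
    rintro rfl
    simp at hx'
  have hne2 : x ≠ v (i + 1) := by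
    rintro rfl
    rw [inner_tangent_sub h] at hx'
    exact lt_irrefl _ hx'.2.2
  by_cases h1 : i + 1 = j
  · have : x ∈ edge v i ∩ edge v (i + 1) := ⟨hxi, h1 ▸ hxj⟩
    rw [h.2.2.1 i] at this
    exact hne2 this
  · by_cases h2 : j + 1 = i
    · have : x ∈ edge v j ∩ edge v (j + 1) := ⟨hxj, h2 ▸ hxi⟩
      rw [h.2.2.1 j, h2] at this
      exact hne1 this
    · exact Set.disjoint_left.1 (h.2.2.2 i j hij.symm h1 h2) hxi hxj

theorem isClosed_edge (v : Fin n → ℂ) (i : Fin n) : IsClosed (edge v i) := (isCompact_edge v i).isClosed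

/-- Near an inner point of an edge, the boundary is a straight line. -/
theorem eventually_mem_boundary_iff (h : IsSimple v) {i : Fin n} {x : ℂ}
    (hx : x ∈ openSegment ℝ (v i) (v (i + 1))) :
    ∀ᶠ y in 𝓝 x, y ∈ boundary v ↔ inner ℝ (normal v i) (y - x) = 0 := by
  have h1 : ∀ᶠ y in 𝓝 x, ∀ j, j ≠ i → y ∉ edge v j := by
    rw [eventually_all]
    intro j
    by_cases hj : j = i
    · exact Eventually.of_forall fun y hy => absurd hj hy
    · filter_upwards [(isClosed_edge v j).isOpen_compl.mem_nhds (h.notMem_edge_of_openSegment hj hx)]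
        with y hy _ using hy
  have hx' := (mem_openSegment_iff h).1 hx
  have h2 : ∀ᶠ y in 𝓝 x, inner ℝ (tangent v i) (y - v i) ∈ Ioo 0 ‖v (i + 1) - v i‖ := by
    have hc : ContinuousAt (fun y : ℂ => (inner ℝ (tangent v i) (y - v i) : ℝ)) x := by fun_prop
    exact hc.eventually_mem (Ioo_mem_nhds hx'.2.1 hx'.2.2)
  filter_upwards [h1, h2] with y hy1 hy2
  have heq : (inner ℝ (normal v i) (y - x) : ℝ) = inner ℝ (normal v i) (y - v i) := by
    rw [← sub_add_sub_cancel y x (v i), inner_add_right, hx'.1, add_zero]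
  rw [heq]
  constructor
  · intro hy
    obtain ⟨j, hj⟩ := mem_iUnion.1 hy
    by_cases hji : j = i
    · subst hji
      exact ((mem_edge_iff h).1 hj).1
    · exact absurd hj (hy1 j hji)
  · intro hy
    exact edge_subset_boundary v i ((mem_edge_iff h).2 ⟨hy, hy2.1.le, hy2.2.le⟩)

theorem add_smul_tendsto (x w : ℂ) : Tendsto (fun s : ℝ => x + s • w) (𝓝[>] 0) (𝓝 x) := by
  have : Tendsto (fun s : ℝ => x + s • w) (𝓝 0) (𝓝 (x + (0 : ℝ) • w)) :=
    Continuous.tendsto (by fun_prop) 0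
  rw [zero_smul, add_zero] at this
  exact this.mono_left nhdsWithin_le_nhds

/-- The angle under which an edge is seen from a point near it on the left or on the right. -/
theorem tendsto_arg_edge (h : IsSimple v) {i : Fin n} {x : ℂ}
    (hx : x ∈ openSegment ℝ (v i) (v (i + 1))) :
    Tendsto (fun s : ℝ => Complex.arg ((v (i + 1) - (x + s • normal v i)) /
      (v i - (x + s • normal v i)))) (𝓝[>] 0) (𝓝 (-Real.pi)) ∧
    Tendsto (fun s : ℝ => Complex.arg ((v (i + 1) - (x + s • -normal v i)) /
      (v i - (x + s • -normal v i)))) (𝓝[>] 0) (𝓝 Real.pi) := by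
  obtain ⟨hx1, hx2⟩ := (mem_openSegment_iff h).1 hx
  set L := ‖v (i + 1) - v i‖ with hL
  set ξ : ℝ := inner ℝ (tangent v i) (x - v i) with hξ
  set e := tangent v i with he
  have hL0 : 0 < L := h.norm_pos i
  have hxe : x = v i + ξ • e := by
    have := eq_tangent_add_normal h i (x - v i)
    rw [hx1, zero_smul, add_zero] at this
    rw [← this]
    ring
  have hve : v (i + 1) = v i + L • e := by
    rw [← h.sub_eq i]
    ring
  have he0 : e ≠ 0 := by
    intro h0
    have := h.norm_tangent i
    rw [← he, h0] at this
    simp at this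
  -- The quotient in the frame of the edge.
  have hquot : ∀ s : ℝ, (v (i + 1) - (x + s • normal v i)) / (v i - (x + s • normal v i)) =
      ((L - ξ : ℝ) + s * Complex.I) / ((-ξ : ℝ) + s * Complex.I) := by
    intro s
    have e1 : v (i + 1) - (x + s • normal v i) = e * ((L - ξ : ℝ) + s * Complex.I) := by
      rw [hve, hxe, normal_eq, ← he, Complex.real_smul, Complex.real_smul, Complex.real_smul]
      push_cast
      ring
    have e2 : v i - (x + s • normal v i) = e * ((-ξ : ℝ) + s * Complex.I) := by
      rw [hxe, normal_eq, ← he, Complex.real_smul, Complex.real_smul]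
      push_cast
      ring
    rw [e1, e2, mul_div_mul_left _ _ he0]
  have him : ∀ s : ℝ, (((L - ξ : ℝ) + s * Complex.I) / ((-ξ : ℝ) + s * Complex.I) : ℂ).im =
      -(s * L) / (ξ ^ 2 + s ^ 2) := by
    intro s
    rw [Complex.div_im, Complex.normSq_apply]
    simp
    field_simp
    ring
  have hlim : Tendsto (fun s : ℝ => (((L - ξ : ℝ) + s * Complex.I) / ((-ξ : ℝ) + s * Complex.I) : ℂ))
      (𝓝 0) (𝓝 ((-((L - ξ) / ξ) : ℝ) : ℂ)) := by
    have hne : ((-ξ : ℝ) : ℂ) ≠ 0 := by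
      have : (-ξ : ℝ) ≠ 0 := by linarith [hx2.1]
      exact_mod_cast this
    have hc : ContinuousAt (fun s : ℝ =>
        (((L - ξ : ℝ) + s * Complex.I) / ((-ξ : ℝ) + s * Complex.I) : ℂ)) 0 := by
      refine ContinuousAt.div (by fun_prop) (by fun_prop) ?_
      simpa using hne
    have := hc.tendsto
    simp only [Complex.ofReal_zero, zero_mul, add_zero] at this
    convert this using 2
    push_cast
    rw [div_neg]
  have hneg : (((-((L - ξ) / ξ) : ℝ) : ℂ)).re < 0 := by
    rw [Complex.ofReal_re, neg_lt_zero]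
    exact div_pos (by linarith [hx2.2]) hx2.1
  have hpos : ∀ s : ℝ, 0 < ξ ^ 2 + s ^ 2 := fun s => by
    have := hx2.1
    positivity
  constructor
  · simp_rw [hquot]
    refine (Complex.tendsto_arg_nhdsWithin_im_neg_of_re_neg_of_im_zero hneg (Complex.ofReal_im _)).comp
      (tendsto_nhdsWithin_iff.2 ⟨hlim.mono_left nhdsWithin_le_nhds, ?_⟩)
    filter_upwards [self_mem_nhdsWithin] with s hs
    rw [him]
    exact div_neg_of_neg_of_pos (by linarith [mul_pos (show 0 < s from hs) hL0]) (hpos s)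
  · have hquot' : ∀ s : ℝ, (v (i + 1) - (x + s • -normal v i)) / (v i - (x + s • -normal v i)) =
        ((L - ξ : ℝ) + (-s : ℝ) * Complex.I) / ((-ξ : ℝ) + (-s : ℝ) * Complex.I) := by
      intro s
      rw [← hquot, smul_neg, neg_smul]
    simp_rw [hquot']
    have hlim' : Tendsto (fun s : ℝ => (((L - ξ : ℝ) + (-s : ℝ) * Complex.I) /
        ((-ξ : ℝ) + (-s : ℝ) * Complex.I) : ℂ)) (𝓝[>] 0) (𝓝 ((-((L - ξ) / ξ) : ℝ) : ℂ)) := by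
      refine hlim.comp (f := fun s : ℝ => -s) ?_
      have : Tendsto (fun s : ℝ => -s) (𝓝 0) (𝓝 (-0)) := tendsto_id.neg
      rw [neg_zero] at this
      exact this.mono_left nhdsWithin_le_nhds
    refine (Complex.tendsto_arg_nhdsWithin_im_nonneg_of_re_neg_of_im_zero hneg
      (Complex.ofReal_im _)).comp (tendsto_nhdsWithin_iff.2 ⟨hlim', ?_⟩)
    filter_upwards [self_mem_nhdsWithin] with s hs
    rw [him]
    exact div_nonneg (by linarith [mul_pos (show 0 < s from hs) hL0]) (hpos _).le

/-- The winding number increases by one when an edge is crossed from the right to the left. -/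
theorem eventually_winding_jump (h : IsSimple v) {i : Fin n} {x : ℂ}
    (hx : x ∈ openSegment ℝ (v i) (v (i + 1))) :
    ∀ᶠ s : ℝ in 𝓝[>] 0, winding v (x + s • -normal v i) = winding v (x + s • normal v i) + 1 := by
  have hterm : ∀ j, j ≠ i → ∀ w : ℂ, Tendsto (fun s : ℝ => Complex.arg ((v (j + 1) - (x + s • w)) /
      (v j - (x + s • w)))) (𝓝[>] 0) (𝓝 (Complex.arg ((v (j + 1) - x) / (v j - x)))) := by
    intro j hj w
    have hxj := h.notMem_edge_of_openSegment hj hx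
    have h1 := Complex.continuousAt_arg (div_mem_slitPlane hxj)
    have hne : v j - x ≠ 0 := _root_.sub_ne_zero.2 fun h0 => hxj (h0 ▸ left_mem_segment ℝ _ _)
    have h2 : ContinuousAt (fun y : ℂ => (v (j + 1) - y) / (v j - y)) x :=
      ContinuousAt.div (by fun_prop) (by fun_prop) hne
    exact (h1.tendsto.comp h2.tendsto).comp (add_smul_tendsto x w)
  obtain ⟨hr, hl⟩ := tendsto_arg_edge h hx
  set R := ∑ j ∈ Finset.univ.erase i, Complex.arg ((v (j + 1) - x) / (v j - x)) with hR
  have hsum : ∀ w : ℂ, ∀ a : ℝ, Tendsto (fun s : ℝ => Complex.arg ((v (i + 1) - (x + s • w)) /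
      (v i - (x + s • w)))) (𝓝[>] 0) (𝓝 a) →
      Tendsto (fun s : ℝ => angleSum v (x + s • w)) (𝓝[>] 0) (𝓝 (a + R)) := by
    intro w a ha
    have h1 : ∀ z, angleSum v z = Complex.arg ((v (i + 1) - z) / (v i - z)) +
        ∑ j ∈ Finset.univ.erase i, Complex.arg ((v (j + 1) - z) / (v j - z)) := fun z =>
      (Finset.add_sum_erase _ _ (Finset.mem_univ i)).symm
    simp_rw [h1]
    exact ha.add (tendsto_finsetSum _ fun j hj => hterm j (Finset.ne_of_mem_erase hj) w)
  have hdiff := ((hsum _ _ hl).sub (hsum _ _ hr))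
  have hval : Real.pi + R - (-Real.pi + R) = 2 * Real.pi := by ring
  rw [hval] at hdiff
  have hne : ∀ w : ℂ, ∀ᶠ s : ℝ in 𝓝[>] 0, ∀ j, v j ≠ x + s • w := by
    intro w
    rw [eventually_all]
    intro j
    have hxj : v j ≠ x := by
      intro h0
      by_cases hj : j = i
      · subst hj
        have := ((mem_openSegment_iff h).1 hx).2.1
        rw [h0] at this
        simp at this
      · exact h.notMem_edge_of_openSegment hj hx (h0 ▸ left_mem_segment ℝ _ _)
    exact ((add_smul_tendsto x w).eventually_ne hxj.symm).mono fun s hs => hs.symm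
  filter_upwards [Metric.tendsto_nhds.1 hdiff (2 * Real.pi) Real.two_pi_pos,
    hne (normal v i), hne (-normal v i)] with s hs h1 h2
  rw [angleSum_eq h1, angleSum_eq h2, Real.dist_eq, ← sub_mul,
    ← sub_one_mul, abs_mul, abs_of_pos Real.two_pi_pos] at hs
  have h3 : |(winding v (x + s • -normal v i) : ℝ) - winding v (x + s • normal v i) - 1| < 1 := by
    by_contra hcon
    push Not at hcon
    nlinarith [Real.two_pi_pos]
  have h4 : |winding v (x + s • -normal v i) - winding v (x + s • normal v i) - 1| < 1 := by
    exact_mod_cast h3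
  rw [Int.abs_lt_one_iff] at h4
  omega

/-! ### The region enclosed by a polygon -/

theorem mem_region_of_isPreconnected {S : Set ℂ} (hS : IsPreconnected S)
    (hd : Disjoint S (boundary v)) {x y : ℂ} (hx : x ∈ S) (hy : y ∈ S) (h : x ∈ region v) :
    y ∈ region v := by
  have hyb := Set.disjoint_left.1 hd hy
  obtain hxb | ⟨hxb, hb⟩ := h
  · exact absurd hxb (Set.disjoint_left.1 hd hx)
  · have hsub : S ⊆ (boundary v)ᶜ := fun w hw => Set.disjoint_left.1 hd hw
    have : y ∈ connectedComponentIn (boundary v)ᶜ x :=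
      hS.subset_connectedComponentIn hx hsub hy
    exact Or.inr ⟨hyb, by rwa [← connectedComponentIn_eq this]⟩

theorem convex_halfDisc (x m : ℂ) (r : ℝ) :
    Convex ℝ (Metric.ball x r ∩ {y | 0 < inner ℝ m (y - x)}) := by
  refine (convex_ball x r).inter ?_
  have h : {y : ℂ | 0 < inner ℝ m (y - x)} = {y | inner ℝ m x < inner ℝ m y} := by
    ext y
    simp [inner_sub_right]
  rw [h]
  exact convex_halfSpace_gt (f := fun y => inner ℝ m y)
    ⟨fun a b => inner_add_right _ _ _, fun c a => inner_smul_right _ _ _⟩ _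

/-- Near an inner point of an edge, the points on the right are outside, and around the points on the
left the polygon winds once. -/
theorem IsPolygon.exists_ball_edge (hv : IsPolygon v) {i : Fin n} {x : ℂ}
    (hx : x ∈ openSegment ℝ (v i) (v (i + 1))) :
    ∃ r > 0, ∀ y ∈ Metric.ball x r, (y ∈ boundary v ↔ inner ℝ (normal v i) (y - x) = 0) ∧
      (0 < inner ℝ (normal v i) (y - x) → y ∉ region v) ∧
      (inner ℝ (normal v i) (y - x) < 0 → winding v y = 1) := by
  obtain ⟨r, hr, hball⟩ := Metric.eventually_nhds_iff_ball.1 (eventually_mem_boundary_iff hv.1 hx)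
  refine ⟨r, hr, fun y hy => ⟨hball y hy, ?_⟩⟩
  have hmem : ∀ w : ℂ, ∀ᶠ s : ℝ in 𝓝[>] 0, x + s • w ∈ Metric.ball x r := fun w =>
    (add_smul_tendsto x w).eventually_mem (Metric.ball_mem_nhds x hr)
  obtain ⟨s, ⟨⟨⟨⟨hs1, hs2⟩, hs3⟩, hs4⟩, hs0⟩⟩ := ((((hv.2 i x hx).and
    (eventually_winding_jump hv.1 hx)).and (hmem (normal v i))).and (hmem (-normal v i))).and
    self_mem_nhdsWithin |>.exists
  have hs0' : 0 < s := hs0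
  have e1 : inner ℝ (normal v i) (x + s • normal v i - x) = s := by
    rw [add_sub_cancel_left, inner_smul_right, inner_normal_self hv.1, mul_one]
  have e2 : inner ℝ (-normal v i) (x + s • -normal v i - x) = s := by
    rw [add_sub_cancel_left, inner_smul_right, inner_neg_neg, inner_normal_self hv.1, mul_one]
  have hd1 : Disjoint (Metric.ball x r ∩ {y | 0 < inner ℝ (normal v i) (y - x)}) (boundary v) := by
    rw [Set.disjoint_left]
    intro w hw hwb
    have := (hball w hw.1).1 hwb
    exact (ne_of_gt hw.2) this
  have hd2 : Disjoint (Metric.ball x r ∩ {y | 0 < inner ℝ (-normal v i) (y - x)}) (boundary v) := by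
    rw [Set.disjoint_left]
    intro w hw hwb
    have := (hball w hw.1).1 hwb
    have h2 : 0 < inner ℝ (-normal v i) (w - x) := hw.2
    rw [inner_neg_left, this] at h2
    simp at h2
  constructor
  · intro hpos hreg
    exact hs1.1 (mem_region_of_isPreconnected (convex_halfDisc x (normal v i) r).isPreconnected hd1
      ⟨hy, hpos⟩ ⟨hs3, by show 0 < inner ℝ _ _; rw [e1]; exact hs0'⟩ hreg)
  · intro hneg
    have h1 := winding_eq_of_isPreconnected (convex_halfDisc x (-normal v i) r).isPreconnected hd2
      ⟨hy, by show 0 < inner ℝ _ _; rw [inner_neg_left]; linarith⟩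
      ⟨hs4, by show 0 < inner ℝ _ _; rw [e2]; exact hs0'⟩
    rw [h1, hs2, winding_eq_zero_of_notMem_region hs1.1, zero_add]

/-- Among infinitely many lines through a point off the boundary, some line avoids the vertices. -/
theorem exists_direction (hz : z ∉ boundary v) :
    ∃ u : ℂ, u.re = 1 ∧ ∀ j, ∀ t : ℝ, z + t • u ≠ v j := by
  by_contra hcon
  push Not at hcon
  have h1 : ∀ k : ℕ, ∃ j, ∃ t : ℝ, z + t • (⟨1, k⟩ : ℂ) = v j := fun k => hcon ⟨1, k⟩ rfl
  choose j t ht using h1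
  obtain ⟨k, k', hne, hj⟩ := Finite.exists_ne_map_eq_of_infinite j
  have h2 : z + t k • (⟨1, k⟩ : ℂ) = z + t k' • (⟨1, k'⟩ : ℂ) := by rw [ht, ht, hj]
  have hre := congrArg Complex.re h2
  have him := congrArg Complex.im h2
  simp at hre him
  rw [hre] at him
  have h0 : t k = 0 := by
    by_contra h0
    rw [hre] at h0
    exact hne (by exact_mod_cast mul_left_cancel₀ h0 him)
  have h3 := ht k
  rw [h0, zero_smul, add_zero] at h3
  exact hz (h3 ▸ vertex_mem_boundary v _)

/-- The polygon winds once around every point of a bounded component: a ray from the point that avoids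
the vertices first meets the polygon in an inner point of an edge, coming from the left. -/
theorem IsPolygon.winding_eq_one (hv : IsPolygon v) (hz : z ∈ region v) (hzb : z ∉ boundary v) :
    winding v z = 1 := by
  obtain ⟨u, hu, huv⟩ := exists_direction hzb
  set T : Set ℝ := Ici 0 ∩ (fun t : ℝ => z + t • u) ⁻¹' boundary v with hT
  have hTc : IsClosed T := isClosed_Ici.inter ((isCompact_boundary v).isClosed.preimage (by fun_prop))
  have hTb : BddBelow T := ⟨0, fun t ht => ht.1⟩
  have hTn : T.Nonempty := by
    by_contra hemp
    rw [Set.not_nonempty_iff_eq_empty] at hemp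
    have hzB := (hz.resolve_left hzb).2
    have hray : IsPreconnected ((fun t : ℝ => z + t • u) '' Ici 0) :=
      isPreconnected_Ici.image _ (by fun_prop)
    have hsub := hray.subset_connectedComponentIn (x := z) (F := (boundary v)ᶜ)
      ⟨0, self_mem_Ici, by simp⟩ (by
        rintro _ ⟨t, ht, rfl⟩ hb
        have : t ∈ T := ⟨ht, hb⟩
        rw [hemp] at this
        exact this)
    obtain ⟨M, hM⟩ := (hzB.subset hsub).exists_norm_le
    have h1 := hM _ ⟨|M| + |z.re| + 1, by show (0 : ℝ) ≤ _; positivity, rfl⟩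
    have h2 := Complex.abs_re_le_norm (z + (|M| + |z.re| + 1) • u)
    simp only [Complex.add_re, Complex.real_smul, Complex.re_ofReal_mul, hu, mul_one] at h1 h2
    have h3 := le_abs_self (z.re + (|M| + |z.re| + 1))
    linarith [neg_abs_le z.re, le_abs_self M]
  have ht := hTc.csInf_mem hTn hTb
  set t := sInf T with htdef
  have hlt : ∀ s : ℝ, 0 ≤ s → s < t → z + s • u ∉ boundary v := fun s hs hst hb =>
    absurd (csInf_le hTb ⟨hs, hb⟩) (not_le.2 hst)
  have ht0 : 0 < t := by
    rcases eq_or_lt_of_le (show 0 ≤ t from ht.1) with h | h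
    · have := ht.2
      rw [← h] at this
      simp at this
      exact absurd this hzb
    · exact h
  obtain ⟨i, hi⟩ := mem_iUnion.1 ht.2
  have hopen : z + t • u ∈ openSegment ℝ (v i) (v (i + 1)) :=
    mem_openSegment_of_ne_left_right (huv i t).symm (huv (i + 1) t).symm hi
  obtain ⟨r, hr, hball⟩ := hv.exists_ball_edge hopen
  have hev : ∀ᶠ s in 𝓝[<] t, z + s • u ∈ Metric.ball (z + t • u) r := by
    have hc : ContinuousAt (fun s : ℝ => z + s • u) t := by fun_prop
    exact (hc.eventually_mem (Metric.ball_mem_nhds _ hr)).filter_mono nhdsWithin_le_nhds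
  obtain ⟨s, hs1, hs2⟩ := (hev.and (Ioo_mem_nhdsLT ht0)).exists
  have hseg : IsPreconnected ((fun s : ℝ => z + s • u) '' Ico 0 t) :=
    isPreconnected_Ico.image _ (by fun_prop)
  have hdis : Disjoint ((fun s : ℝ => z + s • u) '' Ico 0 t) (boundary v) := by
    rw [Set.disjoint_left]
    rintro _ ⟨s, hs, rfl⟩
    exact hlt s hs.1 hs.2
  have hzS : z ∈ (fun s : ℝ => z + s • u) '' Ico 0 t := ⟨0, ⟨le_rfl, ht0⟩, by simp⟩
  have hyS : z + s • u ∈ (fun s : ℝ => z + s • u) '' Ico 0 t := ⟨s, ⟨hs2.1.le, hs2.2⟩, rfl⟩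
  obtain ⟨h1, h2, h3⟩ := hball _ hs1
  rw [winding_eq_of_isPreconnected hseg hdis hzS hyS]
  rcases lt_trichotomy (inner ℝ (normal v i) (z + s • u - (z + t • u))) 0 with h | h | h
  · exact h3 h
  · exact absurd (h1.2 h) (hlt s hs2.1.le hs2.2)
  · exact absurd (mem_region_of_isPreconnected hseg hdis hzS hyS hz) (h2 h)

theorem IsPolygon.mem_region_iff (hv : IsPolygon v) :
    z ∈ region v ↔ z ∈ boundary v ∨ winding v z ≠ 0 := by
  constructor
  · intro hz
    by_cases hb : z ∈ boundary v
    · exact Or.inl hb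
    · right
      rw [hv.winding_eq_one hz hb]
      norm_num
  · rintro (h | h)
    · exact Or.inl h
    · exact mem_region_of_winding_ne_zero h

/-- The points enclosed by the polygon, without the boundary. -/
def inside (v : Fin n → ℂ) : Set ℂ := {z | z ∉ boundary v ∧ winding v z ≠ 0}

theorem inside_subset_region (v : Fin n → ℂ) : inside v ⊆ region v :=
  fun _ hz => mem_region_of_winding_ne_zero hz.2

theorem eventually_winding_eq_nhds (hz : z ∉ boundary v) :
    ∀ᶠ y in 𝓝 z, y ∉ boundary v ∧ winding v y = winding v z := by
  have h : ContinuousAt (fun y => (v, y)) z := by fun_prop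
  have h' : ∀ᶠ y in 𝓝 z, y ∉ boundary v :=
    (isCompact_boundary v).isClosed.isOpen_compl.mem_nhds hz
  exact h'.and (h.eventually (eventually_winding_eq hz))

theorem isOpen_inside (v : Fin n → ℂ) : IsOpen (inside v) := by
  rw [isOpen_iff_mem_nhds]
  intro z hz
  filter_upwards [eventually_winding_eq_nhds hz.1] with y hy
  exact ⟨hy.1, hy.2 ▸ hz.2⟩

theorem IsPolygon.isClosed_region (hv : IsPolygon v) : IsClosed (region v) := by
  rw [← isOpen_compl_iff, isOpen_iff_mem_nhds]
  intro z hz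
  have hzb : z ∉ boundary v := fun h => hz (Or.inl h)
  filter_upwards [eventually_winding_eq_nhds hzb] with y hy hreg
  rcases hv.mem_region_iff.1 hreg with h | h
  · exact hy.1 h
  · rw [hy.2] at h
    exact hz (mem_region_of_winding_ne_zero h)

theorem IsPolygon.openSegment_subset_closure_inside (hv : IsPolygon v) (i : Fin n) :
    openSegment ℝ (v i) (v (i + 1)) ⊆ closure (inside v) := by
  intro x hx
  obtain ⟨r, hr, hball⟩ := hv.exists_ball_edge hx
  refine mem_closure_of_tendsto (add_smul_tendsto x (-normal v i)) ?_
  filter_upwards [(add_smul_tendsto x (-normal v i)).eventually_mem (Metric.ball_mem_nhds x hr),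
    self_mem_nhdsWithin] with s hs hs0
  have hs0' : 0 < s := hs0
  obtain ⟨h1, -, h3⟩ := hball _ hs
  have hin : inner ℝ (normal v i) (x + s • -normal v i - x) = -s := by
    rw [add_sub_cancel_left, inner_smul_right, inner_neg_right, inner_normal_self hv.1]
    ring
  rw [hin] at h1 h3
  refine ⟨fun hb => ?_, ?_⟩
  · have := h1.1 hb
    linarith
  · rw [h3 (by linarith)]
    norm_num

theorem IsPolygon.region_subset_closure_inside (hv : IsPolygon v) :
    region v ⊆ closure (inside v) := by
  intro z hz
  rcases hv.mem_region_iff.1 hz with h | h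
  · obtain ⟨i, hi⟩ := mem_iUnion.1 h
    have h1 : edge v i ⊆ closure (openSegment ℝ (v i) (v (i + 1))) :=
      segment_subset_closure_openSegment
    exact closure_minimal (hv.openSegment_subset_closure_inside i) isClosed_closure (h1 hi)
  · by_cases hb : z ∈ boundary v
    · obtain ⟨i, hi⟩ := mem_iUnion.1 hb
      have h1 : edge v i ⊆ closure (openSegment ℝ (v i) (v (i + 1))) :=
        segment_subset_closure_openSegment
      exact closure_minimal (hv.openSegment_subset_closure_inside i) isClosed_closure (h1 hi)
    · exact subset_closure ⟨hb, h⟩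

/-! ### The neighbourhood of a vertex -/

/-- The sine of the turning angle at the vertex `i + 1`; it is positive at a convex vertex. -/
def turn (v : Fin n → ℂ) (i : Fin n) : ℝ := inner ℝ (normal v (i + 1)) (tangent v i)

theorem inner_normal_tangent_succ (v : Fin n → ℂ) (i : Fin n) :
    inner ℝ (normal v i) (tangent v (i + 1)) = -turn v i := by
  rw [turn, inner_eq_re_im, inner_eq_re_im, normal_re, normal_im, normal_re, normal_im]
  ring

theorem IsSimple.vertex_notMem_edge (h : IsSimple v) {i j : Fin n} (h1 : j ≠ i) (h2 : j ≠ i + 1) :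
    v (i + 1) ∉ edge v j := by
  intro hj
  have hmem : v (i + 1) ∈ edge v (i + 1) := left_mem_segment ℝ _ _
  by_cases h3 : i + 1 + 1 = j
  · have : v (i + 1) ∈ edge v (i + 1) ∩ edge v (i + 1 + 1) := ⟨hmem, h3 ▸ hj⟩
    rw [h.2.2.1] at this
    exact h.add_one_ne (i + 1) (h.2.1 this).symm
  · exact Set.disjoint_left.1 (h.2.2.2 (i + 1) j h2.symm h3 fun h4 => h1 (add_right_cancel h4)) hmem hj

theorem IsSimple.eventually_near_vertex (h : IsSimple v) (i : Fin n) :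
    ∀ᶠ y in 𝓝 (v (i + 1)), y ∈ boundary v → y ∈ edge v i ∨ y ∈ edge v (i + 1) := by
  have h1 : ∀ᶠ y in 𝓝 (v (i + 1)), ∀ j, j ≠ i → j ≠ i + 1 → y ∉ edge v j := by
    rw [eventually_all]
    intro j
    by_cases hj : j = i
    · exact Eventually.of_forall fun y hy => absurd hj hy
    by_cases hj' : j = i + 1
    · exact Eventually.of_forall fun y _ hy => absurd hj' hy
    · filter_upwards [(isClosed_edge v j).isOpen_compl.mem_nhds (h.vertex_notMem_edge hj hj')]
        with y hy _ _ using hy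
  filter_upwards [h1] with y hy hyb
  obtain ⟨j, hj⟩ := mem_iUnion.1 hyb
  by_cases hj1 : j = i
  · exact Or.inl (hj1 ▸ hj)
  by_cases hj2 : j = i + 1
  · exact Or.inr (hj2 ▸ hj)
  · exact absurd hj (hy j hj1 hj2)

/-- A half disc beyond the line of an edge that contains no boundary point lies outside. -/
theorem IsPolygon.halfDisc_notMem_region (hv : IsPolygon v) {j : Fin n} {p : ℂ} {r : ℝ}
    (hd : ∀ y ∈ Metric.ball p r, y ∈ boundary v → inner ℝ (normal v j) (y - p) ≤ 0)
    (hx : ∃ x ∈ Metric.ball p r, x ∈ openSegment ℝ (v j) (v (j + 1)) ∧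
      inner ℝ (normal v j) (x - p) = 0) {y : ℂ} (hy : y ∈ Metric.ball p r)
    (hpos : 0 < inner ℝ (normal v j) (y - p)) : y ∉ region v := by
  obtain ⟨x, hxp, hxj, hx0⟩ := hx
  obtain ⟨s, ⟨hs1, hs2⟩, hs0⟩ := ((hv.2 j x hxj).and
    ((add_smul_tendsto x (normal v j)).eventually_mem (Metric.isOpen_ball.mem_nhds hxp))).and
    self_mem_nhdsWithin |>.exists
  have hs0' : 0 < s := hs0
  intro hreg
  refine hs1.1 (mem_region_of_isPreconnected (convex_halfDisc p (normal v j) r).isPreconnected ?_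
    ⟨hy, hpos⟩ ⟨hs2, ?_⟩ hreg)
  · rw [Set.disjoint_left]
    intro w hw hwb
    exact absurd (hd w hw.1 hwb) (not_le.2 hw.2)
  · show 0 < inner ℝ _ _
    rw [add_sub_right_comm, inner_add_right, hx0, inner_smul_right, inner_normal_self hv.1]
    linarith

/-- At a vertex that is not reflex, the polygon stays behind the lines of both edges. -/
theorem IsPolygon.eventually_inner_nonpos (hv : IsPolygon v) {i : Fin n} (hc : 0 ≤ turn v i) :
    ∀ᶠ y in 𝓝 (v (i + 1)), y ∈ region v →
      inner ℝ (normal v i) (y - v (i + 1)) ≤ 0 ∧ inner ℝ (normal v (i + 1)) (y - v (i + 1)) ≤ 0 := by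
  obtain ⟨r, hr, hball⟩ := Metric.eventually_nhds_iff_ball.1 (hv.1.eventually_near_vertex i)
  have hL1 := hv.1.norm_pos i
  have hL2 := hv.1.norm_pos (i + 1)
  -- The vertex lies at distance `‖v (i + 1) - v i‖` along the first edge.
  have hvi : ∀ y : ℂ, y - v i = (y - v (i + 1)) + (v (i + 1) - v i) := fun y => by ring
  have hE1 : ∀ y ∈ edge v i, inner ℝ (normal v i) (y - v (i + 1)) = 0 ∧
      inner ℝ (tangent v i) (y - v (i + 1)) ≤ 0 := by
    intro y hy
    obtain ⟨h1, h2⟩ := (mem_edge_iff hv.1).1 hy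
    rw [hvi y, inner_add_right, inner_normal_sub hv.1, add_zero] at h1
    rw [hvi y, inner_add_right, inner_tangent_sub hv.1] at h2
    exact ⟨h1, by linarith [h2.2]⟩
  have hE2 : ∀ y ∈ edge v (i + 1), inner ℝ (normal v (i + 1)) (y - v (i + 1)) = 0 ∧
      0 ≤ inner ℝ (tangent v (i + 1)) (y - v (i + 1)) := by
    intro y hy
    obtain ⟨h1, h2⟩ := (mem_edge_iff hv.1).1 hy
    exact ⟨h1, h2.1⟩
  have hd1 : ∀ y ∈ Metric.ball (v (i + 1)) r, y ∈ boundary v →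
      inner ℝ (normal v i) (y - v (i + 1)) ≤ 0 := by
    intro y hy hyb
    rcases hball y hy hyb with h | h
    · exact (hE1 y h).1.le
    · obtain ⟨h1, h2⟩ := hE2 y h
      have h3 := eq_tangent_add_normal hv.1 (i + 1) (y - v (i + 1))
      rw [h1, zero_smul, add_zero] at h3
      rw [h3, inner_smul_right, inner_normal_tangent_succ]
      nlinarith
  have hd2 : ∀ y ∈ Metric.ball (v (i + 1)) r, y ∈ boundary v →
      inner ℝ (normal v (i + 1)) (y - v (i + 1)) ≤ 0 := by
    intro y hy hyb
    rcases hball y hy hyb with h | h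
    · obtain ⟨h1, h2⟩ := hE1 y h
      have h3 := eq_tangent_add_normal hv.1 i (y - v (i + 1))
      rw [h1, zero_smul, add_zero] at h3
      rw [h3, inner_smul_right]
      exact mul_nonpos_of_nonpos_of_nonneg h2 hc
    · exact (hE2 y h).1.le
  have hx1 : ∃ x ∈ Metric.ball (v (i + 1)) r, x ∈ openSegment ℝ (v i) (v (i + 1)) ∧
      inner ℝ (normal v i) (x - v (i + 1)) = 0 := by
    set δ := min (r / 2) (‖v (i + 1) - v i‖ / 2) with hδ
    have hδ0 : 0 < δ := lt_min (by linarith) (by linarith)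
    have hδr : δ ≤ r / 2 := min_le_left _ _
    have hδL : δ ≤ ‖v (i + 1) - v i‖ / 2 := min_le_right _ _
    refine ⟨v (i + 1) + (-δ) • tangent v i, ?_, ?_, ?_⟩
    · rw [Metric.mem_ball, dist_eq_norm, add_sub_cancel_left, norm_smul, hv.1.norm_tangent, mul_one,
        Real.norm_eq_abs, abs_neg, abs_of_pos hδ0]
      linarith
    · rw [mem_openSegment_iff hv.1, hvi, add_sub_cancel_left, inner_add_right, inner_add_right,
        inner_smul_right, inner_smul_right, inner_normal_sub hv.1, inner_tangent_sub hv.1,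
        inner_normal_tangent, inner_tangent_self hv.1]
      refine ⟨by ring, ?_, ?_⟩ <;> linarith
    · rw [add_sub_cancel_left, inner_smul_right, inner_normal_tangent, mul_zero]
  have hx2 : ∃ x ∈ Metric.ball (v (i + 1)) r, x ∈ openSegment ℝ (v (i + 1)) (v (i + 1 + 1)) ∧
      inner ℝ (normal v (i + 1)) (x - v (i + 1)) = 0 := by
    set δ := min (r / 2) (‖v (i + 1 + 1) - v (i + 1)‖ / 2) with hδ
    have hδ0 : 0 < δ := lt_min (by linarith) (by linarith)
    have hδr : δ ≤ r / 2 := min_le_left _ _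
    have hδL : δ ≤ ‖v (i + 1 + 1) - v (i + 1)‖ / 2 := min_le_right _ _
    refine ⟨v (i + 1) + δ • tangent v (i + 1), ?_, ?_, ?_⟩
    · rw [Metric.mem_ball, dist_eq_norm, add_sub_cancel_left, norm_smul, hv.1.norm_tangent, mul_one,
        Real.norm_eq_abs, abs_of_pos hδ0]
      linarith
    · rw [mem_openSegment_iff hv.1, add_sub_cancel_left,
        inner_smul_right, inner_smul_right, inner_normal_tangent, inner_tangent_self hv.1]
      refine ⟨by ring, ?_, ?_⟩ <;> linarith
    · rw [add_sub_cancel_left, inner_smul_right, inner_normal_tangent, mul_zero]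
  filter_upwards [Metric.ball_mem_nhds _ hr] with y hy hreg
  constructor
  · by_contra hcon
    exact hv.halfDisc_notMem_region hd1 hx1 hy (not_le.1 hcon) hreg
  · by_contra hcon
    exact hv.halfDisc_notMem_region hd2 hx2 hy (not_le.1 hcon) hreg

/-! ### Edge inflation -/

variable {q : ℂ}

/-- The velocity of a vertex under the inflation. -/
def drift (v : Fin n → ℂ) (i : Fin n) : ℂ :=
  (1 / (1 + inner ℝ (normal v (i - 1)) (normal v i)) : ℝ) • (normal v (i - 1) + normal v i)

theorem inflate_eq (v : Fin n → ℂ) (t : ℝ) (i : Fin n) : inflate v t i = v i + t • drift v i := by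
  rw [inflate, drift, smul_smul, mul_one_div]

theorem inflate_zero (v : Fin n → ℂ) : inflate v 0 = v := by
  ext i
  rw [inflate_eq, zero_smul, add_zero]

theorem drift_succ (v : Fin n → ℂ) (i : Fin n) : drift v (i + 1) =
    (1 / (1 + inner ℝ (normal v i) (normal v (i + 1))) : ℝ) • (normal v i + normal v (i + 1)) := by
  rw [drift, add_sub_cancel_right]

theorem inner_normal_eq (v : Fin n → ℂ) (i j : Fin n) :
    inner ℝ (normal v i) (normal v j) = inner ℝ (tangent v i) (tangent v j) := by
  simp only [inner_eq_re_im, normal_re, normal_im]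
  ring

theorem turn_sq (hv : IsSimple v) (i : Fin n) :
    inner ℝ (normal v i) (normal v (i + 1)) ^ 2 + turn v i ^ 2 = 1 := by
  rw [turn]
  simp only [inner_eq_re_im, normal_re, normal_im]
  have h1 := hv.tangent_sq i
  have h2 := hv.tangent_sq (i + 1)
  linear_combination ((tangent v (i + 1)).re ^ 2 + (tangent v (i + 1)).im ^ 2) * h1 + h2

theorem add_smul_tangent_mem_edge (hv : IsSimple v) {i : Fin n} {δ : ℝ}
    (hδ : δ ∈ Icc 0 ‖v (i + 1) - v i‖) : v i + δ • tangent v i ∈ edge v i := by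
  rw [mem_edge_iff hv, add_sub_cancel_left, inner_smul_right, inner_smul_right,
    inner_normal_tangent, inner_tangent_self hv, mul_zero, mul_one]
  exact ⟨rfl, hδ⟩

theorem sub_smul_tangent_mem_edge (hv : IsSimple v) {i : Fin n} {δ : ℝ}
    (hδ : δ ∈ Icc 0 ‖v (i + 1) - v i‖) : v (i + 1) - δ • tangent v i ∈ edge v i := by
  have h : v (i + 1) - δ • tangent v i =
      v i + (‖v (i + 1) - v i‖ - δ) • tangent v i := by
    rw [sub_smul, ← hv.sub_eq i]
    ring
  rw [h]
  exact add_smul_tangent_mem_edge hv ⟨by linarith [hδ.2], by linarith [hδ.1]⟩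

/-- Consecutive edges do not run back along each other, so the velocity of their common vertex is not
a junk value. -/
theorem IsSimple.one_add_inner_pos (hv : IsSimple v) (i : Fin n) :
    0 < 1 + inner ℝ (normal v i) (normal v (i + 1)) := by
  have hsq := turn_sq hv i
  set m : ℝ := inner ℝ (normal v i) (normal v (i + 1)) with hm
  by_contra hcon
  push Not at hcon
  have hm1 : m = -1 := by nlinarith [sq_nonneg (turn v i)]
  have hc : turn v i = 0 := by
    rw [hm1] at hsq
    nlinarith
  have ht : tangent v (i + 1) = -tangent v i := by
    have h1 := eq_tangent_add_normal hv i (tangent v (i + 1))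
    rw [inner_normal_tangent_succ, hc, ← inner_normal_eq, ← hm, hm1] at h1
    simpa using h1
  have hL1 := hv.norm_pos i
  have hL2 := hv.norm_pos (i + 1)
  set δ := min ‖v (i + 1) - v i‖ ‖v (i + 1 + 1) - v (i + 1)‖ with hδ
  have hδ0 : 0 < δ := lt_min hL1 hL2
  have hmem : v (i + 1) + δ • tangent v (i + 1) ∈ edge v i ∩ edge v (i + 1) := by
    constructor
    · rw [ht, smul_neg, ← sub_eq_add_neg]
      exact sub_smul_tangent_mem_edge hv ⟨hδ0.le, min_le_left _ _⟩
    · exact add_smul_tangent_mem_edge hv ⟨hδ0.le, min_le_right _ _⟩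
  rw [hv.2.2.1 i, mem_singleton_iff, add_eq_left, smul_eq_zero] at hmem
  rcases hmem with h | h
  · exact hδ0.ne' h
  · have := hv.norm_tangent (i + 1)
    rw [h, norm_zero] at this
    exact zero_ne_one this

theorem inner_normal_drift_succ (hv : IsSimple v) (i : Fin n) :
    inner ℝ (normal v i) (drift v (i + 1)) = 1 := by
  have h := hv.one_add_inner_pos i
  rw [drift_succ, inner_smul_right, inner_add_right, inner_normal_self hv, one_div_mul_cancel h.ne']

theorem inner_normal_drift (hv : IsSimple v) (i : Fin n) :
    inner ℝ (normal v i) (drift v i) = 1 := by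
  obtain ⟨k, rfl⟩ : ∃ k, i = k + 1 := ⟨i - 1, by simp⟩
  have h := hv.one_add_inner_pos k
  rw [drift_succ, inner_smul_right, inner_add_right, inner_normal_self hv,
    real_inner_comm (normal v k), add_comm (inner ℝ (normal v k) (normal v (k + 1))),
    one_div_mul_cancel h.ne']

theorem inner_tangent_drift_succ (v : Fin n → ℂ) (i : Fin n) :
    inner ℝ (tangent v i) (drift v (i + 1)) =
      turn v i / (1 + inner ℝ (normal v i) (normal v (i + 1))) := by
  rw [drift_succ, inner_smul_right, inner_add_right, inner_tangent_normal, zero_add, turn,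
    real_inner_comm (normal v (i + 1)) (tangent v i)]
  ring

theorem inner_tangent_succ_drift_succ (v : Fin n → ℂ) (i : Fin n) :
    inner ℝ (tangent v (i + 1)) (drift v (i + 1)) =
      -turn v i / (1 + inner ℝ (normal v i) (normal v (i + 1))) := by
  rw [drift_succ, inner_smul_right, inner_add_right, inner_tangent_normal, add_zero,
    real_inner_comm (normal v i) (tangent v (i + 1)), inner_normal_tangent_succ]
  ring

/-- The signed length of an edge of the inflated polygon. -/
def signedLength (v : Fin n → ℂ) (i : Fin n) (t : ℝ) : ℝ :=
  ‖v (i + 1) - v i‖ + t * inner ℝ (tangent v i) (drift v (i + 1) - drift v i)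

/-- The edges of the inflated polygon are parallel to the original ones. -/
theorem inflate_sub (hv : IsSimple v) (i : Fin n) (t : ℝ) :
    inflate v t (i + 1) - inflate v t i = signedLength v i t • tangent v i := by
  have h1 := eq_tangent_add_normal hv i (drift v (i + 1) - drift v i)
  have h2 : (inner ℝ (normal v i) (drift v (i + 1) - drift v i) : ℝ) = 0 := by
    rw [inner_sub_right, inner_normal_drift_succ hv, inner_normal_drift hv, sub_self]
  rw [h2, zero_smul, add_zero] at h1
  have h3 : inflate v t (i + 1) - inflate v t i =
      (v (i + 1) - v i) + t • (drift v (i + 1) - drift v i) := by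
    rw [inflate_eq, inflate_eq, smul_sub]
    ring
  rw [h3, signedLength, add_smul, mul_smul, ← h1, ← hv.sub_eq i]

theorem continuous_signedLength (v : Fin n → ℂ) (i : Fin n) : Continuous (signedLength v i) := by
  unfold signedLength
  fun_prop

/-- The inflations of `v` by all parameters up to `T` are polygons. -/
def PolygonUpTo (v : Fin n → ℂ) (T : ℝ) : Prop := ∀ s ∈ Icc 0 T, IsPolygon (inflate v s)

variable {T : ℝ}

theorem PolygonUpTo.isPolygon (h : PolygonUpTo v T) (hT : 0 ≤ T) : IsPolygon v := by
  have := h 0 ⟨le_rfl, hT⟩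
  rwa [inflate_zero] at this

theorem PolygonUpTo.mono (h : PolygonUpTo v T) {s : ℝ} (hs : s ≤ T) : PolygonUpTo v s :=
  fun r hr => h r ⟨hr.1, hr.2.trans hs⟩

/-- No edge shrinks to a point, so no edge reverses its direction. -/
theorem PolygonUpTo.signedLength_pos (h : PolygonUpTo v T) {t : ℝ} (ht : t ∈ Icc 0 T) (i : Fin n) :
    0 < signedLength v i t := by
  have hv := (h.isPolygon (ht.1.trans ht.2)).1
  by_contra hcon
  push Not at hcon
  have h0 : 0 ≤ signedLength v i 0 := by
    rw [signedLength, zero_mul, add_zero]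
    exact norm_nonneg _
  obtain ⟨s, hs, hs0⟩ := intermediate_value_Icc' ht.1 (continuous_signedLength v i).continuousOn
    ⟨hcon, h0⟩
  have hs' := h s ⟨hs.1, hs.2.trans ht.2⟩
  have h1 := inflate_sub hv i s
  rw [hs0, zero_smul] at h1
  exact hs'.1.sub_ne_zero i h1

theorem PolygonUpTo.tangent_inflate (h : PolygonUpTo v T) {t : ℝ} (ht : t ∈ Icc 0 T) (i : Fin n) :
    tangent (inflate v t) i = tangent v i := by
  have hv := (h.isPolygon (ht.1.trans ht.2)).1
  have hpos := h.signedLength_pos ht i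
  rw [tangent, inflate_sub hv, norm_smul, hv.norm_tangent, mul_one, Real.norm_eq_abs,
    abs_of_pos hpos, Complex.real_smul, mul_div_cancel_left₀]
  exact_mod_cast hpos.ne'

theorem PolygonUpTo.normal_inflate (h : PolygonUpTo v T) {t : ℝ} (ht : t ∈ Icc 0 T) (i : Fin n) :
    normal (inflate v t) i = normal v i := by
  rw [normal_eq, normal_eq, h.tangent_inflate ht]

theorem PolygonUpTo.inflate_inflate (h : PolygonUpTo v T) {s : ℝ} (hs : s ∈ Icc 0 T) (t : ℝ) :
    inflate (inflate v s) t = inflate v (s + t) := by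
  ext i
  have hd : drift (inflate v s) i = drift v i := by
    rw [drift, drift, h.normal_inflate hs, h.normal_inflate hs]
  rw [inflate_eq, hd, inflate_eq, inflate_eq, add_smul, add_assoc]

theorem PolygonUpTo.shift (h : PolygonUpTo v T) {s : ℝ} (hs : s ∈ Icc 0 T) :
    PolygonUpTo (inflate v s) (T - s) := by
  intro t ht
  rw [h.inflate_inflate hs]
  exact h _ ⟨add_nonneg hs.1 ht.1, by linarith [ht.2]⟩

/-! ### The distance from the boundary grows with the inflation -/

theorem ball_subset_inside (hq : q ∈ inside v) {d : ℝ} (hd : ∀ x ∈ boundary v, d ≤ ‖x - q‖) :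
    Metric.ball q d ⊆ inside v := by
  intro y hy
  have hdis : Disjoint (Metric.ball q d) (boundary v) := by
    rw [Set.disjoint_left]
    intro x hx hxb
    rw [Metric.mem_ball, dist_eq_norm] at hx
    exact absurd (hd x hxb) (not_le.2 hx)
  have hq' : q ∈ Metric.ball q d := Metric.mem_ball_self (Metric.pos_of_mem_ball hy)
  refine ⟨Set.disjoint_left.1 hdis hy, ?_⟩
  rw [winding_eq_of_isPreconnected (convex_ball q d).isPreconnected hdis hy hq']
  exact hq.2

/-- If `z` is a nearest point of a set that contains an initial part of a ray from `z`, then the ray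
leads away. -/
theorem inner_nonneg_of_nearest {r e : ℂ} {L : ℝ} (hL : 0 < L)
    (h : ∀ δ ∈ Icc 0 L, ‖r‖ ≤ ‖r + δ • e‖) : 0 ≤ inner ℝ e r := by
  by_contra hcon
  push Not at hcon
  have key : ∀ δ ∈ Icc 0 L, 0 ≤ δ * (2 * inner ℝ e r + δ * ‖e‖ ^ 2) := by
    intro δ hδ
    have h1 := h δ hδ
    have h2 : ‖r‖ ^ 2 ≤ ‖r + δ • e‖ ^ 2 := by gcongr
    rw [norm_add_sq_real, inner_smul_right, norm_smul, mul_pow, Real.norm_eq_abs, sq_abs,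
      real_inner_comm] at h2
    nlinarith
  set δ := min L (-inner ℝ e r / (‖e‖ ^ 2 + 1)) with hδ
  have hδ0 : 0 < δ := lt_min hL (div_pos (by linarith) (by positivity))
  have h1 := key δ ⟨hδ0.le, min_le_left _ _⟩
  have h2 : δ * (‖e‖ ^ 2 + 1) ≤ -inner ℝ e r := by
    rw [← le_div_iff₀ (by positivity)]
    exact min_le_right _ _
  have h3 := nonneg_of_mul_nonneg_right h1 hδ0
  nlinarith

theorem turn_smul_eq (v : Fin n → ℂ) (i : Fin n) (r : ℂ) :
    turn v i • r = (inner ℝ (tangent v i) r : ℝ) • normal v (i + 1) -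
      (inner ℝ (tangent v (i + 1)) r : ℝ) • normal v i := by
  rw [turn, inner_eq_re_im, inner_eq_re_im, inner_eq_re_im]
  apply Complex.ext
  · simp [normal_re, normal_im]
    ring
  · simp [normal_re, normal_im]
    ring

/-- If a vertex is the boundary point nearest to an inside point, then its velocity has a component of
at least `1` in the direction away from this point. -/
theorem IsPolygon.norm_le_inner_drift (hv : IsPolygon v) (hq : q ∈ inside v) {i : Fin n}
    (hd : ∀ x ∈ boundary v, ‖v (i + 1) - q‖ ≤ ‖x - q‖) :
    inner ℝ (tangent v i) (v (i + 1) - q) ≤ 0 ∧ 0 ≤ inner ℝ (tangent v (i + 1)) (v (i + 1) - q) ∧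
      ‖v (i + 1) - q‖ ≤ inner ℝ (drift v (i + 1)) (v (i + 1) - q) := by
  set r := v (i + 1) - q with hr
  have hr0 : 0 < ‖r‖ := by
    rw [norm_pos_iff, hr, _root_.sub_ne_zero]
    rintro h
    exact hq.1 (h ▸ vertex_mem_boundary v _)
  have hA : 0 ≤ inner ℝ (tangent v (i + 1)) r := by
    refine inner_nonneg_of_nearest (hv.1.norm_pos (i + 1)) fun δ hδ => ?_
    have : r + δ • tangent v (i + 1) = (v (i + 1) + δ • tangent v (i + 1)) - q := by
      rw [hr]
      ring
    rw [this]
    exact hd _ (edge_subset_boundary v (i + 1) (add_smul_tangent_mem_edge hv.1 hδ))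
  have hB : inner ℝ (tangent v i) r ≤ 0 := by
    rw [← neg_nonneg, ← inner_neg_left]
    refine inner_nonneg_of_nearest (hv.1.norm_pos i) fun δ hδ => ?_
    have : r + δ • -tangent v i = (v (i + 1) - δ • tangent v i) - q := by
      rw [hr, smul_neg]
      ring
    rw [this]
    exact hd _ (edge_subset_boundary v i (sub_smul_tangent_mem_edge hv.1 hδ))
  refine ⟨hB, hA, ?_⟩
  have hn1 : ‖normal v i‖ = 1 := hv.1.norm_normal i
  have hn2 : ‖normal v (i + 1)‖ = 1 := hv.1.norm_normal (i + 1)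
  have hdr : ∀ w : ℂ, inner ℝ (drift v (i + 1)) w =
      (inner ℝ (normal v i) w + inner ℝ (normal v (i + 1)) w) /
        (1 + inner ℝ (normal v i) (normal v (i + 1))) := by
    intro w
    rw [drift_succ, inner_smul_left, inner_add_left]
    simp
    ring
  rcases lt_or_ge (turn v i) 0 with hc | hc
  · -- At a reflex vertex, the point lies in the cone opposite to the two normals.
    set a : ℝ := -inner ℝ (tangent v (i + 1)) r / turn v i with ha
    set b : ℝ := inner ℝ (tangent v i) r / turn v i with hb
    have ha0 : 0 ≤ a := div_nonneg_of_nonpos (by linarith) hc.le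
    have hb0 : 0 ≤ b := div_nonneg_of_nonpos hB hc.le
    have hrab : r = a • normal v i + b • normal v (i + 1) := by
      have h1 := turn_smul_eq v i r
      have h2 : r = (turn v i)⁻¹ • (turn v i • r) := by
        rw [smul_smul, inv_mul_cancel₀ hc.ne, one_smul]
      rw [h1, smul_sub, smul_smul, smul_smul] at h2
      conv_lhs => rw [h2]
      rw [ha, hb, neg_div, neg_smul, div_eq_inv_mul, div_eq_inv_mul]
      abel
    have h3 : inner ℝ (drift v (i + 1)) r = a + b := by
      conv_lhs => rw [hrab]
      rw [inner_add_right, inner_smul_right, inner_smul_right, real_inner_comm,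
        inner_normal_drift_succ hv.1, real_inner_comm, inner_normal_drift hv.1]
      ring
    rw [h3]
    calc ‖r‖ = ‖a • normal v i + b • normal v (i + 1)‖ := by rw [← hrab]
      _ ≤ ‖a • normal v i‖ + ‖b • normal v (i + 1)‖ := norm_add_le _ _
      _ = a + b := by
        rw [norm_smul, norm_smul, hn1, hn2, Real.norm_of_nonneg ha0, Real.norm_of_nonneg hb0]
        ring
  · -- Elsewhere, the segment from the point to the vertex arrives behind the lines of both edges.
    have hseg : ∀ᶠ s : ℝ in 𝓝[>] 0, v (i + 1) + s • -r ∈ region v := by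
      filter_upwards [Ioo_mem_nhdsGT (show (0 : ℝ) < 1 by norm_num)] with s hs
      refine inside_subset_region v (ball_subset_inside hq hd ?_)
      have : v (i + 1) + s • -r - q = (1 - s) • r := by
        rw [sub_smul, one_smul, smul_neg, hr]
        ring
      rw [Metric.mem_ball, dist_eq_norm, this, norm_smul, Real.norm_of_nonneg (by linarith [hs.2])]
      nlinarith [hs.1]
    obtain ⟨s, ⟨hs1, hs2⟩, hs0⟩ := (((add_smul_tendsto (v (i + 1)) (-r)).eventually
      (hv.eventually_inner_nonpos hc)).and hseg).and self_mem_nhdsWithin |>.exists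
    have hs0' : 0 < s := hs0
    obtain ⟨h1, h2⟩ := hs1 hs2
    rw [add_sub_cancel_left, inner_smul_right, inner_neg_right] at h1 h2
    have h1' : 0 ≤ inner ℝ (normal v i) r := by nlinarith
    have h2' : 0 ≤ inner ℝ (normal v (i + 1)) r := by nlinarith
    rcases eq_or_lt_of_le hc with hc0 | hc0
    · have hm : inner ℝ (normal v i) (normal v (i + 1)) = 1 := by
        have h3 := turn_sq hv.1 i
        rw [← hc0] at h3
        have h4 := hv.1.one_add_inner_pos i
        nlinarith
      have hnn : normal v i = normal v (i + 1) :=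
        (inner_eq_one_iff_of_norm_eq_one hn1 hn2).1 hm
      have htt : tangent v i = tangent v (i + 1) := by
        have h5 : ∀ j, tangent v j = Complex.I * normal v j := fun j => by
          rw [normal_eq, ← mul_assoc]
          simp
        rw [h5, h5, hnn]
      have h3 := eq_tangent_add_normal hv.1 (i + 1) r
      have h4 : (inner ℝ (tangent v (i + 1)) r : ℝ) = 0 := le_antisymm (htt ▸ hB) hA
      rw [h4, zero_smul, zero_add] at h3
      have h5 : ‖r‖ = inner ℝ (normal v (i + 1)) r := by
        conv_lhs => rw [h3]
        rw [norm_smul, hn2, mul_one, Real.norm_of_nonneg h2']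
      rw [hdr, hm, hnn, h5]
      linarith
    · exfalso
      have h3 := congrArg (fun w => (inner ℝ r w : ℝ)) (turn_smul_eq v i r)
      simp only [inner_sub_right, inner_smul_right, real_inner_self_eq_norm_sq] at h3
      rw [real_inner_comm (normal v (i + 1)) r, real_inner_comm (normal v i) r] at h3
      have h4 : 0 < turn v i * ‖r‖ ^ 2 := by positivity
      nlinarith [mul_nonneg hA h1', mul_nonneg (neg_nonneg.2 hB) h2']

theorem continuous_inflate (v : Fin n → ℂ) (i : Fin n) : Continuous fun s => inflate v s i := by
  simp only [inflate_eq]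
  fun_prop

/-- The points of an inflated edge, seen from its two end points. -/
theorem exists_of_mem_edge_inflate (hv : IsSimple v) {i : Fin n} {h : ℝ}
    (hl : 0 ≤ signedLength v i h) {x : ℂ} (hx : x ∈ edge (inflate v h) i) :
    ∃ a ≥ (0 : ℝ), ∃ b ≥ (0 : ℝ), x = inflate v h i + a • tangent v i ∧
      x = inflate v h (i + 1) - b • tangent v i := by
  obtain ⟨a, b, ha, hb, hab, rfl⟩ := hx
  have h1 := inflate_sub hv i h
  refine ⟨b * signedLength v i h, by positivity, a * signedLength v i h, by positivity, ?_, ?_⟩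
  · rw [mul_smul, ← h1, smul_sub]
    have : a • inflate v h i = inflate v h i - b • inflate v h i := by
      rw [eq_sub_of_add_eq hab, sub_smul, one_smul]
    rw [this]
    ring
  · rw [mul_smul, ← h1, smul_sub]
    have : b • inflate v h (i + 1) = inflate v h (i + 1) - a • inflate v h (i + 1) := by
      rw [eq_sub_of_add_eq' hab, sub_smul, one_smul]
    rw [this]
    ring

theorem add_le_norm_of_inner {r w : ℂ} {h : ℝ} (hr : 0 < ‖r‖) (hw : ‖r‖ * (‖r‖ + h) ≤ inner ℝ r w) :
    ‖r‖ + h ≤ ‖w‖ :=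
  le_of_mul_le_mul_left (hw.trans (real_inner_le_norm r w)) hr

/-- An edge moves away from an inside point at least as fast as the inflation parameter grows, at the
moments when it contains a nearest boundary point. -/
theorem IsPolygon.eventually_dist_edge (hv : IsPolygon v) (hq : q ∈ inside v) {d : ℝ} (hd0 : 0 < d)
    (hd : ∀ x ∈ boundary v, d ≤ ‖x - q‖) (i : Fin n) :
    ∀ᶠ h : ℝ in 𝓝[>] 0, ∀ x ∈ edge (inflate v h) i, d + h ≤ ‖x - q‖ := by
  obtain ⟨z, hz, hzmin⟩ := (isCompact_edge v i).exists_isMinOn ⟨v i, left_mem_segment ℝ _ _⟩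
    (f := fun x => ‖x - q‖) (by fun_prop)
  have hzmin' : ∀ x ∈ edge v i, ‖z - q‖ ≤ ‖x - q‖ := fun x hx => hzmin hx
  have hdz := hd z (edge_subset_boundary v i hz)
  have hlen : ∀ᶠ h : ℝ in 𝓝[>] 0, 0 ≤ signedLength v i h := by
    have h1 : 0 < signedLength v i 0 := by
      rw [signedLength, zero_mul, add_zero]
      exact hv.1.norm_pos i
    have h2 := (continuous_signedLength v i).continuousAt.eventually (lt_mem_nhds h1)
    exact (h2.filter_mono nhdsWithin_le_nhds).mono fun _ h => h.le
  rcases hdz.eq_or_lt with heq | hlt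
  · have hmin : ∀ x ∈ boundary v, ‖z - q‖ ≤ ‖x - q‖ := fun x hx => heq ▸ hd x hx
    have hzq : 0 < ‖z - q‖ := heq ▸ hd0
    by_cases hz1 : z = v i
    · subst hz1
      obtain ⟨k, rfl⟩ : ∃ k, i = k + 1 := ⟨i - 1, by simp⟩
      obtain ⟨-, h1, h2⟩ := hv.norm_le_inner_drift hq hmin
      filter_upwards [hlen, self_mem_nhdsWithin] with h hh hh0 x hx
      have hh0 : 0 < h := hh0
      obtain ⟨a, ha, -, -, hxa, -⟩ := exists_of_mem_edge_inflate hv.1 hh hx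
      rw [heq]
      refine add_le_norm_of_inner hzq ?_
      have : x - q = (v (k + 1) - q) + h • drift v (k + 1) + a • tangent v (k + 1) := by
        rw [hxa, inflate_eq]
        ring
      rw [this, inner_add_right, inner_add_right, inner_smul_right, inner_smul_right,
        real_inner_self_eq_norm_sq, real_inner_comm (drift v (k + 1)),
        real_inner_comm (tangent v (k + 1))]
      nlinarith [mul_nonneg ha h1, mul_le_mul_of_nonneg_left h2 hh0.le]
    by_cases hz2 : z = v (i + 1)
    · subst hz2
      obtain ⟨h1, -, h2⟩ := hv.norm_le_inner_drift hq hmin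
      filter_upwards [hlen, self_mem_nhdsWithin] with h hh hh0 x hx
      have hh0 : 0 < h := hh0
      obtain ⟨-, -, b, hb, -, hxb⟩ := exists_of_mem_edge_inflate hv.1 hh hx
      rw [heq]
      refine add_le_norm_of_inner hzq ?_
      have : x - q = (v (i + 1) - q) + h • drift v (i + 1) - b • tangent v i := by
        rw [hxb, inflate_eq]
        ring
      rw [this, inner_sub_right, inner_add_right, inner_smul_right, inner_smul_right,
        real_inner_self_eq_norm_sq, real_inner_comm (drift v (i + 1)),
        real_inner_comm (tangent v i)]
      nlinarith [mul_nonneg hb (neg_nonneg.2 h1), mul_le_mul_of_nonneg_left h2 hh0.le]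
    · have hzo : z ∈ openSegment ℝ (v i) (v (i + 1)) :=
        mem_openSegment_of_ne_left_right (Ne.symm hz1) (Ne.symm hz2) hz
      obtain ⟨hn0, ht0, htL⟩ := (mem_openSegment_iff hv.1).1 hzo
      have hmem : ∀ δ : ℝ, inner ℝ (tangent v i) (z - v i) + δ ∈ Icc 0 ‖v (i + 1) - v i‖ →
          ‖z - q‖ ≤ ‖z - q + δ • tangent v i‖ := by
        intro δ hδ
        have : z - q + δ • tangent v i = z + δ • tangent v i - q := by ring
        rw [this]
        refine hzmin' _ ((mem_edge_iff hv.1).2 ?_)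
        rw [add_sub_right_comm, inner_add_right, inner_add_right _ (z - v i), inner_smul_right,
          inner_smul_right, inner_normal_tangent, inner_tangent_self hv.1, hn0, mul_one]
        exact ⟨by ring, hδ⟩
      have hA : 0 ≤ inner ℝ (tangent v i) (z - q) :=
        inner_nonneg_of_nearest (sub_pos.2 htL) fun δ hδ =>
          hmem δ ⟨by linarith [hδ.1], by linarith [hδ.2]⟩
      have hB : 0 ≤ inner ℝ (-tangent v i) (z - q) := by
        refine inner_nonneg_of_nearest ht0 fun δ hδ => ?_
        rw [smul_neg, ← neg_smul]
        exact hmem (-δ) ⟨by linarith [hδ.2], by linarith [hδ.1]⟩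
      rw [inner_neg_left] at hB
      have hr := eq_tangent_add_normal hv.1 i (z - q)
      rw [show (inner ℝ (tangent v i) (z - q) : ℝ) = 0 by linarith, zero_smul, zero_add] at hr
      have hnorm : ‖z - q‖ = |inner ℝ (normal v i) (z - q)| := by
        conv_lhs => rw [hr]
        rw [norm_smul, hv.1.norm_normal, mul_one, Real.norm_eq_abs]
      rcases le_or_gt 0 (inner ℝ (normal v i) (z - q)) with hs | hs
      · rw [abs_of_nonneg hs] at hnorm
        filter_upwards [hlen, self_mem_nhdsWithin] with h hh hh0 x hx
        obtain ⟨a, -, -, -, hxa, -⟩ := exists_of_mem_edge_inflate hv.1 hh hx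
        have hx1 : x - q = (z - q) - (z - v i) + h • drift v i + a • tangent v i := by
          rw [hxa, inflate_eq]
          ring
        have h1 : inner ℝ (normal v i) (x - q) = d + h := by
          rw [hx1, inner_add_right, inner_add_right, inner_sub_right _ (z - q), inner_smul_right,
            inner_smul_right, inner_normal_tangent, inner_normal_drift hv.1, hn0, heq, ← hnorm]
          ring
        have h2 := real_inner_le_norm (normal v i) (x - q)
        rwa [h1, hv.1.norm_normal, one_mul] at h2
      · exfalso
        rw [abs_of_neg hs] at hnorm
        obtain ⟨r, hr0, hball⟩ := hv.exists_ball_edge hzo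
        set τ := min (r / 2) (d / 2) with hτ
        have hτ0 : 0 < τ := lt_min (by linarith) (by linarith)
        have h1 := (hball (z + τ • normal v i) (by
          rw [Metric.mem_ball, dist_eq_norm, add_sub_cancel_left, norm_smul, hv.1.norm_normal,
            mul_one, Real.norm_of_nonneg hτ0.le]
          linarith [min_le_left (r / 2) (d / 2)])).2.1 (by
          rw [add_sub_cancel_left, inner_smul_right, inner_normal_self hv.1]
          linarith)
        refine h1 (inside_subset_region v (ball_subset_inside hq hd ?_))
        have h3 : z + τ • normal v i - q = (τ - d) • normal v i := by
          rw [add_sub_right_comm, hr, ← add_smul, heq, hnorm]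
          ring_nf
        rw [Metric.mem_ball, dist_eq_norm, h3, norm_smul, hv.1.norm_normal, mul_one,
          Real.norm_eq_abs, abs_of_nonpos (by linarith [min_le_right (r / 2) (d / 2)])]
        linarith
  · set M := ‖drift v i‖ + ‖drift v (i + 1)‖ with hM
    have hM0 : 0 ≤ M := by positivity
    have hc : 0 < (‖z - q‖ - d) / (M + 1) := div_pos (by linarith) (by linarith)
    filter_upwards [Ioo_mem_nhdsGT hc] with h hh x hx
    obtain ⟨a, b, ha, hb, hab, rfl⟩ := hx
    have h1 := hzmin' _ ⟨a, b, ha, hb, hab, rfl⟩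
    have h2 : h * (M + 1) ≤ ‖z - q‖ - d := by
      rw [← le_div_iff₀ (by linarith)]
      exact hh.2.le
    have h3 : a • inflate v h i + b • inflate v h (i + 1) - q = (a • v i + b • v (i + 1) - q) -
        -(h • (a • drift v i + b • drift v (i + 1))) := by
      rw [inflate_eq, inflate_eq, smul_add, smul_add, smul_add, smul_comm h a, smul_comm h b]
      ring
    have h4 : ‖a • drift v i + b • drift v (i + 1)‖ ≤ M := by
      refine (norm_add_le _ _).trans (add_le_add ?_ ?_)
      · rw [norm_smul, Real.norm_of_nonneg ha]
        exact mul_le_of_le_one_left (norm_nonneg _) (by linarith)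
      · rw [norm_smul, Real.norm_of_nonneg hb]
        exact mul_le_of_le_one_left (norm_nonneg _) (by linarith)
    have h5 := norm_sub_norm_le (a • v i + b • v (i + 1) - q)
      (-(h • (a • drift v i + b • drift v (i + 1))))
    rw [← h3, norm_neg, norm_smul, Real.norm_of_nonneg hh.1.le] at h5
    nlinarith [mul_le_mul_of_nonneg_left h4 hh.1.le, hh.1]

/-- The distance from an inside point to the boundary grows at least as fast as the inflation
parameter. -/
theorem PolygonUpTo.inside_growth (h : PolygonUpTo v T) (hq : q ∈ inside v) {d : ℝ} (hd0 : 0 < d)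
    (hd : ∀ x ∈ boundary v, d ≤ ‖x - q‖) {s : ℝ} (hs : s ∈ Icc 0 T) :
    q ∈ inside (inflate v s) ∧ ∀ x ∈ boundary (inflate v s), d + s ≤ ‖x - q‖ := by
  set A : Set ℝ := {s | ∀ x ∈ boundary (inflate v s), d + s ≤ ‖x - q‖} ∩ Icc 0 T with hA
  have hAc : IsClosed A := by
    refine IsClosed.inter ?_ isClosed_Icc
    have : {s : ℝ | ∀ x ∈ boundary (inflate v s), d + s ≤ ‖x - q‖} =
        ⋂ (i : Fin n) (a : ℝ) (b : ℝ) (_ : 0 ≤ a ∧ 0 ≤ b ∧ a + b = 1),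
          {s : ℝ | d + s ≤ ‖a • inflate v s i + b • inflate v s (i + 1) - q‖} := by
      ext s
      simp only [mem_ofPred_eq, mem_iInter, boundary, mem_iUnion]
      constructor
      · rintro hx i a b ⟨ha, hb, hab⟩
        exact hx _ ⟨i, a, b, ha, hb, hab, rfl⟩
      · rintro hx _ ⟨i, a, b, ha, hb, hab, rfl⟩
        exact hx i a b ⟨ha, hb, hab⟩
    rw [this]
    refine isClosed_iInter fun i => isClosed_iInter fun a => isClosed_iInter fun b =>
      isClosed_iInter fun _ => isClosed_le (by fun_prop) ?_
    have h1 := continuous_inflate v i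
    have h2 := continuous_inflate v (i + 1)
    fun_prop
  have hAq : ∀ s ∈ A, q ∉ boundary (inflate v s) := by
    intro s hs hqb
    have := hs.1 q hqb
    rw [sub_self, norm_zero] at this
    linarith [hs.2.1]
  have hinf : Continuous fun s : ℝ => inflate v s :=
    continuous_pi fun i => continuous_inflate v i
  have hwc : ∀ s ∈ A, ContinuousAt (fun s => winding (inflate v s) q) s := fun s hs =>
    continuousAt_winding hinf.continuousAt continuousAt_const (hAq s hs)
  set S : Set ℝ := A ∩ (fun s => winding (inflate v s) q) ⁻¹' {winding v q} with hS
  have hSc : IsClosed S :=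
    ContinuousOn.preimage_isClosed_of_isClosed (fun s hs => (hwc s hs).continuousWithinAt) hAc
      (isClosed_discrete _)
  have h0T : (0 : ℝ) ≤ T := hs.1.trans hs.2
  have hsub : Icc 0 T ⊆ S := by
    refine IsClosed.Icc_subset_of_forall_exists_gt ?_ ?_ ?_
    · rwa [inter_eq_left.2 fun s hs => hs.1.2]
    · refine ⟨⟨?_, le_rfl, h0T⟩, ?_⟩
      · simpa only [mem_ofPred_eq, inflate_zero, add_zero] using hd
      · simp only [mem_preimage, inflate_zero, mem_singleton_iff]
    · rintro s ⟨⟨hsA, hsw⟩, hs0, hsT⟩ y hy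
      have hsI : s ∈ Icc 0 T := ⟨hs0, hsT.le⟩
      have hin : q ∈ inside (inflate v s) := by
        refine ⟨hAq s hsA, ?_⟩
        rw [mem_preimage, mem_singleton_iff] at hsw
        rw [hsw]
        exact hq.2
      have hev := eventually_all.2 fun i =>
        (h s hsI).eventually_dist_edge hin (by linarith) hsA.1 i
      have hev2 : ∀ᶠ r : ℝ in 𝓝[>] 0, winding (inflate v (s + r)) q = winding v q := by
        have h1 : ContinuousAt (fun r : ℝ => winding (inflate v (s + r)) q) 0 :=
          continuousAt_winding (hinf.comp (continuous_const_add s)).continuousAt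
            continuousAt_const (by rw [add_zero]; exact hAq s hsA)
        have h2 := h1.eventually_mem ((isOpen_discrete _).mem_nhds (mem_singleton _))
        refine (h2.filter_mono nhdsWithin_le_nhds).mono fun r hr => ?_
        rw [mem_singleton_iff, add_zero] at hr
        exact hr.trans hsw
      have hpos : 0 < min (y - s) (T - s) := lt_min (sub_pos.2 hy) (sub_pos.2 hsT)
      obtain ⟨r, ⟨hr1, hr2⟩, hr3⟩ := ((hev.and hev2).and (Ioo_mem_nhdsGT hpos)).exists
      have hr4 := hr3.2.trans_le (min_le_left _ _)
      have hr5 := hr3.2.trans_le (min_le_right _ _)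
      refine ⟨s + r, ⟨⟨?_, by linarith [hr3.1], by linarith⟩, hr2⟩, by linarith [hr3.1],
        by linarith⟩
      intro x hx
      obtain ⟨i, hi⟩ := mem_iUnion.1 hx
      rw [← h.inflate_inflate hsI] at hi
      linarith [hr1 i x hi]
  obtain ⟨hsA, hsw⟩ := hsub hs
  refine ⟨⟨hAq s hsA, ?_⟩, hsA.1⟩
  rw [mem_preimage, mem_singleton_iff] at hsw
  rw [hsw]
  exact hq.2

/-- The inflation by `s` contains the `s`-neighbourhood of the polygon. -/
theorem PolygonUpTo.closedBall_subset_region (h : PolygonUpTo v T) {s : ℝ} (hs : s ∈ Icc 0 T)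
    (hq : q ∈ region v) : Metric.closedBall q s ⊆ region (inflate v s) := by
  have key : ∀ q ∈ inside v, ∀ w : ℂ, ‖w‖ ≤ s → q + w ∈ region (inflate v s) := by
    intro q hq w hw
    obtain ⟨z, hz, hzmin⟩ := (isCompact_boundary v).exists_isMinOn ⟨v 0, vertex_mem_boundary v 0⟩
      (f := fun x => ‖x - q‖) (by fun_prop)
    have hd0 : 0 < ‖z - q‖ := by
      rw [norm_pos_iff, _root_.sub_ne_zero]
      rintro rfl
      exact hq.1 hz
    obtain ⟨h1, h2⟩ := h.inside_growth hq hd0 (fun x hx => hzmin hx) hs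
    refine inside_subset_region _ (ball_subset_inside h1 h2 ?_)
    rw [Metric.mem_ball, dist_eq_norm, add_sub_cancel_left]
    linarith
  intro p hp
  rw [Metric.mem_closedBall, dist_eq_norm] at hp
  have h1 : MapsTo (fun x => x + (p - q)) (inside v) (region (inflate v s)) :=
    fun x hx => key x hx _ hp
  have h2 := h1.closure (by fun_prop)
    ((h.isPolygon (hs.1.trans hs.2)).region_subset_closure_inside hq)
  rw [(h s hs).isClosed_region.closure_eq] at h2
  simpa using h2

/-! ### Guards of the polygon guard its inflation -/

theorem PolygonUpTo.mem_region_of_near_vertex (h : PolygonUpTo v T) {s : ℝ} (hs : s ∈ Icc 0 T)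
    {j : Fin n} {p : ℂ} (hp : ‖p - inflate v s j‖ ≤ T - s) : p ∈ region (inflate v T) := by
  have h1 := (h.shift hs).closedBall_subset_region
    (right_mem_Icc.2 (sub_nonneg.2 hs.2)) (boundary_subset_region _ (vertex_mem_boundary _ j))
  rw [h.inflate_inflate hs, add_sub_cancel] at h1
  exact h1 (by rwa [Metric.mem_closedBall, dist_eq_norm])

theorem drift_eq_left (hv : IsSimple v) (i : Fin n) : drift v (i + 1) =
    (turn v i / (1 + inner ℝ (normal v i) (normal v (i + 1)))) • tangent v i + normal v i := by
  have h := eq_tangent_add_normal hv i (drift v (i + 1))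
  rwa [inner_tangent_drift_succ, inner_normal_drift_succ hv, one_smul] at h

theorem drift_eq_right (hv : IsSimple v) (i : Fin n) : drift v (i + 1) =
    (-turn v i / (1 + inner ℝ (normal v i) (normal v (i + 1)))) • tangent v (i + 1) +
      normal v (i + 1) := by
  have h := eq_tangent_add_normal hv (i + 1) (drift v (i + 1))
  rwa [inner_tangent_succ_drift_succ, inner_normal_drift hv, one_smul] at h

/-- A new point that was swept over by an edge is the sweep position of a point of the original edge,
or lies near the path of a convex vertex. -/
theorem PolygonUpTo.near_of_mem_edge_inflate (h : PolygonUpTo v T) {s : ℝ} (hs : s ∈ Icc 0 T)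
    {j : Fin n} {p : ℂ} (hp : p ∈ edge (inflate v s) j) :
    (∃ q ∈ region v, ‖p - q‖ ≤ T) ∨
      ∃ i, 0 < turn v i ∧ ∃ r ∈ Icc 0 T, ‖p - inflate v r (i + 1)‖ ≤ T - r := by
  have hv := (h.isPolygon (hs.1.trans hs.2)).1
  obtain ⟨a, ha, b, hb, hpa, hpb⟩ := exists_of_mem_edge_inflate hv (h.signedLength_pos hs j).le hp
  have hnear : ∀ r ∈ Icc 0 s, ∀ i k : Fin n, p - inflate v r i = (s - r) • normal v k →
      ‖p - inflate v r i‖ ≤ T - r := by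
    intro r hr i k hpr
    rw [hpr, norm_smul, hv.norm_normal, mul_one, Real.norm_of_nonneg (sub_nonneg.2 hr.2)]
    linarith [hs.2]
  by_cases hξ0 : inner ℝ (tangent v j) (p - v j) < 0
  · obtain ⟨k, rfl⟩ : ∃ k, j = k + 1 := ⟨j - 1, by simp⟩
    have hm := hv.one_add_inner_pos k
    set m : ℝ := 1 + inner ℝ (normal v k) (normal v (k + 1)) with hmdef
    have hξ : inner ℝ (tangent v (k + 1)) (p - v (k + 1)) = a - s * (turn v k / m) := by
      rw [hpa, inflate_eq, add_sub_right_comm, add_sub_cancel_left, inner_add_right,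
        inner_smul_right, inner_smul_right, inner_tangent_self hv, inner_tangent_succ_drift_succ]
      ring
    rw [hξ] at hξ0
    have hc : 0 < turn v k / m := by
      by_contra hcon
      push Not at hcon
      nlinarith [mul_nonneg hs.1 (neg_nonneg.2 hcon)]
    -- The moment at which the vertex passes behind `p`, in the direction of the normal.
    refine Or.inr ⟨k, (div_pos_iff_of_pos_right hm).1 hc, s - a / (turn v k / m), ?_, ?_⟩
    · have h1 : a / (turn v k / m) ≤ s := by
        rw [div_le_iff₀ hc]
        linarith
      exact ⟨by linarith, by linarith [hs.2, div_nonneg ha hc.le]⟩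
    · have h1 : a / (turn v k / m) ≤ s := by
        rw [div_le_iff₀ hc]
        linarith
      refine hnear _ ⟨by linarith, by linarith [div_nonneg ha hc.le]⟩ _ (k + 1) ?_
      rw [hpa, inflate_eq, inflate_eq, drift_eq_right hv, ← hmdef, neg_div]
      have h2 : a • tangent v (k + 1) =
          (a / (turn v k / m)) • (turn v k / m) • tangent v (k + 1) := by
        rw [smul_smul, div_mul_cancel₀ _ hc.ne']
      rw [h2]
      module
  by_cases hξL : ‖v (j + 1) - v j‖ < inner ℝ (tangent v j) (p - v j)
  · have hm := hv.one_add_inner_pos j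
    set m : ℝ := 1 + inner ℝ (normal v j) (normal v (j + 1)) with hmdef
    have hξ : inner ℝ (tangent v j) (p - v j) =
        ‖v (j + 1) - v j‖ + s * (turn v j / m) - b := by
      have h1 : p - v j = (v (j + 1) - v j) + s • drift v (j + 1) - b • tangent v j := by
        rw [hpb, inflate_eq]
        ring
      rw [h1, inner_sub_right, inner_add_right, inner_smul_right, inner_smul_right,
        inner_tangent_self hv, inner_tangent_drift_succ, inner_tangent_sub hv]
      ring
    rw [hξ] at hξL
    have hc : 0 < turn v j / m := by
      by_contra hcon
      push Not at hcon
      nlinarith [mul_nonneg hs.1 (neg_nonneg.2 hcon)]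
    have h1 : b / (turn v j / m) ≤ s := by
      rw [div_le_iff₀ hc]
      linarith
    refine Or.inr ⟨j, (div_pos_iff_of_pos_right hm).1 hc, s - b / (turn v j / m), ?_, ?_⟩
    · exact ⟨by linarith, by linarith [hs.2, div_nonneg hb hc.le]⟩
    · refine hnear _ ⟨by linarith, by linarith [div_nonneg hb hc.le]⟩ _ j ?_
      rw [hpb, inflate_eq, inflate_eq, drift_eq_left hv, ← hmdef]
      have h2 : b • tangent v j = (b / (turn v j / m)) • (turn v j / m) • tangent v j := by
        rw [smul_smul, div_mul_cancel₀ _ hc.ne']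
      rw [h2]
      module
  · refine Or.inl ⟨p - s • normal v j, boundary_subset_region v (edge_subset_boundary v j
      ((mem_edge_iff hv).2 ⟨?_, ?_⟩)), ?_⟩
    · rw [sub_right_comm, inner_sub_right _ (p - v j), inner_smul_right, inner_normal_self hv,
        hpa, inflate_eq, add_sub_right_comm, add_sub_cancel_left, inner_add_right,
        inner_smul_right, inner_smul_right, inner_normal_tangent, inner_normal_drift hv]
      ring
    · rw [sub_right_comm, inner_sub_right _ (p - v j), inner_smul_right, inner_tangent_normal,
        mul_zero, sub_zero]
      exact ⟨not_lt.1 hξ0, not_lt.1 hξL⟩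
    · rw [sub_sub_cancel, norm_smul, hv.norm_normal, mul_one, Real.norm_of_nonneg hs.1]
      exact hs.2

/-- A point of the inflated polygon is near the polygon, or near the path of a convex vertex. -/
theorem PolygonUpTo.near_of_mem_region (h : PolygonUpTo v T) (hT : 0 ≤ T) {p : ℂ}
    (hp : p ∈ region (inflate v T)) :
    (∃ q ∈ region v, ‖p - q‖ ≤ T) ∨
      ∃ i, 0 < turn v i ∧ ∃ r ∈ Icc 0 T, ‖p - inflate v r (i + 1)‖ ≤ T - r := by
  by_cases hpv : p ∈ region v
  · exact Or.inl ⟨p, hpv, by simpa using hT⟩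
  by_cases hs : ∃ s ∈ Icc 0 T, p ∈ boundary (inflate v s)
  · obtain ⟨s, hs, hps⟩ := hs
    obtain ⟨j, hj⟩ := mem_iUnion.1 hps
    exact h.near_of_mem_edge_inflate hs hj
  · push Not at hs
    have hc : ContinuousOn (fun s => winding (inflate v s) p) (Icc 0 T) := fun s hsI =>
      (continuousAt_winding (continuous_pi fun i => continuous_inflate v i).continuousAt
        continuousAt_const (hs s hsI)).continuousWithinAt
    have h1 := isPreconnected_Icc.constant hc (left_mem_Icc.2 hT) (right_mem_Icc.2 hT)
    rw [inflate_zero, winding_eq_zero_of_notMem_region hpv] at h1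
    rcases (h T ⟨hT, le_rfl⟩).mem_region_iff.1 hp with h2 | h2
    · exact absurd h2 (hs T ⟨hT, le_rfl⟩)
    · exact absurd h1.symm h2

/-- A point that sees a convex vertex lies behind the lines of both of its edges. -/
theorem IsPolygon.inner_nonpos_of_segment_subset (hv : IsPolygon v) {i : Fin n}
    (hc : 0 ≤ turn v i) {g : ℂ} (hg : segment ℝ g (v (i + 1)) ⊆ region v) :
    inner ℝ (normal v i) (g - v (i + 1)) ≤ 0 ∧ inner ℝ (normal v (i + 1)) (g - v (i + 1)) ≤ 0 := by
  obtain ⟨s, h1, hs⟩ := (((add_smul_tendsto (v (i + 1)) (g - v (i + 1))).eventually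
    (hv.eventually_inner_nonpos hc)).and (Ioo_mem_nhdsGT zero_lt_one)).exists
  have hmem : v (i + 1) + s • (g - v (i + 1)) ∈ region v := by
    refine hg ⟨s, 1 - s, hs.1.le, by linarith [hs.2], by ring, ?_⟩
    module
  have h2 := h1 hmem
  rw [add_sub_cancel_left, inner_smul_right, inner_smul_right] at h2
  exact ⟨nonpos_of_mul_nonpos_right h2.1 hs.1, nonpos_of_mul_nonpos_right h2.2 hs.1⟩

theorem turn_smul_eq_tangent (v : Fin n → ℂ) (i : Fin n) (r : ℂ) :
    turn v i • r = (inner ℝ (normal v (i + 1)) r : ℝ) • tangent v i -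
      (inner ℝ (normal v i) r : ℝ) • tangent v (i + 1) := by
  rw [turn, inner_eq_re_im, inner_eq_re_im, inner_eq_re_im]
  apply Complex.ext
  · simp [normal_re, normal_im]
    ring
  · simp [normal_re, normal_im]
    ring

/-- If a guard sees a convex vertex, then after the inflation every nearby point sees the neighbourhood
of the path of this vertex. A segment of sight stays in the convex neighbourhood of the old segment of
sight, or enters the corner cut out by the two shifted edges. -/
theorem PolygonUpTo.segment_subset_of_near_vertex (h : PolygonUpTo v T) (hT : 0 < T) {i : Fin n}
    (hc : 0 < turn v i) {g g' p : ℂ} (hg : segment ℝ g (v (i + 1)) ⊆ region v)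
    (hg' : ‖g' - g‖ ≤ T) {s : ℝ} (hs : s ∈ Icc 0 T) (hp : ‖p - inflate v s (i + 1)‖ ≤ T - s) :
    segment ℝ g' p ⊆ region (inflate v T) := by
  have hv := h.isPolygon hT.le
  have hm := hv.1.one_add_inner_pos i
  set m : ℝ := 1 + inner ℝ (normal v i) (normal v (i + 1)) with hmdef
  set V₀ := v (i + 1) with hV₀
  set V := inflate v T (i + 1) with hV
  have hVeq : V = V₀ + T • drift v (i + 1) := inflate_eq v T (i + 1)
  set S : Set ℂ := segment ℝ g V₀ + Metric.closedBall 0 T with hS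
  have hSc : Convex ℝ S := (convex_segment g V₀).add (convex_closedBall 0 T)
  have hSr : S ⊆ region (inflate v T) := by
    rintro _ ⟨x, hx, u, hu, rfl⟩
    refine h.closedBall_subset_region (right_mem_Icc.2 hT.le) (hg hx) ?_
    rw [Metric.mem_closedBall, dist_eq_norm] at hu ⊢
    simpa using hu
  have hball : ∀ x ∈ segment ℝ g V₀, ∀ y, ‖y - x‖ ≤ T → y ∈ S := fun x hx y hy =>
    ⟨x, hx, y - x, by simpa [Metric.mem_closedBall, dist_eq_norm] using hy, by simp⟩
  obtain ⟨hD1, hD2⟩ := hv.inner_nonpos_of_segment_subset hc.le hg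
  -- The neighbourhood lies behind the shifted lines of the two edges.
  have hhalf : ∀ e : ℂ, ‖e‖ = 1 → inner ℝ e (drift v (i + 1)) = 1 → inner ℝ e (g - V₀) ≤ 0 →
      ∀ y ∈ S, inner ℝ e (y - V) ≤ 0 := by
    rintro e he heD heg _ ⟨x, ⟨a, b, ha, hb, hab, rfl⟩, u, hu, rfl⟩
    rw [Metric.mem_closedBall, dist_zero_right] at hu
    obtain rfl : b = 1 - a := by linarith
    have h1 : a • g + (1 - a) • V₀ + u - V = a • (g - V₀) + u - T • drift v (i + 1) := by
      rw [hVeq]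
      module
    have h2 := real_inner_le_norm e u
    rw [he, one_mul] at h2
    simp only
    rw [h1, inner_sub_right, inner_add_right, inner_smul_right, inner_smul_right, heD]
    nlinarith
  -- `p` lies on a segment from a point `b₀` of the disc around the old vertex to the new vertex. For
  -- `s = T` the quotient is `0`, and `p` is the new vertex.
  set b₀ := V₀ + (T / (T - s)) • (p - inflate v s (i + 1)) with hb₀
  have hb₀S : b₀ ∈ S := by
    refine hball V₀ (right_mem_segment ℝ _ _) _ ?_
    rw [hb₀, add_sub_cancel_left, norm_smul,
      Real.norm_of_nonneg (div_nonneg hT.le (sub_nonneg.2 hs.2))]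
    rcases hs.2.eq_or_lt with hsT | hsT
    · rw [hsT, sub_self, div_zero, zero_mul]
      exact hT.le
    · rw [div_mul_eq_mul_div, div_le_iff₀ (sub_pos.2 hsT)]
      exact mul_le_mul_of_nonneg_left hp hT.le
  have hpseg : p ∈ segment ℝ b₀ V := by
    refine ⟨1 - s / T, s / T, ?_, div_nonneg hs.1 hT.le, by ring, ?_⟩
    · rw [sub_nonneg, div_le_one hT]
      exact hs.2
    · have h1 : (1 - s / T) • (T / (T - s)) • (p - inflate v s (i + 1)) =
          p - inflate v s (i + 1) := by
        rcases hs.2.eq_or_lt with hsT | hsT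
        · rw [hsT, sub_self, norm_le_zero_iff] at hp
          rw [hsT, hp, smul_zero, smul_zero]
        · rw [smul_smul]
          have : (1 - s / T) * (T / (T - s)) = 1 := by
            have := (sub_pos.2 hsT).ne'
            field_simp
          rw [this, one_smul]
      have h2 : (s / T) • T • drift v (i + 1) = s • drift v (i + 1) := by
        rw [smul_smul, div_mul_cancel₀ _ hT.ne']
      rw [hb₀, smul_add, h1, hVeq, smul_add, h2, inflate_eq]
      module
  -- So a point of the segment from `g'` to `p` lies between a point `y` of `S` and the new vertex `V`.
  intro x hx
  have hxhull : x ∈ convexJoin ℝ (segment ℝ g' b₀) {V} := by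
    rw [convexJoin_segment_singleton]
    have hsub : ({g', b₀, V} : Set ℂ) ⊆ convexHull ℝ {g', b₀, V} := subset_convexHull ℝ _
    have hcv := convex_convexHull ℝ ({g', b₀, V} : Set ℂ)
    exact hcv.segment_subset (hsub (by simp))
      (hcv.segment_subset (hsub (by simp)) (hsub (by simp)) hpseg) hx
  obtain ⟨y, hy, V', hV', hxy⟩ := mem_convexJoin.1 hxhull
  rw [mem_singleton_iff] at hV'
  subst hV'
  have hyS : y ∈ S :=
    hSc.segment_subset (hball g (left_mem_segment ℝ _ _) g' hg') hb₀S hy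
  have hA := hhalf _ (hv.1.norm_normal (i + 1)) (inner_normal_drift hv.1 _) hD2 y hyS
  have hB := hhalf _ (hv.1.norm_normal i) (inner_normal_drift_succ hv.1 _) hD1 y hyS
  -- As `y` lies behind both lines, `y - V` is a nonnegative combination of the vectors from `V` to the
  -- two points `V₀ + T • normal`, at which the disc around `V₀` touches the shifted lines.
  set κ : ℝ := T * (turn v i / m) with hκ
  have hκ0 : 0 < κ := mul_pos hT (div_pos hc hm)
  set a : ℝ := -inner ℝ (normal v (i + 1)) (y - V) / (turn v i * κ) with ha
  set b : ℝ := -inner ℝ (normal v i) (y - V) / (turn v i * κ) with hb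
  have ha0 : 0 ≤ a := div_nonneg (by linarith) (by positivity)
  have hb0 : 0 ≤ b := div_nonneg (by linarith) (by positivity)
  have hf1 : T • (normal v i - drift v (i + 1)) = -κ • tangent v i := by
    rw [drift_eq_left hv.1, ← hmdef, hκ]
    module
  have hf2 : T • (normal v (i + 1) - drift v (i + 1)) = κ • tangent v (i + 1) := by
    rw [drift_eq_right hv.1, ← hmdef, hκ, neg_div]
    module
  have hyV : y - V = a • T • (normal v i - drift v (i + 1)) +
      b • T • (normal v (i + 1) - drift v (i + 1)) := by
    have h1 : y - V = (turn v i)⁻¹ • (turn v i • (y - V)) := by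
      rw [smul_smul, inv_mul_cancel₀ hc.ne', one_smul]
    rw [turn_smul_eq_tangent] at h1
    rw [hf1, hf2, smul_smul, smul_smul]
    have h2 : a * -κ = (turn v i)⁻¹ * inner ℝ (normal v (i + 1)) (y - V) := by
      rw [ha]
      field_simp
    have h3 : b * κ = -((turn v i)⁻¹ * inner ℝ (normal v i) (y - V)) := by
      rw [hb]
      field_simp
    rw [h2, h3]
    refine h1.trans ?_
    module
  obtain ⟨l₁, l, hl₁, hl, hl1, rfl⟩ := hxy
  obtain rfl : l = 1 - l₁ := by linarith
  rcases (add_nonneg ha0 hb0).eq_or_lt with hσ | hσ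
  · obtain rfl : y = V := by
      have h1 : a = 0 := by linarith
      have h2 : b = 0 := by linarith
      rw [h1, h2, zero_smul, zero_smul, add_zero, sub_eq_zero] at hyV
      exact hyV
    rw [← add_smul, add_sub_cancel, one_smul]
    exact hSr hyS
  -- The ray from `V` through `y` passes through the point `V₀ + T • e` of the disc. Before this point,
  -- it runs near the path of the vertex, and after it inside `S`.
  set e := (a / (a + b)) • normal v i + (b / (a + b)) • normal v (i + 1) with he
  have he1 : ‖e‖ ≤ 1 := by
    refine (norm_add_le _ _).trans ?_
    rw [norm_smul, norm_smul, hv.1.norm_normal, hv.1.norm_normal,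
      Real.norm_of_nonneg (by positivity), Real.norm_of_nonneg (by positivity), mul_one, mul_one,
      ← add_div, div_self hσ.ne']
  have hyV' : y - V = (a + b) • T • (e - drift v (i + 1)) := by
    have h1 : (a + b) • e = a • normal v i + b • normal v (i + 1) := by
      rw [he, smul_add, smul_smul, smul_smul, mul_div_cancel₀ _ hσ.ne', mul_div_cancel₀ _ hσ.ne']
    have h2 : (a + b) • T • (e - drift v (i + 1)) =
        T • ((a + b) • e) - ((a + b) * T) • drift v (i + 1) := by module
    rw [hyV, h2, h1]
    module
  set ω := l₁ * (a + b) with hω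
  have hx1 : l₁ • y + (1 - l₁) • V = V₀ + ((1 - ω) * T) • drift v (i + 1) + (ω * T) • e := by
    have h1 : l₁ • y + (1 - l₁) • V = V + l₁ • (y - V) := by module
    rw [h1, hyV', hVeq, hω]
    module
  have hω0 : 0 ≤ ω := mul_nonneg hl₁ hσ.le
  rcases le_or_gt ω 1 with hω1 | hω1
  · refine h.mem_region_of_near_vertex (s := (1 - ω) * T) (j := i + 1)
      ⟨mul_nonneg (by linarith) hT.le, by nlinarith⟩ ?_
    rw [hx1, inflate_eq, add_sub_cancel_left, norm_smul, Real.norm_of_nonneg (by positivity)]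
    nlinarith [mul_le_mul_of_nonneg_left he1 (mul_nonneg hω0 hT.le)]
  · have hl2 : ω ≤ a + b := by nlinarith
    refine hSr (hSc.segment_subset (hball V₀ (right_mem_segment ℝ _ _) (V₀ + T • e) ?_) hyS ?_)
    · rw [add_sub_cancel_left, norm_smul, Real.norm_of_nonneg hT.le]
      nlinarith
    · have h1 : 0 < a + b - 1 := by linarith
      refine ⟨(a + b - ω) / (a + b - 1), (ω - 1) / (a + b - 1),
        div_nonneg (by linarith) h1.le, div_nonneg (by linarith) h1.le, ?_, ?_⟩
      · rw [← add_div, div_eq_one_iff_eq h1.ne']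
        ring
      · have h2 : y = V + (a + b) • T • (e - drift v (i + 1)) := by
          rw [← hyV']
          ring
        rw [hx1, h2, hVeq]
        have h3 : (a + b - ω) / (a + b - 1) = 1 - (ω - 1) / (a + b - 1) := by
          field_simp
          ring
        have h4 : (ω - 1) / (a + b - 1) * (a + b - 1) = ω - 1 := div_mul_cancel₀ _ h1.ne'
        rw [h3]
        set c := (ω - 1) / (a + b - 1) with hcdef
        have h5 : ω = 1 + c * (a + b - 1) := by linarith
        rw [h5]
        module

/-- After the inflation by `T`, the guards may be moved by up to `T`. -/
theorem PolygonUpTo.guards_map (h : PolygonUpTo v T) (hT : 0 < T) {G : List ℂ}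
    (hG : Guards G (region v)) {f : ℂ → ℂ} (hf : ∀ g ∈ G, ‖f g - g‖ ≤ T) :
    Guards (G.map f) (region (inflate v T)) := by
  have hTI : T ∈ Icc 0 T := right_mem_Icc.2 hT.le
  constructor
  · intro g' hg'
    obtain ⟨g, hg, rfl⟩ := List.mem_map.1 hg'
    refine h.closedBall_subset_region hTI (hG.1 g hg) ?_
    rw [Metric.mem_closedBall, dist_eq_norm]
    exact hf g hg
  · intro p hp
    rcases h.near_of_mem_region hT.le hp with ⟨q, hq, hpq⟩ | ⟨i, hi, s, hs, hps⟩
    · obtain ⟨g, hg, hgq⟩ := hG.2 q hq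
      refine ⟨f g, List.mem_map_of_mem hg, ?_⟩
      rintro _ ⟨a, b, ha, hb, hab, rfl⟩
      refine h.closedBall_subset_region hTI (hgq ⟨a, b, ha, hb, hab, rfl⟩) ?_
      rw [Metric.mem_closedBall, dist_eq_norm]
      have h1 : a • f g + b • p - (a • g + b • q) = a • (f g - g) + b • (p - q) := by module
      rw [h1]
      refine (norm_add_le _ _).trans ?_
      rw [norm_smul, norm_smul, Real.norm_of_nonneg ha, Real.norm_of_nonneg hb]
      nlinarith [mul_le_mul_of_nonneg_left (hf g hg) ha, mul_le_mul_of_nonneg_left hpq hb]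
    · obtain ⟨g, hg, hgq⟩ := hG.2 _ (boundary_subset_region v (vertex_mem_boundary v (i + 1)))
      exact ⟨f g, List.mem_map_of_mem hg,
        h.segment_subset_of_near_vertex hT hi hgq (hf g hg) hs hps⟩

/-! ### Every point of a polygon sees a vertex -/

theorem IsPolygon.inner_nonpos_of_segment (hv : IsPolygon v) {k : Fin n} {x y : ℂ}
    (hx : x ∈ openSegment ℝ (v k) (v (k + 1))) (hs : segment ℝ x y ⊆ region v) :
    inner ℝ (normal v k) (y - x) ≤ 0 := by
  obtain ⟨r, hr, hball⟩ := hv.exists_ball_edge hx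
  obtain ⟨s, h1, h2⟩ := (((add_smul_tendsto x (y - x)).eventually_mem
    (Metric.ball_mem_nhds x hr)).and (Ioo_mem_nhdsGT zero_lt_one)).exists
  by_contra hcon
  push Not at hcon
  refine (hball _ h1).2.1 ?_ (hs ⟨1 - s, s, by linarith [h2.2], h2.1.le, by ring, by module⟩)
  rw [add_sub_cancel_left, inner_smul_right]
  exact mul_pos h2.1 hcon

/-- An open segment of sight that meets the boundary in a point other than a vertex runs along an edge,
so it contains a vertex. -/
theorem IsPolygon.exists_vertex_of_mem_edge (hv : IsPolygon v) {p x : ℂ} (hq : q ∉ boundary v)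
    (hs : segment ℝ q p ⊆ region v) (hx : x ∈ openSegment ℝ q p) (hxb : x ∈ boundary v) :
    ∃ j, segment ℝ q (v j) ⊆ region v := by
  obtain ⟨k, hk⟩ := mem_iUnion.1 hxb
  have hxs := openSegment_subset_segment ℝ _ _ hx
  have hqx : segment ℝ q x ⊆ region v :=
    ((convex_segment q p).segment_subset (left_mem_segment ℝ _ _) hxs).trans hs
  by_cases h1 : x = v k
  · exact ⟨k, h1 ▸ hqx⟩
  by_cases h2 : x = v (k + 1)
  · exact ⟨k + 1, h2 ▸ hqx⟩
  have hxo : x ∈ openSegment ℝ (v k) (v (k + 1)) :=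
    mem_openSegment_of_ne_left_right (Ne.symm h1) (Ne.symm h2) hk
  have h3 := hv.inner_nonpos_of_segment hxo (y := q) (segment_symm ℝ q x ▸ hqx)
  have h4 := hv.inner_nonpos_of_segment hxo (y := p)
    (((convex_segment q p).segment_subset hxs (right_mem_segment ℝ _ _)).trans hs)
  have h5 : inner ℝ (normal v k) (q - x) = 0 := by
    obtain ⟨a, b, ha, hb, hab, hxe⟩ := hx
    have h6 : a • (q - x) + b • (p - x) = 0 := by
      have : a • (q - x) + b • (p - x) = (a • q + b • p) - (a + b) • x := by module
      rw [this, hxe, hab, one_smul, sub_self]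
    have h7 := congrArg (fun w => (inner ℝ (normal v k) w : ℝ)) h6
    simp only [inner_add_right, inner_smul_right, inner_zero_right] at h7
    nlinarith
  obtain ⟨hx0, hx1, hx2⟩ := (mem_openSegment_iff hv.1).1 hxo
  have hq0 : inner ℝ (normal v k) (q - v k) = 0 := by
    rw [← sub_add_sub_cancel q x (v k), inner_add_right, h5, hx0, add_zero]
  have hqt := eq_tangent_add_normal hv.1 k (q - v k)
  have hxt := eq_tangent_add_normal hv.1 k (x - v k)
  rw [hq0, zero_smul, add_zero, sub_eq_iff_eq_add] at hqt
  rw [hx0, zero_smul, add_zero, sub_eq_iff_eq_add] at hxt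
  have hL := hv.1.sub_eq k
  set ξ : ℝ := inner ℝ (tangent v k) (q - v k) with hξ
  set η : ℝ := inner ℝ (tangent v k) (x - v k) with hη
  set L := ‖v (k + 1) - v k‖
  -- The points of the line between the two abscissae are points of the segment.
  have hmem : ∀ c : ℝ, min ξ η ≤ c → c ≤ max ξ η → ξ ≠ η →
      v k + c • tangent v k ∈ segment ℝ q x := by
    intro c hc1 hc2 hne
    have hne' : η - ξ ≠ 0 := sub_ne_zero.2 (Ne.symm hne)
    refine ⟨1 - (c - ξ) / (η - ξ), (c - ξ) / (η - ξ), ?_, ?_, by ring, ?_⟩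
    · rw [sub_nonneg]
      rcases lt_or_gt_of_ne hne with hlt | hlt
      · rw [div_le_one (by linarith)]
        rw [max_eq_right hlt.le] at hc2
        linarith
      · rw [div_le_one_of_neg (by linarith)]
        rw [min_eq_right hlt.le] at hc1
        linarith
    · rcases lt_or_gt_of_ne hne with hlt | hlt
      · rw [min_eq_left hlt.le] at hc1
        exact div_nonneg (by linarith) (by linarith)
      · rw [max_eq_left hlt.le] at hc2
        exact div_nonneg_of_nonpos (by linarith) (by linarith)
    · have h6 : (c - ξ) / (η - ξ) * (η - ξ) = c - ξ := div_mul_cancel₀ _ hne'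
      set l := (c - ξ) / (η - ξ)
      have h7 : c = l * (η - ξ) + ξ := by linarith
      rw [hqt, hxt, h7]
      module
  have hqe : ¬ (0 ≤ ξ ∧ ξ ≤ L) := fun h =>
    hq (edge_subset_boundary v k ((mem_edge_iff hv.1).2 ⟨hq0, h⟩))
  rcases lt_or_ge ξ 0 with h6 | h6
  · refine ⟨k, ((convex_segment q x).segment_subset (left_mem_segment ℝ _ _) ?_).trans hqx⟩
    have := hmem 0 ((min_le_left _ _).trans h6.le) (hx1.le.trans (le_max_right _ _)) (by linarith)
    rwa [zero_smul, add_zero] at this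
  · have h7 : L < ξ := not_le.1 fun h => hqe ⟨h6, h⟩
    refine ⟨k + 1, ((convex_segment q x).segment_subset (left_mem_segment ℝ _ _) ?_).trans hqx⟩
    have := hmem L ((min_le_right _ _).trans hx2.le) (h7.le.trans (le_max_left _ _)) (by linarith)
    rwa [← hL, add_sub_cancel] at this

/-- A segment of sight from `q` to a boundary point can be rotated around `q`, with its end running
along an edge, as long as it meets no vertex. -/
theorem IsPolygon.exists_vertex_visible (hv : IsPolygon v) (hq : q ∈ region v) :
    ∃ j, segment ℝ q (v j) ⊆ region v := by
  by_cases hqb : q ∈ boundary v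
  · obtain ⟨j, hj⟩ := mem_iUnion.1 hqb
    exact ⟨j, ((convex_segment _ _).segment_subset hj (left_mem_segment ℝ _ _)).trans
      ((edge_subset_boundary v j).trans (boundary_subset_region v))⟩
  have hqi : q ∈ inside v := ⟨hqb, (hv.mem_region_iff.1 hq).resolve_left hqb⟩
  by_contra hcon
  obtain ⟨z, hz, hzmin⟩ := (isCompact_boundary v).exists_isMinOn ⟨v 0, vertex_mem_boundary v 0⟩
    (f := fun x => ‖x - q‖) (by fun_prop)
  have hzmin' : ∀ x ∈ boundary v, ‖z - q‖ ≤ ‖x - q‖ := fun x hx => hzmin hx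
  have hd0 : 0 < ‖z - q‖ := by
    rw [norm_pos_iff, _root_.sub_ne_zero]
    rintro rfl
    exact hqb hz
  obtain ⟨j, hj⟩ := mem_iUnion.1 hz
  set p : ℝ → ℂ := fun t => z + t • (v (j + 1) - z) with hp
  have hpc : Continuous p := by fun_prop
  set S : Set ℝ := {t | ∀ b ∈ Icc (0 : ℝ) 1, (1 - b) • q + b • p t ∈ region v} with hS
  have hSseg : ∀ t ∈ S, segment ℝ q (p t) ⊆ region v := by
    rintro t ht _ ⟨a, b, ha, hb, hab, rfl⟩
    obtain rfl : a = 1 - b := by linarith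
    exact ht b ⟨hb, by linarith⟩
  have hpe : ∀ t ∈ Icc (0 : ℝ) 1, p t ∈ edge v j := by
    intro t ht
    refine (convex_segment _ _).segment_subset hj (right_mem_segment ℝ _ _)
      ⟨1 - t, t, by linarith [ht.2], ht.1, by ring, ?_⟩
    rw [hp]
    module
  have hSc : IsClosed S := by
    have : S = ⋂ b ∈ Icc (0 : ℝ) 1, (fun t => (1 - b) • q + b • p t) ⁻¹' region v := by
      ext t
      simp [hS]
    rw [this]
    exact isClosed_biInter fun b _ => hv.isClosed_region.preimage (by fun_prop)
  have hsub : Icc (0 : ℝ) 1 ⊆ S := by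
    refine IsClosed.Icc_subset_of_forall_exists_gt (hSc.inter isClosed_Icc) ?_ ?_
    · intro b hb
      have hp0 : p 0 = z := by simp [hp]
      rw [hp0]
      rcases hb.2.eq_or_lt with rfl | hb1
      · simpa using boundary_subset_region v hz
      · refine inside_subset_region v (ball_subset_inside hqi hzmin' ?_)
        have : (1 - b) • q + b • z - q = b • (z - q) := by module
        rw [Metric.mem_ball, dist_eq_norm, this, norm_smul, Real.norm_of_nonneg hb.1]
        exact mul_lt_of_lt_one_left hd0 hb1
    · rintro t ⟨htS, ht0, ht1⟩ y hy
      have hseg := hSseg t htS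
      have hpo : p t ∈ openSegment ℝ (v j) (v (j + 1)) := by
        refine mem_openSegment_of_ne_left_right ?_ ?_ (hpe t ⟨ht0, ht1.le⟩)
        · intro h
          exact hcon ⟨j, h ▸ hseg⟩
        · intro h
          exact hcon ⟨j + 1, h ▸ hseg⟩
      have hnp := hv.inner_nonpos_of_segment hpo (y := q) (segment_symm ℝ q (p t) ▸ hseg)
      have hloc : ∀ b ∈ Icc (0 : ℝ) 1, ∀ᶠ w : ℝ × ℝ in 𝓝 (t, b), w.1 < 1 → t < w.1 →
          w.2 ∈ Icc (0 : ℝ) 1 → (1 - w.2) • q + w.2 • p w.1 ∈ region v := by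
        intro b hb
        have hc : ContinuousAt (fun w : ℝ × ℝ => (1 - w.2) • q + w.2 • p w.1) (t, b) := by
          fun_prop
        rcases hb.2.eq_or_lt with rfl | hb1
        · obtain ⟨r, hr, hball⟩ := hv.exists_ball_edge hpo
          have hc' : (1 - (1 : ℝ)) • q + (1 : ℝ) • p t = p t := by simp
          have hnear := hc.eventually_mem (by
            show Metric.ball (p t) r ∈ 𝓝 ((1 - (1 : ℝ)) • q + (1 : ℝ) • p t)
            rw [hc']
            exact Metric.ball_mem_nhds _ hr)
          filter_upwards [hnear] with w hw hw1 hw2 hw3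
          have h1 : inner ℝ (normal v j) (p w.1 - p t) = 0 := by
            have h2 := ((mem_edge_iff hv.1).1 (hpe w.1 ⟨ht0.trans hw2.le, hw1.le⟩)).1
            have h3 := ((mem_edge_iff hv.1).1 (hpe t ⟨ht0, ht1.le⟩)).1
            rw [← sub_sub_sub_cancel_right (p w.1) (p t) (v j), inner_sub_right _ (p w.1 - v j),
              h2, h3, sub_self]
          have h2 : inner ℝ (normal v j) ((1 - w.2) • q + w.2 • p w.1 - p t) ≤ 0 := by
            have h3 : (1 - w.2) • q + w.2 • p w.1 - p t =
                (1 - w.2) • (q - p t) + w.2 • (p w.1 - p t) := by module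
            rw [h3, inner_add_right, inner_smul_right, inner_smul_right, h1, mul_zero, add_zero]
            exact mul_nonpos_of_nonneg_of_nonpos (by linarith [hw3.2]) hnp
          obtain ⟨h3, -, h4⟩ := hball _ hw
          rcases h2.eq_or_lt with h5 | h5
          · exact boundary_subset_region v (h3.2 h5)
          · exact mem_region_of_winding_ne_zero (by rw [h4 h5]; exact one_ne_zero)
        · have hin : (1 - b) • q + b • p t ∈ inside v := by
            have hnb : (1 - b) • q + b • p t ∉ boundary v := by
              rcases hb.1.eq_or_lt with rfl | hb0
              · simpa using hqb
              · intro h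
                exact hcon (hv.exists_vertex_of_mem_edge hqb hseg
                  ⟨1 - b, b, by linarith, hb0, by ring, rfl⟩ h)
            exact ⟨hnb, (hv.mem_region_iff.1 (htS b hb)).resolve_left hnb⟩
          filter_upwards [hc.eventually_mem ((isOpen_inside v).mem_nhds hin)] with w hw _ _ _
          exact inside_subset_region v hw
      have hev := isCompact_Icc.eventually_forall_of_forall_eventually
        (P := fun s b => s < 1 → t < s → b ∈ Icc (0 : ℝ) 1 → (1 - b) • q + b • p s ∈ region v) hloc
      obtain ⟨s, hs1, hs2⟩ := ((hev.filter_mono nhdsWithin_le_nhds).and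
        (Ioo_mem_nhdsGT (lt_min (show t < y from hy) ht1))).exists
      exact ⟨s, fun b hb => hs1 b hb (hs2.2.trans_le (min_le_right _ _)) hs2.1 hb, hs2.1,
        (hs2.2.trans_le (min_le_left _ _)).le⟩
  have h1 := hSseg 1 (hsub ⟨zero_le_one, le_rfl⟩)
  refine hcon ⟨j + 1, ?_⟩
  simpa [hp] using h1

/-- The vertices form a set of guards, so solutions exist and the optimum is at most `n`. -/
theorem IsPolygon.guards_vertices (hv : IsPolygon v) : Guards (List.ofFn v) (region v) := by
  constructor
  · intro g hg
    obtain ⟨i, rfl⟩ := (List.mem_ofFn' _ _).1 hg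
    exact boundary_subset_region v (vertex_mem_boundary v i)
  · intro q hq
    obtain ⟨j, hj⟩ := hv.exists_vertex_visible hq
    exact ⟨v j, (List.mem_ofFn' _ _).2 ⟨j, rfl⟩, segment_symm ℝ q (v j) ▸ hj⟩

/-! ### The art gallery problem -/

variable {R : ℝ}

theorem polygonUpTo_of_mem_dom {I : Input} {α : ℝ} (hα : α ∈ (problem R).dom I) :
    PolygonUpTo I.v α := fun s hs => (hα.2 s hs).1

theorem ordConnected_dom (I : Input) : ((problem R).dom I).OrdConnected := by
  refine ⟨fun a ha b hb c hc => ⟨⟨ha.1.1.trans hc.1, hc.2.trans hb.1.2⟩, fun s hs => ?_⟩⟩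
  exact hb.2 s ⟨hs.1, hs.2.trans hc.2⟩

theorem vertices_mem_sol {I : Input} {α : ℝ} (hα : α ∈ (problem R).dom I) :
    List.ofFn (inflate I.v α) ∈ (problem R).sol I α :=
  (hα.2 α ⟨hα.1.1, le_rfl⟩).1.guards_vertices

theorem exists_isOptimal (I : Input) {α : ℝ} (hα : α ∈ (problem R).dom I) :
    ∃ x, (problem R).IsOptimal I α x := by
  refine (problem R).exists_isOptimal ⟨_, vertices_mem_sol hα⟩ (N := 0) fun x _ => ?_
  simp [AugmentationProblem.score, problem]

/-- Moving the guards by up to the increase of the parameter turns a solution into a solution. -/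
theorem map_mem_sol {I : Input} {α ε : ℝ} (hα : α ∈ (problem R).dom I) (hε : 0 < ε)
    (hαε : α + ε ∈ (problem R).dom I) {G : List ℂ} (hG : Guards G (region (inflate I.v α))) {f : ℂ → ℂ}
    (hf : ∀ g ∈ G, ‖f g - g‖ ≤ ε) :
    Guards (G.map f) (region (inflate I.v (α + ε))) := by
  have h := polygonUpTo_of_mem_dom hαε
  have hαI : α ∈ Icc 0 (α + ε) := ⟨hα.1.1, by linarith⟩
  have h1 := h.shift hαI
  rw [add_sub_cancel_left] at h1
  have h2 := h1.guards_map hε hG hf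
  rwa [h.inflate_inflate hαI] at h2

theorem isMonotone : (problem R).IsMonotone := by
  intro (I : Input) α hα α' hα' hle (G : List ℂ) (hG : Guards G _)
  rcases hle.eq_or_lt with rfl | hlt
  · exact hG
  · have h := map_mem_sol hα (sub_pos.2 hlt) (by rwa [add_sub_cancel]) hG (f := id) fun g _ => by
      simpa using hle
    rw [add_sub_cancel, List.map_id] at h
    exact h

theorem isModerate : (problem R).IsModerate := by
  refine ⟨4, fun (I : Input) => ?_⟩
  have h := AugmentationProblem.encard_breakpoints_le (P := problem R) isMonotone
    (fun I _ hα => exists_isOptimal I hα) (ordConnected_dom I) (N := I.n) fun α hα => ?_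
  · refine h.trans ?_
    have h1 : 0 < I.n := Nat.pos_of_ne_zero I.pos.out
    have h2 : I.n ≤ I.n ^ 4 := Nat.le_self_pow (by norm_num) _
    exact_mod_cast (show I.n + 3 ≤ 4 * I.n ^ 4 by omega)
  · have h1 : (problem R).opt I α ≤ (List.ofFn (inflate I.v α)).length :=
      Nat.sInf_le ⟨_, vertices_mem_sol hα, rfl⟩
    rwa [List.length_ofFn] at h1

/-- The guards are rounded to a grid of width at most `ε / 2`. -/
theorem isSmoothable : (problem R).IsSmoothable := by
  obtain ⟨B, hB⟩ : ∃ B : ℕ, |R| ≤ 2 ^ B := by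
    obtain ⟨B, hB⟩ := exists_nat_ge |R|
    exact ⟨B, hB.trans (by exact_mod_cast (Nat.lt_two_pow_self (n := B)).le)⟩
  refine ⟨B + 9, fun A (I : Input) α ε hα hε hαε (G : List ℂ) hG => ?_⟩
  have hε1 : ε ≤ 1 := by linarith [hα.1.1, hαε.1.2]
  obtain ⟨k, hk, hk'⟩ := exists_half_pow_le (show 0 < ε / 2 by linarith) (by linarith)
  have hround : ∀ z : ℂ, ∃ p q : ℚ, (ratBits p ≤ B + 2 * k + 3 ∧ ratBits q ≤ B + 2 * k + 3) ∧
      (z ∈ square (-R) R → ‖(⟨p, q⟩ : ℂ) - z‖ ≤ ε) := by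
    intro z
    by_cases hz : z ∈ square (-R) R
    · have hR := le_abs_self R
      obtain ⟨p, hp, hp'⟩ := exists_shortRat_near (x := z.re) (A := B) k
        (abs_le.2 ⟨by linarith [hz.1.1], by linarith [hz.1.2]⟩)
      obtain ⟨q, hq, hq'⟩ := exists_shortRat_near (x := z.im) (A := B) k
        (abs_le.2 ⟨by linarith [hz.2.1], by linarith [hz.2.2]⟩)
      refine ⟨p, q, ⟨hp', hq'⟩, fun _ => ?_⟩
      refine (Complex.norm_le_abs_re_add_abs_im _).trans ?_
      simp only [Complex.sub_re, Complex.sub_im]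
      linarith
    · have h0 : ratBits 0 = 2 := by simp [ratBits, intBits]
      exact ⟨0, 0, ⟨by omega, by omega⟩, fun h => absurd h hz⟩
  choose p q hbits hpq using hround
  have hsol := map_mem_sol hα hε hαε hG.1 (f := fun z => ⟨p z, q z⟩) fun g hg =>
    hpq g ((hα.2 α ⟨hα.1.1, le_rfl⟩).2 (hG.1.1 g hg))
  refine ⟨_, hsol, AugmentationProblem.atLeastAsGood_iff.2 (le_of_eq ?_), ?_⟩
  · exact congrArg (problem R).score (List.length_map _).symm
  · have hbit := AugmentationProblem.bitIn_le_of_rational (P := problem R) A I (α + ε)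
      (G.map fun z => ⟨p z, q z⟩ : List ℂ) (l := G.flatMap fun z => [p z, q z])
      (m := B + 2 * k + 3)
      (by
        have h1 : (G.map fun z => (⟨p z, q z⟩ : ℂ)).flatMap coords =
            (G.flatMap fun z => [p z, q z]).map fun q : ℚ => (q : ℝ) := by
          rw [List.flatMap_map, List.map_flatMap]
          rfl
        exact h1)
      (by
        intro r hr
        obtain ⟨z, -, hz⟩ := List.mem_flatMap.1 hr
        simp only [List.mem_cons, List.not_mem_nil, or_false] at hz
        rcases hz with rfl | rfl
        exacts [(hbits z).1, (hbits z).2])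
      (by
        intro z hz
        exact absurd hz (List.not_mem_nil))
    have hn3 : (3 : ℝ) ≤ I.n := by
      exact_mod_cast (hα.2 α ⟨hα.1.1, le_rfl⟩).1.1.1
    have hM1 : 1 ≤ Real.logb 2 (I.n / ε) := by
      rw [Real.le_logb_iff_rpow_le (by norm_num) (by positivity), Real.rpow_one, le_div_iff₀ hε]
      linarith
    have hlog : Real.logb 2 (1 / (ε / 2)) ≤ Real.logb 2 (I.n / ε) := by
      apply Real.logb_le_logb_of_le (by norm_num) (by positivity)
      rw [one_div_div]
      gcongr
      linarith
    have hm : ((B + 2 * k + 3 : ℕ) : ℝ) ≤ (B + 9 : ℕ) * Real.logb 2 (I.n / ε) := by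
      push_cast
      nlinarith [Nat.cast_nonneg (α := ℝ) B]
    calc (((problem R).bitIn A I (α + ε) (G.map fun z => ⟨p z, q z⟩ : List ℂ) : ℕ∞) : ℝ≥0∞)
        ≤ ((B + 2 * k + 3 : ℕ) : ℝ≥0∞) := by exact_mod_cast hbit
      _ = ENNReal.ofReal ((B + 2 * k + 3 : ℕ) : ℝ) := (ENNReal.ofReal_natCast _).symm
      _ ≤ _ := ENNReal.ofReal_le_ofReal hm

end ArtGallery

end

theorem mainTheorem8 :
    (∀ R : ℝ,
      (ArtGallery.problem R).IsMonotone ∧ (ArtGallery.problem R).IsModerate ∧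
        (ArtGallery.problem R).IsSmoothable ∧ (ArtGallery.problem R).HasLogSmoothedBit) ∧
    ∀ Apart : Set ℂ → Set ℂ → Prop,
      (Apart = (fun X Y => Disjoint X Y) ∨
        Apart = (fun X Y => Disjoint (interior X) (interior Y))) →
      (Packing.problem Apart).IsMonotone ∧ (Packing.problem Apart).IsModerate ∧
        (Packing.problem Apart).IsSmoothable ∧ (Packing.problem Apart).HasLogSmoothedBit := by
  refine ⟨fun R => ⟨ArtGallery.isMonotone, ArtGallery.isModerate, ArtGallery.isSmoothable,
    AugmentationProblem.hasLogSmoothedBit ArtGallery.isMonotone ArtGallery.isModerate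
      ArtGallery.isSmoothable fun I _ hα => ArtGallery.exists_isOptimal I hα⟩, ?_⟩
  rintro Apart hApart
  have h₁ : ∀ X Y, Apart X Y → Disjoint (interior X) (interior Y) := by
    rcases hApart with rfl | rfl
    · exact fun X Y h => h.mono interior_subset interior_subset
    · exact fun X Y h => h
  have h₂ : ∀ X Y, Disjoint X Y → Apart X Y := by
    rcases hApart with rfl | rfl
    · exact fun X Y h => h
    · exact fun X Y h => h.mono interior_subset interior_subset
  have hs := Packing.isSmoothable h₁ h₂
  exact ⟨Packing.isMonotone, Packing.isModerate, hs,
    AugmentationProblem.hasLogSmoothedBit Packing.isMonotone Packing.isModerate hs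
      fun I α _ => Packing.exists_isOptimal I α⟩
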